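/- Let $n\ge 1$ and let $\mathbb H^n=\mathbb C^n\times\mathbb R$ be the Heisenberg group with product $[z,t]*[z',t']=[z+z',\,t+t'+\operatorname{Im}\sum_k z_k\bar z_k']$, with the left-invariant Riemannian metric $g$ for which $X_k=\partial_{x_k}+y_k\partial_t$, $Y_k=\partial_{y_k}-x_k\partial_t$, $T=\partial_t$ $(1\le k\le n)$ are orthonormal, and with the horizontal distribution spanned by the $X_k,Y_k$. For an immersed $C^2$ hypersurface with local unit normal $N$, let $N_H$ be the horizontal part of $N$; at the regular points, where $N_H\ne0$, the mean curvature $H$ is defined by $-2nH=\operatorname{div}_\Sigma(N_H/|N_H|)$, where $\operatorname{div}_\Sigma$ is the divergence relative to the hypersurface with respect to the Levi-Civita connection of $g$. The hypersurface is minimal if $H=0$ at all its regular points. It is a hypersurface of revolution if it is invariant under the rotations $(z,t)\mapsto(Rz,t)$, $R\in SO(2n)$, that is, if for every such rotation $\rho$ the immersion $f:M\to\mathbb H^n$ satisfies $f\circ\psi=\rho\circ f$ for some $C^2$ diffeomorphism $\psi$ of $M$. For $c\in\mathbb R$ let $P_c=\{t=c\}$ be the Euclidean hyperplane orthogonal to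 the $t$-axis, and for $E>0$, $c\in\mathbb R$ let $C_{E,c}$ be the catenoidal type hypersurface $$C_{E,c}=\Big\{(z,t):\ |z|\ge E^{\frac1{2n-1}},\quad |t-c|=\int_{E^{1/(2n-1)}}^{|z|}\frac{E\,r}{\sqrt{r^{4n-2}-E^2}}\,dr\Big\}.$$ Let $f:M\to\mathbb H^n$ be a $C^2$ immersion of a connected (Hausdorff, second countable) $2n$-dimensional $C^2$ manifold which is a minimal hypersurface of revolution about the $t$-axis. Then either $f(M)\subseteq P_c$ for some $c$, with equality if the metric induced from $g$ is complete; or $f(M)\subseteq C_{E,c}$ for some $E>0$ and some $c$, with equality if the induced metric is complete. Conversely, every $P_c$ and every $C_{E,c}$ ($E>0$, $c\in\mathbb R$) is a connected, complete, embedded $C^2$ minimal hypersurface of revolution about the $t$-axis. -/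

import Mathlib

open scoped Manifold ContDiff

noncomputable section

namespace Heisenberg

/-- The space `ℝ^{2n+1} = ℂⁿ × ℝ` underlying the Heisenberg group, with its usual Euclidean norm.
The same space serves for the coefficients `(a + i b, c)` of a tangent vector
`∑ aₖ Xₖ + bₖ Yₖ + c T` in the left-invariant frame, for which the Euclidean inner product is the
left-invariant Riemannian metric. -/
abbrev Space (n : ℕ) : Type := WithLp 2 (EuclideanSpace ℂ (Fin n) × ℝ)

/-- `Im (∑ₖ zₖ conj(wₖ))`. -/
def symp {n : ℕ} (z w : EuclideanSpace ℂ (Fin n)) : ℝ :=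
  (∑ k, z k * (starRingEnd ℂ) (w k)).im

/-- The product of the Heisenberg group. -/
def mul {n : ℕ} (p q : Space n) : Space n :=
  WithLp.toLp 2 (p.fst + q.fst, p.snd + q.snd + symp p.fst q.fst)

/-- The value at `p` of the left-invariant field `∑ aₖ Xₖ + bₖ Yₖ + c T`, `u = (a + i b, c)`, where
`Xₖ = ∂/∂xₖ + yₖ ∂/∂t`, `Yₖ = ∂/∂yₖ - xₖ ∂/∂t`, `T = ∂/∂t`. -/
def leftField {n : ℕ} (u p : Space n) : Space n :=
  WithLp.toLp 2 (u.fst, u.snd + symp p.fst u.fst)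

/-- The coefficients in the frame `Xₖ, Yₖ, T` of the tangent vector `v` at `p`
(given in the coordinates of `ℝ^{2n+1}`). -/
def frameCoord {n : ℕ} (p v : Space n) : Space n :=
  WithLp.toLp 2 (v.fst, v.snd - symp p.fst v.fst)

/-- The Levi-Civita connection on left-invariant fields: `connection u v` is `D_u v`
(see `connection_metric` and `connection_torsion`). In other words `D_{Xₖ} Yₖ = -T`,
`D_{Yₖ} Xₖ = T`, `D_{Xₖ} T = D_T Xₖ = Yₖ`, `D_{Yₖ} T = D_T Yₖ = -Xₖ`, all others being zero. -/
def connection {n : ℕ} (u v : Space n) : Space n :=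
  WithLp.toLp 2 (u.snd • (Complex.I • v.fst) + v.snd • (Complex.I • u.fst), symp u.fst v.fst)

/-- The projection to the horizontal distribution, spanned by the `Xₖ` and `Yₖ`. -/
def horizontal {n : ℕ} (u : Space n) : Space n := WithLp.toLp 2 (u.fst, 0)

/-- The rotation `(z, t) ↦ (R z, t)` about the `t`-axis. -/
def rotate {n : ℕ} (R : EuclideanSpace ℂ (Fin n) ≃ₗᵢ[ℝ] EuclideanSpace ℂ (Fin n))
    (p : Space n) : Space n :=
  WithLp.toLp 2 (R p.fst, p.snd)

theorem Space.ext {n : ℕ} {p q : Space n} (h₁ : p.fst = q.fst) (h₂ : p.snd = q.snd) : p = q :=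
  WithLp.ofLp_injective 2 (Prod.ext h₁ h₂)

/-! ### The frame is left-invariant and the connection is the Levi-Civita one -/

theorem leftField_frameCoord {n : ℕ} (p v : Space n) : leftField (frameCoord p v) p = v := by
  refine Space.ext ?_ ?_ <;> simp [leftField, frameCoord]

theorem frameCoord_leftField {n : ℕ} (p u : Space n) : frameCoord p (leftField u p) = u := by
  refine Space.ext ?_ ?_ <;> simp [leftField, frameCoord]

theorem symp_add_left {n : ℕ} (z z' w : EuclideanSpace ℂ (Fin n)) :
    symp (z + z') w = symp z w + symp z' w := by
  simp [symp, add_mul, Finset.sum_add_distrib]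

theorem symp_smul_left {n : ℕ} (r : ℝ) (z w : EuclideanSpace ℂ (Fin n)) :
    symp (r • z) w = r * symp z w := by
  simp [symp, Finset.mul_sum, mul_assoc]

theorem symp_swap {n : ℕ} (z w : EuclideanSpace ℂ (Fin n)) : symp w z = - symp z w := by
  simp only [symp, Complex.im_sum, ← Finset.sum_neg_distrib]
  refine Finset.sum_congr rfl fun k _ => ?_
  simp only [Complex.mul_im, Complex.conj_re, Complex.conj_im]
  ring

theorem symp_smul_right {n : ℕ} (r : ℝ) (z w : EuclideanSpace ℂ (Fin n)) :
    symp z (r • w) = r * symp z w := by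
  rw [symp_swap, symp_smul_left, symp_swap]; ring

theorem leftField_eq_deriv {n : ℕ} (p u : Space n) :
    HasDerivAt (fun s : ℝ => mul p (s • u)) (leftField u p) 0 := by
  have h : (fun s : ℝ => mul p (s • u)) = fun s : ℝ => p + s • leftField u p := by
    funext s
    refine Space.ext ?_ ?_
    · simp [mul, leftField]
    · simp [mul, leftField, symp_smul_right]; ring
  rw [h]
  simpa using ((hasDerivAt_id (0 : ℝ)).smul_const (leftField u p)).const_add p

theorem connection_metric {n : ℕ} (u v w : Space n) :
    inner ℝ (connection u v) w + inner ℝ v (connection u w) = 0 := by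
  have hi : ∀ a b : Space n, inner ℝ a b
      = (∑ k, ((a.fst k).re * (b.fst k).re + (a.fst k).im * (b.fst k).im)) + a.snd * b.snd := by
    intro a b
    rw [WithLp.prod_inner_apply]
    congr 1
    · change inner ℝ a.fst b.fst = _
      rw [PiLp.inner_apply]
      refine Finset.sum_congr rfl fun k _ => ?_
      rw [Complex.inner, Complex.mul_re, Complex.conj_re, Complex.conj_im]
      ring
    · exact mul_comm _ _
  rw [hi, hi]
  simp only [connection, symp, WithLp.toLp_fst, WithLp.toLp_snd, PiLp.add_apply, PiLp.smul_apply,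
    Complex.im_sum, Complex.add_re, Complex.add_im, Complex.real_smul, smul_eq_mul, Complex.mul_re,
    Complex.mul_im, Complex.conj_re, Complex.conj_im, Complex.I_re, Complex.I_im,
    Complex.ofReal_re, Complex.ofReal_im, Finset.mul_sum, Finset.sum_mul,
    ← Finset.sum_add_distrib]
  refine Finset.sum_eq_zero fun k _ => ?_
  ring

theorem connection_torsion {n : ℕ} (u v p : Space n) :
    VectorField.lieBracket ℝ (leftField u) (leftField v) p
      = leftField (connection u v - connection v u) p := by
  have key : ∀ w : Space n, ∃ L : Space n →L[ℝ] Space n,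
      (∀ q, L q = WithLp.toLp 2 (0, symp q.fst w.fst)) ∧ HasFDerivAt (leftField w) L p := by
    intro w
    let L₀ : Space n →ₗ[ℝ] Space n :=
      { toFun := fun q => WithLp.toLp 2 (0, symp q.fst w.fst)
        map_add' := fun a b => by refine Space.ext ?_ ?_ <;> simp [symp_add_left]
        map_smul' := fun r a => by refine Space.ext ?_ ?_ <;> simp [symp_smul_left] }
    refine ⟨LinearMap.toContinuousLinearMap L₀, fun q => rfl, ?_⟩
    have h : leftField w = fun q => w + LinearMap.toContinuousLinearMap L₀ q := by
      funext q
      refine Space.ext ?_ ?_ <;> simp [leftField, L₀]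
    rw [h]
    exact (LinearMap.toContinuousLinearMap L₀).hasFDerivAt.const_add w
  obtain ⟨L, hL, hL'⟩ := key u
  obtain ⟨K, hK, hK'⟩ := key v
  rw [VectorField.lieBracket, hL'.fderiv, hK'.fderiv, hL, hK]
  refine Space.ext ?_ ?_
  · simp [leftField, connection, add_comm]
  · simp [leftField, connection, symp, add_comm]

/-! ### Immersed hypersurfaces and their sub-Riemannian mean curvature -/

section Hypersurface

variable {n : ℕ} {M : Type*} [TopologicalSpace M] [ChartedSpace (EuclideanSpace ℝ (Fin (2 * n))) M]

/-- The derivative `dU_p(e)` of a map `U` into the vector space `Space n`. -/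
def dirDeriv (U : M → Space n) (p : M) (e : TangentSpace (𝓡 (2 * n)) p) : Space n :=
  mfderiv (𝓡 (2 * n)) 𝓘(ℝ, Space n) U p e

/-- The frame coefficients of the tangent vector `df_p(e)`. -/
def push (f : M → Space n) (p : M) (e : TangentSpace (𝓡 (2 * n)) p) : Space n :=
  frameCoord (f p) (dirDeriv f p e)

/-- The frame coefficients of `D_e U`, for a vector field `U` along `f` given by its
frame coefficients. -/
def covDeriv (f U : M → Space n) (p : M) (e : TangentSpace (𝓡 (2 * n)) p) : Space n :=
  dirDeriv U p e + connection (push f p e) (U p)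

/-- `N` (in frame coefficients) is a `C¹` unit normal field to the immersion `f` over `W`. -/
structure IsUnitNormalOn (f N : M → Space n) (W : Set M) : Prop where
  contMDiffOn : ContMDiffOn (𝓡 (2 * n)) 𝓘(ℝ, Space n) 1 N W
  norm_eq_one : ∀ p ∈ W, ‖N p‖ = 1
  normal : ∀ p ∈ W, ∀ e : TangentSpace (𝓡 (2 * n)) p, inner ℝ (N p) (push f p e) = 0

/-- The horizontal unit normal `N_H / |N_H|`. -/
def horizontalNormal (N : M → Space n) (p : M) : Space n :=
  ‖horizontal (N p)‖⁻¹ • horizontal (N p)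

/-- The mean curvature `H` at `p` with respect to `N`: `-2n H` is the divergence, relative to the
hypersurface, of the horizontal unit normal, computed in an orthonormal basis `e` of the tangent
space. -/
def meanCurvature (f N : M → Space n) (p : M) (e : Fin (2 * n) → TangentSpace (𝓡 (2 * n)) p) : ℝ :=
  -(1 / (2 * (n : ℝ))) * ∑ i, inner ℝ (covDeriv f (horizontalNormal N) p (e i)) (push f p (e i))

/-- The immersion `f` is minimal: `H = 0` at all points of its regular set (where `N_H ≠ 0`),
for every local unit normal. -/
def IsMinimal (f : M → Space n) : Prop :=
  ∀ (W : Set M) (N : M → Space n), IsOpen W → IsUnitNormalOn f N W →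
    ∀ p ∈ W, horizontal (N p) ≠ 0 →
      ∀ e : Fin (2 * n) → TangentSpace (𝓡 (2 * n)) p,
        Orthonormal ℝ (fun i => push f p (e i)) → meanCurvature f N p e = 0

/-- `f` is a `C²` immersed hypersurface which is invariant under the rotations about the `t`-axis:
each `R` in `SO(2n)` carries the immersion to itself, up to a diffeomorphism of `M`. -/
structure IsHypersurfaceOfRevolution (f : M → Space n) : Prop where
  contMDiff : ContMDiff (𝓡 (2 * n)) 𝓘(ℝ, Space n) 2 f
  immersion : ∀ p, Function.Injective (mfderiv (𝓡 (2 * n)) 𝓘(ℝ, Space n) f p)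
  invariant : ∀ R : EuclideanSpace ℂ (Fin n) ≃ₗᵢ[ℝ] EuclideanSpace ℂ (Fin n),
    LinearMap.det (R.toLinearEquiv : EuclideanSpace ℂ (Fin n) →ₗ[ℝ] EuclideanSpace ℂ (Fin n)) = 1 →
      ∃ ψ : Diffeomorph (𝓡 (2 * n)) (𝓡 (2 * n)) M M 2, ∀ p, f (ψ p) = rotate R (f p)

/-- Completeness of the Riemannian metric induced by `f`: every `C¹` curve of finite length
converges in `M`. -/
def IsCompleteImmersion (f : M → Space n) : Prop :=
  ∀ σ : ℝ → M, ContMDiffOn 𝓘(ℝ, ℝ) (𝓡 (2 * n)) 1 σ (Set.Ioo 0 1) →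
    MeasureTheory.IntegrableOn
      (fun s => ‖frameCoord (f (σ s)) (deriv (fun τ => f (σ τ)) s)‖) (Set.Ioo 0 1) →
    ∃ q : M, Filter.Tendsto σ (nhdsWithin 1 (Set.Iio 1)) (nhds q)

end Hypersurface

/-! ### The two families -/

/-- The Euclidean hyperplane `t = c`. -/
def hyperplane (n : ℕ) (c : ℝ) : Set (Space n) := {p | p.snd = c}

/-- The catenoidal type hypersurface of energy `E > 0` with neck on `t = c`, where `n ≥ 1`:
`t = c ± ∫_{E^{1/(2n-1)}}^{|z|} E r / √(r^{4n-2} - E²) dr`, `|z| ≥ E^{1/(2n-1)}`. -/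
def catenoid (n : ℕ) (E c : ℝ) : Set (Space n) :=
  {p | E ^ (1 / (2 * (n : ℝ) - 1)) ≤ ‖p.fst‖ ∧
    |p.snd - c| = ∫ r in (E ^ (1 / (2 * (n : ℝ) - 1)))..‖p.fst‖,
      E * r / Real.sqrt (r ^ (4 * n - 2) - E ^ 2)}

/-- `S` is the image of a connected, complete, embedded `C²` minimal hypersurface of revolution. -/
def IsEmbeddedCompleteMinimalOfRevolution {n : ℕ} (S : Set (Space n)) : Prop :=
  ∃ (M : Type) (_ : TopologicalSpace M) (_ : ChartedSpace (EuclideanSpace ℝ (Fin (2 * n))) M)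
    (f : M → Space n),
    IsManifold (𝓡 (2 * n)) 2 M ∧ T2Space M ∧ SecondCountableTopology M ∧ ConnectedSpace M ∧
      IsHypersurfaceOfRevolution f ∧ IsMinimal f ∧ IsCompleteImmersion f ∧
      Topology.IsEmbedding f ∧ Set.range f = S

end Heisenberg

end

noncomputable section

namespace Heisenberg

/-! ### Linear algebra of the model space -/

section Algebra

variable {n : ℕ}

/-! Off the axis the geometry reduces to the profile curve in the coordinates `(|z|² / 2, t)`. Since
a hypersurface of revolution is tangent to the rotation orbits, the covectors `⟪z, dz⟫` and `dt` are
proportional on it: `⟪z, dz⟫ = w l` and `dt = α l` with `α² + w² = 1` (`exists_isProfile`). The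
horizontal unit normal is then `(α z + w i z) / |z|`. Its divergence is a trace over the tangent
space, evaluated by Parseval in `sum_inner_frame`. If `α'`, `w'` denote derivatives with respect to
`l`, then `H = 0` says `|z| (w α' - α w') + (2n - 1) α / |z| = 0`.

This equation has the first integral `|z|^(2n-1) α` (`IsMinimalProfile.energy_eq`), whose sign is
only a choice of orientation. When its value is `E > 0`, put `sinh θ = w / α`. Then `cosh θ = 1 /
α`, hence `|z|^(2n-1) = E cosh θ`, and `dt` is an explicit multiple of `dθ`. This is the catenoid,
parametrized smoothly across its neck (`IsMinimalProfile.height_eq`). Energy zero forces `dt = 0`.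

Three points need care globally. Invariance supplies a diffeomorphism for each rotation separately,
with no continuity in the rotation, so tangency to the orbits is not formal: if it failed, sweeping
the hypersurface by rotations would produce an open subset of the image, whose Hausdorff dimension
is at most `2n` (`exists_dirDeriv_eq`). The squared energy `K` is locally constant off the axis and
satisfies `0 ≤ K ≤ |z|^(4n-2)`; set to zero on the axis it is continuous with countably many values,
hence constant (`exists_forall_isEnergyAt`). Finally, the immersion followed by a global coordinate
of the model is a local diffeomorphism. Completeness lets segments be lifted through it, so its
image is open and closed in the connected coordinate domain
(`IsParametrization.image_subset_range`).

For the converse, the models are parametrized by `ℂⁿ` and by `ℂⁿ ∖ {0}` with `θ = log |u|`. Any unit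
normal is locally plus or minus the explicit one, so the same divergence formula proves minimality
(`HasMinimalNormal.isMinimal`). Completeness follows because the images are closed and curves of
finite length converge in the ambient group. -/

theorem inner_eq (a b : Space n) :
    inner ℝ a b = inner ℝ a.fst b.fst + a.snd * b.snd := by
  rw [WithLp.prod_inner_apply]
  congr 1
  exact mul_comm _ _

theorem inner_complex_eq (z w : EuclideanSpace ℂ (Fin n)) :
    inner ℝ z w = ∑ k, ((z k).re * (w k).re + (z k).im * (w k).im) := by
  rw [PiLp.inner_apply]
  refine Finset.sum_congr rfl fun k _ => ?_
  rw [Complex.inner, Complex.mul_re, Complex.conj_re, Complex.conj_im]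
  ring

theorem inner_I_smul_left (z w : EuclideanSpace ℂ (Fin n)) :
    inner ℝ (Complex.I • z) w = -symp z w := by
  rw [inner_complex_eq, symp, Complex.im_sum, ← Finset.sum_neg_distrib]
  refine Finset.sum_congr rfl fun k _ => ?_
  simp only [PiLp.smul_apply, smul_eq_mul, Complex.mul_re, Complex.mul_im, Complex.conj_re,
    Complex.conj_im, Complex.I_re, Complex.I_im]
  ring

theorem symp_eq (z w : EuclideanSpace ℂ (Fin n)) : symp z w = -inner ℝ (Complex.I • z) w := by
  rw [inner_I_smul_left, neg_neg]

theorem symp_self (z : EuclideanSpace ℂ (Fin n)) : symp z z = 0 := by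
  have := symp_swap z z; linarith

theorem inner_I_smul_self (z : EuclideanSpace ℂ (Fin n)) : inner ℝ (Complex.I • z) z = 0 := by
  rw [inner_I_smul_left, symp_self, neg_zero]

theorem norm_I_smul (z : EuclideanSpace ℂ (Fin n)) : ‖Complex.I • z‖ = ‖z‖ := by
  rw [norm_smul, Complex.norm_I, one_mul]

theorem I_smul_I_smul (z : EuclideanSpace ℂ (Fin n)) : Complex.I • Complex.I • z = -z := by
  rw [smul_smul, Complex.I_mul_I, neg_one_smul]

theorem finrank_complex : Module.finrank ℝ (EuclideanSpace ℂ (Fin n)) = 2 * n := by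
  rw [← Module.finrank_mul_finrank ℝ ℂ, Complex.finrank_real_complex, finrank_euclideanSpace,
    Fintype.card_fin]

theorem finrank_space : Module.finrank ℝ (Space n) = 2 * n + 1 := by
  rw [(WithLp.linearEquiv 2 ℝ (EuclideanSpace ℂ (Fin n) × ℝ)).finrank_eq, Module.finrank_prod,
    finrank_complex, Module.finrank_self]

/-- Parseval's identity for an orthonormal family of corank one, completed by a unit vector. -/
theorem sum_inner_mul_inner_of_normal {u : Fin (2 * n) → Space n} (hu : Orthonormal ℝ u)
    {N : Space n} (hN : ‖N‖ = 1) (hNu : ∀ i, inner ℝ N (u i) = 0) (x y : Space n) :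
    ∑ i, inner ℝ x (u i) * inner ℝ y (u i) = inner ℝ x y - inner ℝ x N * inner ℝ y N := by
  have ho : Orthonormal ℝ (fun o : Option (Fin (2 * n)) => o.elim N u) := by
    refine ⟨?_, ?_⟩
    · rintro (_ | i)
      · exact hN
      · exact hu.1 i
    · rintro (_ | i) (_ | j) hij
      · exact absurd rfl hij
      · exact hNu j
      · exact (real_inner_comm _ _).trans (hNu i)
      · exact hu.2 fun h => hij (congrArg some h)
  have hcard : Fintype.card (Option (Fin (2 * n))) = Module.finrank ℝ (Space n) := by
    rw [finrank_space, Fintype.card_option, Fintype.card_fin]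
  let b := basisOfOrthonormalOfCardEqFinrank ho hcard
  have hb : ⇑b = fun o : Option (Fin (2 * n)) => o.elim N u :=
    coe_basisOfOrthonormalOfCardEqFinrank ho hcard
  have hb' : Orthonormal ℝ b := by rw [hb]; exact ho
  have h := (b.toOrthonormalBasis hb').sum_inner_mul_inner x y
  rw [Module.Basis.coe_toOrthonormalBasis, hb, Fintype.sum_option] at h
  simp only [Option.elim] at h
  rw [← h, real_inner_comm N y, add_sub_cancel_left]
  exact Finset.sum_congr rfl fun i _ => by rw [real_inner_comm y]

/-- The direction `((α + i w) z / |z|, 0)` of the horizontal normal. -/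
def radialNormal (α w : ℝ) (z : EuclideanSpace ℂ (Fin n)) : Space n :=
  WithLp.toLp 2 (‖z‖⁻¹ • (α • z + w • (Complex.I • z)), 0)

/-- The unit normal with horizontal part along `radialNormal α w z`, orthogonal to the vectors with
frame coefficients `(v, s)` such that `α ⟪z, v⟫ = w (s + symp z v)`. -/
def unitNormal (α w : ℝ) (z : EuclideanSpace ℂ (Fin n)) : Space n :=
  (Real.sqrt (1 + (w * ‖z‖⁻¹) ^ 2))⁻¹ •
    WithLp.toLp 2 (‖z‖⁻¹ • (α • z + w • (Complex.I • z)), -(w * ‖z‖⁻¹))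

theorem norm_radialNormal {z : EuclideanSpace ℂ (Fin n)} (hz : z ≠ 0) {α w : ℝ}
    (h1 : α ^ 2 + w ^ 2 = 1) : ‖radialNormal α w z‖ = 1 := by
  have hr : ‖z‖ ≠ 0 := norm_ne_zero_iff.2 hz
  have hii : inner ℝ (Complex.I • z) (Complex.I • z) = ‖z‖ ^ 2 := by
    rw [real_inner_self_eq_norm_sq, norm_I_smul]
  have : ‖radialNormal α w z‖ ^ 2 = 1 := by
    rw [← real_inner_self_eq_norm_sq, inner_eq]
    simp only [radialNormal, WithLp.toLp_fst, WithLp.toLp_snd, inner_smul_left, inner_smul_right,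
      inner_add_left, inner_add_right, real_inner_self_eq_norm_sq z, hii, inner_I_smul_self,
      real_inner_comm (Complex.I • z) z, conj_trivial]
    field_simp
    linear_combination ‖z‖ ^ 2 * h1
  have h0 := norm_nonneg (radialNormal α w z)
  nlinarith

theorem horizontal_unitNormal (α w : ℝ) (z : EuclideanSpace ℂ (Fin n)) :
    horizontal (unitNormal α w z)
      = (Real.sqrt (1 + (w * ‖z‖⁻¹) ^ 2))⁻¹ • radialNormal α w z := by
  refine Space.ext ?_ ?_ <;> simp [horizontal, unitNormal, radialNormal]

theorem norm_unitNormal {z : EuclideanSpace ℂ (Fin n)} (hz : z ≠ 0) {α w : ℝ}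
    (h1 : α ^ 2 + w ^ 2 = 1) : ‖unitNormal α w z‖ = 1 := by
  have hwr : 0 < 1 + (w * ‖z‖⁻¹) ^ 2 := by positivity
  have h2 := norm_radialNormal hz h1
  have h3 : ‖WithLp.toLp 2 (‖z‖⁻¹ • (α • z + w • (Complex.I • z)), -(w * ‖z‖⁻¹))‖ ^ 2
      = 1 + (w * ‖z‖⁻¹) ^ 2 := by
    have h4 := real_inner_self_eq_norm_sq (radialNormal α w z)
    rw [h2, inner_eq] at h4
    rw [← real_inner_self_eq_norm_sq, inner_eq]
    simp only [radialNormal, WithLp.toLp_fst, WithLp.toLp_snd] at h4 ⊢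
    rw [show inner ℝ _ _ = (1 : ℝ) by linarith]
    ring
  rw [unitNormal, norm_smul, norm_inv, Real.norm_of_nonneg (Real.sqrt_nonneg _), ← h3,
    Real.sqrt_sq (norm_nonneg _), inv_mul_cancel₀]
  intro h
  rw [h] at h3
  linarith [sq_nonneg (w * ‖z‖⁻¹)]

theorem inner_unitNormal {z : EuclideanSpace ℂ (Fin n)} {α w : ℝ} {u : Space n}
    (h : α * inner ℝ z u.fst = w * (u.snd + symp z u.fst)) :
    inner ℝ (unitNormal α w z) u = 0 := by
  rw [symp_eq] at h
  rw [unitNormal, inner_smul_left, inner_eq]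
  simp only [WithLp.toLp_fst, WithLp.toLp_snd, inner_smul_left, inner_add_left, conj_trivial]
  linear_combination (Real.sqrt (1 + (w * ‖z‖⁻¹) ^ 2))⁻¹ * ‖z‖⁻¹ * h

/-- The divergence of the horizontal normal in an orthonormal frame. -/
theorem sum_inner_frame {z : EuclideanSpace ℂ (Fin n)} (hz : z ≠ 0) {α w α' w' : ℝ}
    (h1 : α ^ 2 + w ^ 2 = 1) (h2 : α * α' + w * w' = 0)
    {u : Fin (2 * n) → Space n} (hu : Orthonormal ℝ u)
    (ht : ∀ i, α * inner ℝ z (u i).fst = w * ((u i).snd + symp z (u i).fst))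
    {D : Fin (2 * n) → Space n} {l : Fin (2 * n) → ℝ}
    (hl : ∀ i, l i = w * inner ℝ z (u i).fst + α * ((u i).snd + symp z (u i).fst))
    (hD : ∀ i, (D i).fst = (l i * (‖z‖⁻¹ * α' - ‖z‖⁻¹ ^ 3 * (α * w))) • z
      + (l i * (‖z‖⁻¹ * w' - ‖z‖⁻¹ ^ 3 * w ^ 2)) • (Complex.I • z)
      + (‖z‖⁻¹ * α) • (u i).fst + (‖z‖⁻¹ * w) • (Complex.I • (u i).fst))
    (hD2 : ∀ i, (D i).snd = 0) :
    ∑ i, inner ℝ (D i + connection (u i) (radialNormal α w z)) (u i)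
      = ‖z‖ * (w * α' - α * w') + (2 * n - 1) * (α * ‖z‖⁻¹) := by
  have hr : ‖z‖ ≠ 0 := norm_ne_zero_iff.2 hz
  set r := ‖z‖ with hrdef
  set iz := Complex.I • z with hiz
  have hzz : inner ℝ z z = r ^ 2 := real_inner_self_eq_norm_sq z
  have hii : inner ℝ iz iz = r ^ 2 := by rw [real_inner_self_eq_norm_sq, norm_I_smul]
  have hIi : Complex.I • iz = -z := I_smul_I_smul z
  have hiz0 : inner ℝ iz z = 0 := inner_I_smul_self z
  have hzi : inner ℝ z iz = 0 := by rw [real_inner_comm]; exact hiz0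
  -- The normalizing factor of the normal can stay opaque: the `κ²` contributions of `ℓ`, `C` and of
  -- `et` to the trace cancel in the end.
  obtain ⟨κ, hκ⟩ : ∃ κ, κ = (Real.sqrt (1 + (w * r⁻¹) ^ 2))⁻¹ := ⟨_, rfl⟩
  obtain ⟨N, hNdef⟩ : ∃ N, N = unitNormal α w z := ⟨_, rfl⟩
  have hN : ‖N‖ = 1 := hNdef ▸ norm_unitNormal hz h1
  have hNu : ∀ i, inner ℝ N (u i) = 0 := fun i => hNdef ▸ inner_unitNormal (ht i)
  have hN1 : N.fst = (κ * r⁻¹) • (α • z + w • iz) := by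
    rw [hNdef, hκ, mul_smul]; rfl
  have hN2 : N.snd = -(κ * (w * r⁻¹)) := by
    rw [hNdef, hκ, ← mul_neg]; rfl
  -- Each term of the divergence becomes a product of two linear forms in `u i`, to which Parseval
  -- applies. `ℓ` represents the profile form `l`, `C` the variation of the horizontal normal along
  -- it, `et` the vertical coordinate, and `iν` is `i` times the horizontal normal; the pair `et`,
  -- `iν` accounts for the connection term.
  let ℓ : Space n := WithLp.toLp 2 (w • z - α • iz, α)
  let C : Space n := WithLp.toLp 2 ((r⁻¹ * α' - r⁻¹ ^ 3 * (α * w)) • z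
    + (r⁻¹ * w' - r⁻¹ ^ 3 * w ^ 2) • iz, 0)
  let et : Space n := WithLp.toLp 2 (0, 1)
  let iν : Space n := WithLp.toLp 2 (r⁻¹ • (α • iz - w • z), 0)
  have key : ∀ i, inner ℝ (D i + connection (u i) (radialNormal α w z)) (u i)
      = inner ℝ ℓ (u i) * inner ℝ C (u i) + r⁻¹ * α * (1 - inner ℝ et (u i) * inner ℝ et (u i))
        + 2 * (inner ℝ et (u i) * inner ℝ iν (u i)) := by
    intro i
    have hnorm : inner ℝ (u i).fst (u i).fst = 1 - (u i).snd * (u i).snd := by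
      have := real_inner_self_eq_norm_sq (u i)
      rw [hu.1 i, inner_eq] at this
      linarith
    have hiv := inner_I_smul_self (u i).fst
    have hc : ∀ (a : ℝ) (x : EuclideanSpace ℂ (Fin n)), Complex.I • a • x = a • Complex.I • x :=
      fun a x => smul_comm _ _ _
    have hvz : inner ℝ (Complex.I • (u i).fst) z = -inner ℝ iz (u i).fst := by
      rw [inner_I_smul_left, symp_swap, symp_eq]; simp [hiz]
    have hviz : inner ℝ (Complex.I • (u i).fst) iz = inner ℝ z (u i).fst := by
      rw [inner_I_smul_left, symp_swap, symp_eq, hIi, inner_neg_left]; simp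
    simp only [inner_eq, connection, radialNormal, hD, hD2, hl,
      ℓ, C, et, iν, WithLp.toLp_fst, WithLp.toLp_snd, inner_add_left, inner_sub_left,
      inner_smul_left, conj_trivial, hnorm, hiv, inner_zero_left, smul_add, zero_smul, hc, hvz, hviz,
      hIi, inner_neg_left, symp_eq, ← hiz, inner_smul_right, inner_add_right, ← hrdef]
    ring
  rw [Finset.sum_congr rfl fun i _ => key i]
  simp only [Finset.sum_add_distrib, ← Finset.mul_sum, Finset.sum_sub_distrib,
    sum_inner_mul_inner_of_normal hu hN hNu]
  simp only [inner_eq, ℓ, C, et, iν, hN1, hN2, WithLp.toLp_fst, WithLp.toLp_snd, inner_add_left, inner_sub_left, inner_add_right,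
    inner_smul_left, inner_smul_right, hzz, hii, hiz0, hzi, conj_trivial, inner_zero_left,
    inner_zero_right, Finset.sum_const, Finset.card_univ, Fintype.card_fin, nsmul_eq_mul]
  push_cast
  field_simp
  linear_combination κ ^ 2 * α * w * r ^ 4 * h2 - κ ^ 2 * α * w ^ 2 * r ^ 2 * h1

/-- Rotations act transitively on the spheres of `ℂⁿ`. -/
theorem exists_rotation {z z' : EuclideanSpace ℂ (Fin n)} (h : ‖z‖ = ‖z'‖) :
    ∃ R : EuclideanSpace ℂ (Fin n) ≃ₗᵢ[ℝ] EuclideanSpace ℂ (Fin n),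
      LinearMap.det (R.toLinearEquiv : EuclideanSpace ℂ (Fin n) →ₗ[ℝ] EuclideanSpace ℂ (Fin n)) = 1
        ∧ R z = z' := by
  by_cases hzz : z = z'
  · exact ⟨LinearIsometryEquiv.refl ℝ _, LinearMap.det_id, hzz⟩
  have hz' : z' ≠ 0 := by
    rintro rfl
    exact hzz (norm_eq_zero.1 (h.trans norm_zero))
  have hdet : ∀ v : EuclideanSpace ℂ (Fin n), v ≠ 0 →
      LinearMap.det ((ℝ ∙ v)ᗮ.reflection.toLinearEquiv :
        EuclideanSpace ℂ (Fin n) →ₗ[ℝ] EuclideanSpace ℂ (Fin n)) = -1 := by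
    intro v hv
    have := (ℝ ∙ v)ᗮ.det_reflection
    rw [Submodule.orthogonal_orthogonal, finrank_span_singleton hv, pow_one] at this
    exact this
  -- The first reflection exchanges `z` and `z'`; the second fixes `z'`, since `i z'` is orthogonal
  -- to it, and only serves to restore determinant one.
  refine ⟨(ℝ ∙ (z - z'))ᗮ.reflection.trans (ℝ ∙ (Complex.I • z'))ᗮ.reflection, ?_, ?_⟩
  · have := LinearMap.det_comp
      ((ℝ ∙ (Complex.I • z'))ᗮ.reflection.toLinearEquiv :
        EuclideanSpace ℂ (Fin n) →ₗ[ℝ] EuclideanSpace ℂ (Fin n))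
      ((ℝ ∙ (z - z'))ᗮ.reflection.toLinearEquiv :
        EuclideanSpace ℂ (Fin n) →ₗ[ℝ] EuclideanSpace ℂ (Fin n))
    rw [hdet _ (sub_ne_zero.2 hzz), hdet _ (smul_ne_zero Complex.I_ne_zero hz')] at this
    exact this.trans (by norm_num)
  · rw [LinearIsometryEquiv.trans_apply, Submodule.reflection_sub h,
      Submodule.reflection_mem_subspace_eq_self]
    rw [Submodule.mem_orthogonal_singleton_iff_inner_right]
    exact inner_I_smul_self z'

end Algebra

/-! ### The mean curvature of a hypersurface with a normal of rotational type -/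

section MeanCurvature

open Filter Topology

variable {n : ℕ} {V : Type*} [NormedAddCommGroup V] [NormedSpace ℝ V]

/-- The projection to `ℂⁿ` as a continuous linear map. -/
def fstL (n : ℕ) : Space n →L[ℝ] EuclideanSpace ℂ (Fin n) :=
  LinearMap.toContinuousLinearMap
    { toFun := fun p => p.fst, map_add' := fun _ _ => rfl, map_smul' := fun _ _ => rfl }

/-- The projection to the `t`-axis as a continuous linear map. -/
def sndL (n : ℕ) : Space n →L[ℝ] ℝ :=
  LinearMap.toContinuousLinearMap
    { toFun := fun p => p.snd, map_add' := fun _ _ => rfl, map_smul' := fun _ _ => rfl }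

/-- The inclusion of the horizontal slice as a continuous linear map. -/
def inlL (n : ℕ) : EuclideanSpace ℂ (Fin n) →L[ℝ] Space n :=
  LinearMap.toContinuousLinearMap
    { toFun := fun z => WithLp.toLp 2 (z, 0)
      map_add' := fun _ _ => by refine Space.ext ?_ ?_ <;> simp
      map_smul' := fun _ _ => by refine Space.ext ?_ ?_ <;> simp }

/-- The inclusion of the `t`-axis as a continuous linear map. -/
def inrL (n : ℕ) : ℝ →L[ℝ] Space n :=
  LinearMap.toContinuousLinearMap
    { toFun := fun t => WithLp.toLp 2 (0, t)
      map_add' := fun _ _ => by refine Space.ext ?_ ?_ <;> simp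
      map_smul' := fun _ _ => by refine Space.ext ?_ ?_ <;> simp }

/-- Multiplication by `i` as a continuous linear map. -/
def mulIL (n : ℕ) : EuclideanSpace ℂ (Fin n) →L[ℝ] EuclideanSpace ℂ (Fin n) :=
  LinearMap.toContinuousLinearMap
    { toFun := fun z => Complex.I • z
      map_add' := fun a b => smul_add _ _ _
      map_smul' := fun a b => smul_comm _ _ _ }

@[simp] theorem fstL_apply (p : Space n) : fstL n p = p.fst := rfl
@[simp] theorem sndL_apply (p : Space n) : sndL n p = p.snd := rfl
@[simp] theorem inlL_apply (z : EuclideanSpace ℂ (Fin n)) : inlL n z = WithLp.toLp 2 (z, 0) := rfl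
@[simp] theorem inrL_apply (t : ℝ) : inrL n t = WithLp.toLp 2 (0, t) := rfl
@[simp] theorem mulIL_apply (z : EuclideanSpace ℂ (Fin n)) : mulIL n z = Complex.I • z := rfl

/-- Passage to frame coefficients at `p` as a continuous linear map. -/
def frameL (p : Space n) : Space n →L[ℝ] Space n :=
  LinearMap.toContinuousLinearMap
    { toFun := frameCoord p
      map_add' := fun a b => by
        refine Space.ext ?_ ?_
        · simp [frameCoord]
        · simp [frameCoord, symp_eq, inner_add_right]; ring
      map_smul' := fun r a => by
        refine Space.ext ?_ ?_
        · simp [frameCoord]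
        · simp [frameCoord, symp_smul_right]; ring }

theorem hasFDerivAt_norm_inv {z : V → EuclideanSpace ℂ (Fin n)}
    {Z : V →L[ℝ] EuclideanSpace ℂ (Fin n)} {x : V} (hz : HasFDerivAt z Z x) (h0 : z x ≠ 0) :
    HasFDerivAt (fun y => ‖z y‖⁻¹) (-(‖z x‖⁻¹ ^ 3) • (innerSL ℝ (z x)).comp Z) x := by
  have hr : ‖z x‖ ≠ 0 := norm_ne_zero_iff.2 h0
  have h1 := (hz.norm_sq).sqrt (pow_ne_zero 2 hr)
  simp only [Real.sqrt_sq (norm_nonneg _)] at h1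
  have h2 := (hasDerivAt_inv hr).comp_hasFDerivAt x h1
  refine h2.congr_fderiv ?_
  ext e
  simp
  field_simp

theorem hasFDerivAt_radialNormal {z : V → EuclideanSpace ℂ (Fin n)} {α w : V → ℝ}
    {Z : V →L[ℝ] EuclideanSpace ℂ (Fin n)} {Dα Dw : V →L[ℝ] ℝ} {x : V} (hz : HasFDerivAt z Z x)
    (hα : HasFDerivAt α Dα x) (hw : HasFDerivAt w Dw x) (h0 : z x ≠ 0) :
    ∃ L : V →L[ℝ] Space n, HasFDerivAt (fun y => radialNormal (α y) (w y) (z y)) L x ∧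
      ∀ e, L e = WithLp.toLp 2
        (‖z x‖⁻¹ • (Dα e • z x + α x • Z e + Dw e • (Complex.I • z x) + w x • (Complex.I • Z e))
          - (‖z x‖⁻¹ ^ 3 * inner ℝ (z x) (Z e)) • (α x • z x + w x • (Complex.I • z x)), 0) := by
  have h1 := (inlL n).hasFDerivAt.comp x ((hasFDerivAt_norm_inv hz h0).smul
    ((hα.smul hz).add (hw.smul ((mulIL n).hasFDerivAt.comp x hz))))
  refine ⟨_, h1, fun e => ?_⟩
  refine Space.ext ?_ ?_
  · simp
    module
  · simp

variable {M : Type*} [TopologicalSpace M] [ChartedSpace (EuclideanSpace ℝ (Fin (2 * n))) M]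

/-- This converts manifold derivatives into Fréchet derivatives whenever a map factors locally
through a coordinate `φ` with values in a vector space. -/
theorem dirDeriv_eq_comp {U : M → Space n} {U' : V → Space n} {φ : M → V} {q : M}
    {A : TangentSpace (𝓡 (2 * n)) q →L[ℝ] V} {L : V →L[ℝ] Space n}
    (hφ : HasMFDerivAt (𝓡 (2 * n)) 𝓘(ℝ, V) φ q A) (hU' : HasFDerivAt U' L (φ q))
    (hU : U =ᶠ[𝓝 q] U' ∘ φ) (e : TangentSpace (𝓡 (2 * n)) q) : dirDeriv U q e = L (A e) := by
  have h := (hU'.hasMFDerivAt.comp q hφ).congr_of_eventuallyEq hU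
  rw [dirDeriv, h.mfderiv]
  rfl

/-- The factorization through a map `φ` into an arbitrary normed space serves two cases: a chart of
an abstract hypersurface, and the global coordinate of a model. Only the germ of the horizontal
normal is prescribed, so normals of either sign are covered. -/
theorem meanCurvature_eq {f N : M → Space n} {φ : M → V} {q : M}
    {A : TangentSpace (𝓡 (2 * n)) q →L[ℝ] V} (hφ : HasMFDerivAt (𝓡 (2 * n)) 𝓘(ℝ, V) φ q A)
    {g : V → Space n} {G : V →L[ℝ] Space n} (hg : HasFDerivAt g G (φ q)) (hf : f =ᶠ[𝓝 q] g ∘ φ)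
    {α w : V → ℝ} {Dα Dw : V →L[ℝ] ℝ} (hα : HasFDerivAt α Dα (φ q)) (hw : HasFDerivAt w Dw (φ q))
    (hN : horizontalNormal N =ᶠ[𝓝 q]
      (fun y => radialNormal (α y) (w y) (g y).fst) ∘ φ)
    (h0 : (g (φ q)).fst ≠ 0) {α' w' : ℝ} (h1 : α (φ q) ^ 2 + w (φ q) ^ 2 = 1)
    (h2 : α (φ q) * α' + w (φ q) * w' = 0)
    (ht : ∀ e, α (φ q) * inner ℝ (g (φ q)).fst (G e).fst = w (φ q) * (G e).snd)
    (hDα : ∀ e, Dα e = (w (φ q) * inner ℝ (g (φ q)).fst (G e).fst + α (φ q) * (G e).snd) * α')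
    (hDw : ∀ e, Dw e = (w (φ q) * inner ℝ (g (φ q)).fst (G e).fst + α (φ q) * (G e).snd) * w')
    {e : Fin (2 * n) → TangentSpace (𝓡 (2 * n)) q}
    (he : Orthonormal ℝ (fun i => push f q (e i))) :
    meanCurvature f N q e = -(1 / (2 * (n : ℝ))) *
      (‖(g (φ q)).fst‖ * (w (φ q) * α' - α (φ q) * w')
        + (2 * n - 1) * (α (φ q) * ‖(g (φ q)).fst‖⁻¹)) := by
  have hfq : f q = g (φ q) := hf.eq_of_nhds
  have hNq : horizontalNormal N q = radialNormal (α (φ q)) (w (φ q)) (g (φ q)).fst :=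
    hN.eq_of_nhds
  obtain ⟨L, hL, hLe⟩ := hasFDerivAt_radialNormal ((fstL n).hasFDerivAt.comp (φ q) hg) hα hw h0
  have hdf : ∀ i, dirDeriv f q (e i) = G (A (e i)) := fun i => dirDeriv_eq_comp hφ hg hf _
  have hdN : ∀ i, dirDeriv (horizontalNormal N) q (e i) = L (A (e i)) :=
    fun i => dirDeriv_eq_comp hφ hL hN _
  have hp1 : ∀ i, (push f q (e i)).fst = (G (A (e i))).fst := fun i => by
    rw [push, hdf]; rfl
  have hp2 : ∀ i, (push f q (e i)).snd + symp (g (φ q)).fst (push f q (e i)).fst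
      = (G (A (e i))).snd := fun i => by
    rw [push, hdf, hfq]; simp [frameCoord]
  rw [meanCurvature]
  congr 1
  simp only [covDeriv, hdN, hNq]
  refine sum_inner_frame h0 h1 h2 he (l := fun i => _) (fun i => ?_) (fun i => rfl)
    (fun i => ?_) (fun i => ?_)
  · rw [hp2, hp1]; exact ht _
  · rw [hp2, hp1, hLe, hDα, hDw]
    -- As `(w, α)` is a unit vector in the direction of `(⟪z, dz⟫, dt)`, the radial differential is
    -- `w` times the profile form.
    have key : inner ℝ (g (φ q)).fst (G (A (e i))).fst = w (φ q) *
        (w (φ q) * inner ℝ (g (φ q)).fst (G (A (e i))).fst + α (φ q) * (G (A (e i))).snd) := by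
      have := ht (A (e i))
      linear_combination α (φ q) * this - inner ℝ (g (φ q)).fst (G (A (e i))).fst * h1
    set l := w (φ q) * inner ℝ (g (φ q)).fst (G (A (e i))).fst + α (φ q) * (G (A (e i))).snd
    simp only [Function.comp_apply, fstL_apply, ContinuousLinearMap.comp_apply, WithLp.toLp_fst]
    rw [key]
    module
  · rw [hLe]; rfl

/-- An immersed hypersurface has orthonormal frames. -/
theorem exists_orthonormal_push {f : M → Space n} {q : M}
    (h : Function.Injective (mfderiv (𝓡 (2 * n)) 𝓘(ℝ, Space n) f q)) :
    ∃ e : Fin (2 * n) → TangentSpace (𝓡 (2 * n)) q, Orthonormal ℝ (fun i => push f q (e i)) := by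
  let D : EuclideanSpace ℝ (Fin (2 * n)) →L[ℝ] Space n := mfderiv (𝓡 (2 * n)) 𝓘(ℝ, Space n) f q
  let P : EuclideanSpace ℝ (Fin (2 * n)) →ₗ[ℝ] Space n := (frameL (f q)).toLinearMap ∘ₗ D.toLinearMap
  have hP : Function.Injective P := by
    refine Function.Injective.comp (g := frameL (f q)) (fun a b hab => ?_) h
    rw [← leftField_frameCoord (f q) a, ← leftField_frameCoord (f q) b]
    exact congrArg (leftField · (f q)) hab
  have hr : Module.finrank ℝ (LinearMap.range P) = 2 * n := by
    rw [LinearMap.finrank_range_of_inj hP, finrank_euclideanSpace, Fintype.card_fin]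
  let b := (stdOrthonormalBasis ℝ (LinearMap.range P)).reindex (finCongr hr)
  choose e he using fun i => LinearMap.mem_range.1 (b i).2
  refine ⟨e, ?_⟩
  have : (fun i => push f q (e i)) = fun i => ((b i : LinearMap.range P) : Space n) :=
    funext he
  rw [this]
  exact b.orthonormal.comp_linearIsometry (LinearMap.range P).subtypeₗᵢ

theorem contDiffOn_unitNormal {z : V → EuclideanSpace ℂ (Fin n)} {α w : V → ℝ} {B : Set V}
    (hz : ContDiffOn ℝ 1 z B) (hα : ContDiffOn ℝ 1 α B) (hw : ContDiffOn ℝ 1 w B)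
    (h0 : ∀ y ∈ B, z y ≠ 0) :
    ContDiffOn ℝ 1 (fun y => unitNormal (α y) (w y) (z y)) B := by
  have hr : ContDiffOn ℝ 1 (fun y => ‖z y‖⁻¹) B :=
    (hz.norm ℝ h0).inv fun y hy => norm_ne_zero_iff.2 (h0 y hy)
  have hκ : ContDiffOn ℝ 1 (fun y => (Real.sqrt (1 + (w y * ‖z y‖⁻¹) ^ 2))⁻¹) B := by
    refine ContDiffOn.inv (ContDiffOn.sqrt (contDiffOn_const.add ((hw.mul hr).pow 2)) ?_) ?_
    · intro y _; positivity
    · intro y _; positivity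
  have h1 := (inlL n).contDiff.comp_contDiffOn
    (hr.smul ((hα.smul hz).add (hw.smul ((mulIL n).contDiff.comp_contDiffOn hz))))
  have h2 := (inrL n).contDiff.comp_contDiffOn (hw.mul hr).neg
  refine (hκ.smul (h1.add h2)).congr fun y _ => ?_
  rw [unitNormal]
  congr 1
  refine Space.ext ?_ ?_ <;> simp

theorem horizontalNormal_unitNormal {z : M → EuclideanSpace ℂ (Fin n)} {α w : M → ℝ} {q : M}
    (h0 : z q ≠ 0) (h1 : α q ^ 2 + w q ^ 2 = 1) :
    horizontalNormal (fun y => unitNormal (α y) (w y) (z y)) q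
      = radialNormal (α q) (w q) (z q) := by
  rw [horizontalNormal, horizontal_unitNormal, norm_smul, norm_radialNormal h0 h1, mul_one,
    smul_smul, Real.norm_of_nonneg (by positivity), inv_mul_cancel₀ (by positivity), one_smul]

/-- The minimal surface equation of a hypersurface with a normal of rotational type. -/
theorem IsMinimal.radial_equation (hn : 1 ≤ n) {f : M → Space n} (hmin : IsMinimal f) {W : Set M}
    (hW : IsOpen W) {φ : M → V} (hφ : ContMDiffOn (𝓡 (2 * n)) 𝓘(ℝ, V) 1 φ W) {g : V → Space n}
    (hfg : ∀ q ∈ W, f q = g (φ q)) {B : Set V} (hB : IsOpen B) (hφB : Set.MapsTo φ W B)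
    (hg : ContDiffOn ℝ 1 g B) {α w : V → ℝ} (hα : ContDiffOn ℝ 1 α B) (hw : ContDiffOn ℝ 1 w B)
    (h0 : ∀ y ∈ B, (g y).fst ≠ 0) (h1 : ∀ y ∈ B, α y ^ 2 + w y ^ 2 = 1)
    (ht : ∀ y ∈ B, ∀ e, α y * inner ℝ (g y).fst (fderiv ℝ g y e).fst
      = w y * (fderiv ℝ g y e).snd)
    {q : M} (hq : q ∈ W) (himm : Function.Injective (mfderiv (𝓡 (2 * n)) 𝓘(ℝ, Space n) f q))
    {α' w' : ℝ} (h2 : α (φ q) * α' + w (φ q) * w' = 0)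
    (hDα : ∀ e, fderiv ℝ α (φ q) e = (w (φ q) * inner ℝ (g (φ q)).fst (fderiv ℝ g (φ q) e).fst
      + α (φ q) * (fderiv ℝ g (φ q) e).snd) * α')
    (hDw : ∀ e, fderiv ℝ w (φ q) e = (w (φ q) * inner ℝ (g (φ q)).fst (fderiv ℝ g (φ q) e).fst
      + α (φ q) * (fderiv ℝ g (φ q) e).snd) * w') :
    ‖(g (φ q)).fst‖ * (w (φ q) * α' - α (φ q) * w')
        + (2 * n - 1) * (α (φ q) * ‖(g (φ q)).fst‖⁻¹) = 0 := by
  obtain ⟨e, he⟩ := exists_orthonormal_push himm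
  have hd : ∀ {F : Type _} [NormedAddCommGroup F] [NormedSpace ℝ F] {u : V → F},
      ContDiffOn ℝ 1 u B → ∀ y ∈ B, HasFDerivAt u (fderiv ℝ u y) y := fun hu y hy =>
    ((hu.differentiableOn one_ne_zero).differentiableAt (hB.mem_nhds hy)).hasFDerivAt
  have hφq : ∀ p ∈ W, HasMFDerivAt (𝓡 (2 * n)) 𝓘(ℝ, V) φ p
      (mfderiv (𝓡 (2 * n)) 𝓘(ℝ, V) φ p) := fun p hp =>
    (((hφ.mdifferentiableOn one_ne_zero) p hp).mdifferentiableAt (hW.mem_nhds hp)).hasMFDerivAt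
  have hz : ContDiffOn ℝ 1 (fun y => (g y).fst) B := (fstL n).contDiff.comp_contDiffOn hg
  have hN := contDiffOn_unitNormal hz hα hw h0
  have hfe : ∀ p ∈ W, f =ᶠ[𝓝 p] g ∘ φ := fun p hp =>
    Filter.eventually_of_mem (hW.mem_nhds hp) hfg
  have hU : IsUnitNormalOn f (fun p => unitNormal (α (φ p)) (w (φ p)) (g (φ p)).fst) W := by
    refine ⟨hN.contMDiffOn.comp hφ hφB, fun p hp => ?_, fun p hp e => ?_⟩
    · exact norm_unitNormal (h0 _ (hφB hp)) (h1 _ (hφB hp))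
    · refine inner_unitNormal ?_
      rw [push, dirDeriv_eq_comp (hφq p hp) (hd hg _ (hφB hp)) (hfe p hp), hfg p hp]
      simpa [frameCoord] using ht _ (hφB hp) _
  have hhN : ∀ p ∈ W, horizontalNormal
      (fun p => unitNormal (α (φ p)) (w (φ p)) (g (φ p)).fst) p
        = radialNormal (α (φ p)) (w (φ p)) (g (φ p)).fst := fun p hp =>
    horizontalNormal_unitNormal (z := fun p => (g (φ p)).fst) (α := fun p => α (φ p))
      (w := fun p => w (φ p)) (h0 _ (hφB hp)) (h1 _ (hφB hp))
  -- Every point off the axis is regular, because the horizontal normal just computed has norm one.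
  have hreg : horizontal (unitNormal (α (φ q)) (w (φ q)) (g (φ q)).fst) ≠ 0 := by
    intro h
    have := hhN q hq
    rw [horizontalNormal, h, smul_zero] at this
    have h3 := norm_radialNormal (h0 _ (hφB hq)) (h1 _ (hφB hq))
    rw [← this, norm_zero] at h3
    exact zero_ne_one h3
  have hH := hmin W _ hW hU q hq hreg e he
  rw [meanCurvature_eq (hφq q hq) (hd hg _ (hφB hq)) (hfe q hq) (hd hα _ (hφB hq))
    (hd hw _ (hφB hq)) (Filter.eventually_of_mem (hW.mem_nhds hq) hhN) (h0 _ (hφB hq))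
    (h1 _ (hφB hq)) h2 (ht _ (hφB hq)) hDα hDw he] at hH
  have hn' : (n : ℝ) ≠ 0 := by positivity
  rcases mul_eq_zero.1 hH with h | h
  · exact absurd h (by simp [hn'])
  · exact h

end MeanCurvature

/-! ### The profile of the catenoid -/

section Profile

variable {n : ℕ}

/-- The radius `(E cosh θ)^{1/(2n-1)}` of the catenoid at the parameter `θ`. -/
def profileRadius (n : ℕ) (E θ : ℝ) : ℝ := (E * Real.cosh θ) ^ (1 / (2 * (n : ℝ) - 1))

/-- The height of the catenoid at the parameter `θ`. -/
def profileHeight (n : ℕ) (E θ : ℝ) : ℝ :=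
  ∫ s in (0 : ℝ)..θ, profileRadius n E s ^ 2 / ((2 * (n : ℝ) - 1) * Real.cosh s)

theorem two_mul_sub_one_pos (hn : 1 ≤ n) : 0 < 2 * (n : ℝ) - 1 := by
  have : (1 : ℝ) ≤ n := by exact_mod_cast hn
  linarith

theorem cast_two_mul_sub_one (hn : 1 ≤ n) : ((2 * n - 1 : ℕ) : ℝ) = 2 * (n : ℝ) - 1 := by
  rw [Nat.cast_sub (by omega)]; push_cast; ring

theorem profileRadius_pos {E : ℝ} (hE : 0 < E) (θ : ℝ) : 0 < profileRadius n E θ :=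
  Real.rpow_pos_of_pos (mul_pos hE (Real.cosh_pos θ)) _

theorem profileRadius_pow (hn : 1 ≤ n) {E : ℝ} (hE : 0 < E) (θ : ℝ) :
    profileRadius n E θ ^ (2 * n - 1) = E * Real.cosh θ := by
  rw [profileRadius, ← Real.rpow_natCast, ← Real.rpow_mul (mul_pos hE (Real.cosh_pos θ)).le,
    cast_two_mul_sub_one hn, one_div_mul_cancel (two_mul_sub_one_pos hn).ne', Real.rpow_one]

theorem eq_profileRadius (hn : 1 ≤ n) {E : ℝ} (hE : 0 < E) {r θ : ℝ} (hr : 0 ≤ r)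
    (h : r ^ (2 * n - 1) = E * Real.cosh θ) : r = profileRadius n E θ :=
  (pow_left_inj₀ hr (profileRadius_pos hE θ).le (by omega)).1
    (h.trans (profileRadius_pow hn hE θ).symm)

theorem profileRadius_neg (E θ : ℝ) : profileRadius n E (-θ) = profileRadius n E θ := by
  rw [profileRadius, Real.cosh_neg, profileRadius]

theorem contDiff_profileRadius {E : ℝ} (hE : 0 < E) : ContDiff ℝ ∞ (profileRadius n E) :=
  (contDiff_const.mul Real.contDiff_cosh).rpow_const_of_ne
    fun θ => (mul_pos hE (Real.cosh_pos θ)).ne'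

theorem hasDerivAt_profileRadius (hn : 1 ≤ n) {E : ℝ} (hE : 0 < E) (θ : ℝ) :
    HasDerivAt (profileRadius n E)
      (profileRadius n E θ * Real.sinh θ / ((2 * (n : ℝ) - 1) * Real.cosh θ)) θ := by
  have hc := mul_pos hE (Real.cosh_pos θ)
  have h := ((Real.hasDerivAt_cosh θ).const_mul E).rpow_const
    (p := 1 / (2 * (n : ℝ) - 1)) (Or.inl hc.ne')
  refine h.congr_deriv ?_
  have := (two_mul_sub_one_pos hn).ne'
  have := (Real.cosh_pos θ).ne'
  rw [Real.rpow_sub_one hc.ne', profileRadius]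
  field_simp

theorem contDiff_profileHeight_deriv (hn : 1 ≤ n) {E : ℝ} (hE : 0 < E) :
    ContDiff ℝ ∞
      (fun s => profileRadius n E s ^ 2 / ((2 * (n : ℝ) - 1) * Real.cosh s)) :=
  ((contDiff_profileRadius hE).pow 2).div (contDiff_const.mul Real.contDiff_cosh)
    fun s => (mul_pos (two_mul_sub_one_pos hn) (Real.cosh_pos s)).ne'

theorem hasDerivAt_profileHeight (hn : 1 ≤ n) {E : ℝ} (hE : 0 < E) (θ : ℝ) :
    HasDerivAt (profileHeight n E)
      (profileRadius n E θ ^ 2 / ((2 * (n : ℝ) - 1) * Real.cosh θ)) θ :=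
  (contDiff_profileHeight_deriv hn hE).continuous.integral_hasStrictDerivAt 0 θ |>.hasDerivAt

theorem contDiff_profileHeight (hn : 1 ≤ n) {E : ℝ} (hE : 0 < E) :
    ContDiff ℝ ∞ (profileHeight n E) := by
  rw [contDiff_infty_iff_deriv]
  refine ⟨fun θ => (hasDerivAt_profileHeight hn hE θ).differentiableAt, ?_⟩
  rw [show deriv (profileHeight n E) = _ from
    funext fun θ => (hasDerivAt_profileHeight hn hE θ).deriv]
  exact contDiff_profileHeight_deriv hn hE

theorem profileHeight_deriv_pos (hn : 1 ≤ n) {E : ℝ} (hE : 0 < E) (θ : ℝ) :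
    0 < profileRadius n E θ ^ 2 / ((2 * (n : ℝ) - 1) * Real.cosh θ) :=
  div_pos (pow_pos (profileRadius_pos hE θ) 2)
    (mul_pos (two_mul_sub_one_pos hn) (Real.cosh_pos θ))

theorem strictMono_profileHeight (hn : 1 ≤ n) {E : ℝ} (hE : 0 < E) :
    StrictMono (profileHeight n E) :=
  strictMono_of_hasDerivAt_pos (hasDerivAt_profileHeight hn hE) (profileHeight_deriv_pos hn hE)

theorem profileHeight_zero (E : ℝ) : profileHeight n E 0 = 0 := intervalIntegral.integral_same

theorem profileHeight_neg (E θ : ℝ) : profileHeight n E (-θ) = -profileHeight n E θ := by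
  have h := intervalIntegral.integral_comp_neg (a := 0) (b := θ)
    (fun s => profileRadius n E s ^ 2 / ((2 * (n : ℝ) - 1) * Real.cosh s))
  simp only [profileRadius_neg, Real.cosh_neg, neg_zero] at h
  rw [profileHeight, intervalIntegral.integral_symm, profileHeight, h]

end Profile

/-! ### Local analysis in a chart -/

section Local

open Filter Topology

variable {n : ℕ} {V : Type*} [NormedAddCommGroup V] [NormedSpace ℝ V]

/-- At a point of a non-open map whose differential contains the tangent space of the orbit, the
differentials of the radius and of the height are proportional. -/
theorem proportional_of_not_surjective {G : V →L[ℝ] Space n} {z : EuclideanSpace ℂ (Fin n)}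
    (hG : ¬ Function.Surjective G)
    (hz : ∀ v : EuclideanSpace ℂ (Fin n), inner ℝ z v = 0 → ∃ e, G e = WithLp.toLp 2 (v, 0))
    (e e' : V) :
    inner ℝ z (G e).fst * (G e').snd = inner ℝ z (G e').fst * (G e).snd := by
  by_contra hne
  apply hG
  intro u
  set δ := inner ℝ z (G e).fst * (G e').snd - inner ℝ z (G e').fst * (G e).snd with hδ
  have hδ0 : δ ≠ 0 := sub_ne_zero.2 hne
  -- Cramer's rule for the two equations prescribing `⟪z, dz⟫` and `dt`; what remains of the target
  -- is orthogonal to `z` and horizontal, hence tangent to the orbit and already in the image.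
  set x := (inner ℝ z u.fst * (G e').snd - inner ℝ z (G e').fst * u.snd) / δ with hx
  set y := (inner ℝ z (G e).fst * u.snd - inner ℝ z u.fst * (G e).snd) / δ with hy
  obtain ⟨e'', he''⟩ := hz (u.fst - x • (G e).fst - y • (G e').fst) (by
    simp only [inner_sub_right, inner_smul_right]
    rw [hx, hy]
    field_simp
    rw [hδ]
    ring)
  refine ⟨x • e + y • e' + e'', ?_⟩
  rw [map_add, map_add, map_smul, map_smul, he'']
  refine Space.ext ?_ ?_
  · simp
  · simp
    rw [hx, hy]
    field_simp
    rw [hδ]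
    ring

/-- If both covectors vanished, `dt = 0` would make `dz` injective, hence onto `ℂⁿ` by equality of
dimensions; a preimage of `z` would then give `⟪z, z⟫ = 0`. -/
theorem exists_nondegenerate [FiniteDimensional ℝ V] (hV : Module.finrank ℝ V = 2 * n)
    {G : V →L[ℝ] Space n} {z : EuclideanSpace ℂ (Fin n)} (hG : Function.Injective G)
    (hz : z ≠ 0) : ∃ e, inner ℝ z (G e).fst ≠ 0 ∨ (G e).snd ≠ 0 := by
  by_contra! h
  have hinj : Function.Injective ((fstL n).comp G : V →ₗ[ℝ] EuclideanSpace ℂ (Fin n)) := by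
    intro a b hab
    apply hG
    exact Space.ext hab (((h a).2).trans (h b).2.symm)
  have hs := (LinearMap.injective_iff_surjective_of_finrank_eq_finrank
    (hV.trans finrank_complex.symm)).1 hinj
  obtain ⟨e, he⟩ := hs z
  have h1 := (h e).1
  rw [show (G e).fst = z from he] at h1
  exact hz (inner_self_eq_zero.1 h1)

/-- If `α dρ = w dτ` then `(dα ∧ dρ) = (dw ∧ dτ)`. -/
theorem wedge_eq {ρ τ α w : V → ℝ} {y : V} (hρ : ContDiffAt ℝ 2 ρ y) (hτ : ContDiffAt ℝ 2 τ y)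
    (hα : DifferentiableAt ℝ α y) (hw : DifferentiableAt ℝ w y)
    (h : ∀ᶠ x in 𝓝 y, ∀ e, α x * fderiv ℝ ρ x e = w x * fderiv ℝ τ x e) (e e' : V) :
    fderiv ℝ α y e' * fderiv ℝ ρ y e - fderiv ℝ w y e' * fderiv ℝ τ y e
      = fderiv ℝ α y e * fderiv ℝ ρ y e' - fderiv ℝ w y e * fderiv ℝ τ y e' := by
  have hd : ∀ {u : V → ℝ}, ContDiffAt ℝ 2 u y →
      ∀ a, HasFDerivAt (fun x => fderiv ℝ u x a)
        ((ContinuousLinearMap.apply ℝ ℝ a).comp (fderiv ℝ (fderiv ℝ u) y)) y := by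
    intro u hu a
    have : DifferentiableAt ℝ (fderiv ℝ u) y :=
      (hu.fderiv_right (m := 1) (by norm_num)).differentiableAt one_ne_zero
    exact (ContinuousLinearMap.apply ℝ ℝ a).hasFDerivAt.comp y this.hasFDerivAt
  -- Differentiate `α dρ = w dτ`. Antisymmetrizing in the two directions then removes the Hessians
  -- by their symmetry, which is where the class `C²` enters.
  have key : ∀ a b, fderiv ℝ α y b * fderiv ℝ ρ y a + α y * fderiv ℝ (fderiv ℝ ρ) y b a
      = fderiv ℝ w y b * fderiv ℝ τ y a + w y * fderiv ℝ (fderiv ℝ τ) y b a := by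
    intro a b
    have h1 := (hα.hasFDerivAt.mul (hd hρ a))
    have h2 := (hw.hasFDerivAt.mul (hd hτ a))
    have h3 := h1.unique (h2.congr_of_eventuallyEq (h.mono fun x hx => hx a))
    have := DFunLike.congr_fun h3 b
    simp at this
    linarith
  have s1 : fderiv ℝ (fderiv ℝ ρ) y e e' = fderiv ℝ (fderiv ℝ ρ) y e' e :=
    (hρ.isSymmSndFDerivAt (by simp)).eq e e'
  have s2 : fderiv ℝ (fderiv ℝ τ) y e e' = fderiv ℝ (fderiv ℝ τ) y e' e :=
    (hτ.isSymmSndFDerivAt (by simp)).eq e e'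
  have k1 := key e e'
  have k2 := key e' e
  rw [s1, s2] at k2
  linarith

end Local

/-! ### The profile direction, its energy and the catenary equation in a chart. -/

section LocalProfile

open Filter Topology

variable {n : ℕ} {V : Type*} [NormedAddCommGroup V] [NormedSpace ℝ V]

/-- The differential of the profile curve: `w ⟪z, dz⟫ + α dt`. -/
def profileForm (g : V → Space n) (α w : V → ℝ) (y e : V) : ℝ :=
  w y * inner ℝ (g y).fst (fderiv ℝ g y e).fst + α y * (fderiv ℝ g y e).snd

/-- `(w, α)` is the unit direction of the differential of `(|z|² / 2, t)` along `g`. -/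
structure IsProfile (g : V → Space n) (B : Set V) (α w : V → ℝ) : Prop where
  contDiffOn_left : ContDiffOn ℝ 1 α B
  contDiffOn_right : ContDiffOn ℝ 1 w B
  sq_add_sq : ∀ y ∈ B, α y ^ 2 + w y ^ 2 = 1
  tangent : ∀ y ∈ B, ∀ e, α y * inner ℝ (g y).fst (fderiv ℝ g y e).fst
    = w y * (fderiv ℝ g y e).snd
  nondegenerate : ∀ y ∈ B, ∃ e, profileForm g α w y e ≠ 0

theorem IsProfile.radial {g : V → Space n} {B : Set V} {α w : V → ℝ} (h : IsProfile g B α w)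
    {y : V} (hy : y ∈ B) (e : V) :
    inner ℝ (g y).fst (fderiv ℝ g y e).fst = w y * profileForm g α w y e := by
  rw [profileForm]
  linear_combination α y * h.tangent y hy e
    - inner ℝ (g y).fst (fderiv ℝ g y e).fst * h.sq_add_sq y hy

theorem IsProfile.vertical {g : V → Space n} {B : Set V} {α w : V → ℝ} (h : IsProfile g B α w)
    {y : V} (hy : y ∈ B) (e : V) :
    (fderiv ℝ g y e).snd = α y * profileForm g α w y e := by
  rw [profileForm]
  linear_combination -w y * h.tangent y hy e - (fderiv ℝ g y e).snd * h.sq_add_sq y hy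

/-- A single direction `e₀` suffices: normalize the values of the two covectors on `e₀`, which do
not vanish simultaneously near `y₀`. Rank one makes every other direction proportional to it. The
neighbourhood is a ball so that it is convex. -/
theorem exists_isProfile [FiniteDimensional ℝ V] (hV : Module.finrank ℝ V = 2 * n)
    {g : V → Space n} {B : Set V} (hB : IsOpen B) (hg : ContDiffOn ℝ 2 g B) {y₀ : V} (hy₀ : y₀ ∈ B)
    (h0 : ∀ y ∈ B, (g y).fst ≠ 0) (hns : ∀ y ∈ B, ¬ Function.Surjective (fderiv ℝ g y))
    (ht : ∀ y ∈ B, ∀ v : EuclideanSpace ℂ (Fin n), inner ℝ (g y).fst v = 0 →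
      ∃ e, fderiv ℝ g y e = WithLp.toLp 2 (v, 0))
    (hinj : Function.Injective (fderiv ℝ g y₀)) :
    ∃ B' ⊆ B, IsOpen B' ∧ Convex ℝ B' ∧ y₀ ∈ B' ∧ ∃ α w, IsProfile g B' α w := by
  obtain ⟨e₀, he₀⟩ := exists_nondegenerate hV hinj (h0 y₀ hy₀)
  set A : V → ℝ := fun y => inner ℝ (g y).fst (fderiv ℝ g y e₀).fst with hA
  set b : V → ℝ := fun y => (fderiv ℝ g y e₀).snd with hb
  have hdg : ContDiffOn ℝ 1 (fun y => fderiv ℝ g y e₀) B :=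
    (hg.fderiv_of_isOpen hB (by norm_num)).clm_apply contDiffOn_const
  have hAc : ContDiffOn ℝ 1 A B :=
    ((fstL n).contDiff.comp_contDiffOn (hg.of_le one_le_two)).inner ℝ
      ((fstL n).contDiff.comp_contDiffOn hdg)
  have hbc : ContDiffOn ℝ 1 b B := (sndL n).contDiff.comp_contDiffOn hdg
  set s : V → ℝ := fun y => A y ^ 2 + b y ^ 2 with hs
  have hsc : ContDiffOn ℝ 1 s B := (hAc.pow 2).add (hbc.pow 2)
  have hs0 : 0 < s y₀ := by
    rcases he₀ with h | h
    · have : 0 < A y₀ ^ 2 := by positivity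
      have := sq_nonneg (b y₀)
      simp only [hs]; linarith
    · have : 0 < b y₀ ^ 2 := by positivity
      have := sq_nonneg (A y₀)
      simp only [hs]; linarith
  have hmem : B ∩ s ⁻¹' Set.Ioi 0 ∈ 𝓝 y₀ :=
    (hsc.continuousOn.isOpen_inter_preimage hB isOpen_Ioi).mem_nhds ⟨hy₀, hs0⟩
  obtain ⟨ε, hε, hball⟩ := Metric.mem_nhds_iff.1 hmem
  have hsub : Metric.ball y₀ ε ⊆ B := fun y hy => (hball hy).1
  have hpos : ∀ y ∈ Metric.ball y₀ ε, 0 < s y := fun y hy => (hball hy).2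
  refine ⟨Metric.ball y₀ ε, hsub, Metric.isOpen_ball, convex_ball _ _, Metric.mem_ball_self hε,
    fun y => b y / Real.sqrt (s y), fun y => A y / Real.sqrt (s y), ?_, ?_, ?_, ?_, ?_⟩
  · exact (hbc.mono hsub).div ((hsc.mono hsub).sqrt fun y hy => (hpos y hy).ne')
      fun y hy => (Real.sqrt_pos.2 (hpos y hy)).ne'
  · exact (hAc.mono hsub).div ((hsc.mono hsub).sqrt fun y hy => (hpos y hy).ne')
      fun y hy => (Real.sqrt_pos.2 (hpos y hy)).ne'
  · intro y hy
    rw [div_pow, div_pow, Real.sq_sqrt (hpos y hy).le, ← add_div, add_comm]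
    exact div_self (hpos y hy).ne'
  · intro y hy e
    have := proportional_of_not_surjective (hns y (hsub hy)) (ht y (hsub hy)) e₀ e
    rw [div_mul_eq_mul_div, div_mul_eq_mul_div]
    congr 1
    simp only [hA, hb]
    linarith
  · intro y hy
    refine ⟨e₀, ?_⟩
    have : profileForm g (fun y => b y / Real.sqrt (s y)) (fun y => A y / Real.sqrt (s y)) y e₀
        = s y / Real.sqrt (s y) := by
      simp only [profileForm, hs, hA, hb]; ring
    rw [this]
    exact (div_pos (hpos y hy) (Real.sqrt_pos.2 (hpos y hy))).ne'

theorem fderiv_half_norm_sq {g : V → Space n} {y : V} (hg : DifferentiableAt ℝ g y) (e : V) :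
    fderiv ℝ (fun x => (1 / 2 : ℝ) * ‖(g x).fst‖ ^ 2) y e
      = inner ℝ (g y).fst (fderiv ℝ g y e).fst := by
  have h := ((((fstL n).hasFDerivAt.comp y hg.hasFDerivAt).norm_sq).const_mul (1 / 2 : ℝ)).fderiv
  have h' := DFunLike.congr_fun h e
  refine h'.trans ?_
  simp

theorem fderiv_snd {g : V → Space n} {y : V} (hg : DifferentiableAt ℝ g y) (e : V) :
    fderiv ℝ (fun x => (g x).snd) y e = (fderiv ℝ g y e).snd :=
  DFunLike.congr_fun ((sndL n).hasFDerivAt.comp y hg.hasFDerivAt).fderiv e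

/-- The direction of the profile only varies along the profile. -/
theorem IsProfile.exists_curvature {g : V → Space n} {B : Set V} {α w : V → ℝ}
    (h : IsProfile g B α w) (hB : IsOpen B) (hg : ContDiffOn ℝ 2 g B) {y : V} (hy : y ∈ B) :
    ∃ μ : ℝ, (∀ e, fderiv ℝ α y e = profileForm g α w y e * (-(w y * μ))) ∧
      ∀ e, fderiv ℝ w y e = profileForm g α w y e * (α y * μ) := by
  have hBy := hB.mem_nhds hy
  have hgd : ∀ x ∈ B, DifferentiableAt ℝ g x := fun x hx =>
    (hg.contDiffAt (hB.mem_nhds hx)).differentiableAt two_ne_zero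
  have hα := (h.contDiffOn_left.contDiffAt hBy).differentiableAt one_ne_zero
  have hw := (h.contDiffOn_right.contDiffAt hBy).differentiableAt one_ne_zero
  have hgy := hg.contDiffAt hBy
  have hwedge := wedge_eq (ρ := fun x => (1 / 2 : ℝ) * ‖(g x).fst‖ ^ 2) (τ := fun x => (g x).snd)
    (contDiffAt_const.mul (((fstL n).contDiff.contDiffAt.comp y hgy).norm_sq ℝ))
    ((sndL n).contDiff.contDiffAt.comp y hgy) hα hw
    (eventually_of_mem hBy fun x hx e => by
      rw [fderiv_half_norm_sq (hgd x hx), fderiv_snd (hgd x hx)]; exact h.tangent x hx e)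
  simp only [fderiv_half_norm_sq (hgd y hy), fderiv_snd (hgd y hy), h.radial hy, h.vertical hy]
    at hwedge
  have hsq : ∀ e, α y * fderiv ℝ α y e + w y * fderiv ℝ w y e = 0 := by
    intro e
    have h1 := (hα.hasFDerivAt.mul hα.hasFDerivAt).add (hw.hasFDerivAt.mul hw.hasFDerivAt)
    have h2 := h1.unique ((hasFDerivAt_const (1 : ℝ) y).congr_of_eventuallyEq
      (eventually_of_mem hBy fun x hx => by
        have := h.sq_add_sq x hx
        simp only [Pi.add_apply, Pi.mul_apply]
        linarith))
    have := DFunLike.congr_fun h2 e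
    simp at this
    linarith
  obtain ⟨e₁, he₁⟩ := h.nondegenerate y hy
  set l := profileForm g α w y
  -- With `⟪z, dz⟫ = w l` and `dt = α l`, the wedge identity says that `α dw - w dα` is a multiple
  -- of `l`. Together with `α dα + w dw = 0` this determines both differentials.
  have hμ : ∀ e, α y * fderiv ℝ w y e - w y * fderiv ℝ α y e
      = l e * ((α y * fderiv ℝ w y e₁ - w y * fderiv ℝ α y e₁) / l e₁) := by
    intro e
    have := hwedge e e₁
    field_simp
    linear_combination this
  have h1 := h.sq_add_sq y hy
  refine ⟨(α y * fderiv ℝ w y e₁ - w y * fderiv ℝ α y e₁) / l e₁, fun e => ?_, fun e => ?_⟩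
  · linear_combination -w y * hμ e + α y * hsq e - fderiv ℝ α y e * h1
  · linear_combination α y * hμ e + w y * hsq e - fderiv ℝ w y e * h1

/-- The equations of a minimal profile. -/
structure IsMinimalProfile (g : V → Space n) (B : Set V) (α w : V → ℝ) : Prop
    extends IsProfile g B α w where
  fderiv_left : ∀ y ∈ B, ∀ e, fderiv ℝ α y e
    = -((2 * n - 1) * (α y * w y) * ‖(g y).fst‖⁻¹ ^ 2) * profileForm g α w y e
  fderiv_right : ∀ y ∈ B, ∀ e, fderiv ℝ w y e
    = ((2 * n - 1) * α y ^ 2 * ‖(g y).fst‖⁻¹ ^ 2) * profileForm g α w y e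

theorem hasFDerivAt_norm_fst {g : V → Space n} {y : V} (hg : DifferentiableAt ℝ g y)
    (h0 : (g y).fst ≠ 0) :
    HasFDerivAt (fun x => ‖(g x).fst‖)
      (‖(g y).fst‖⁻¹ • (innerSL ℝ (g y).fst).comp ((fstL n).comp (fderiv ℝ g y))) y := by
  have hr : ‖(g y).fst‖ ≠ 0 := norm_ne_zero_iff.2 h0
  have h := hasFDerivAt_norm_inv ((fstL n).hasFDerivAt.comp y hg.hasFDerivAt) h0
  have h1 := (hasDerivAt_inv (inv_ne_zero hr)).comp_hasFDerivAt y h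
  simp only [Function.comp_def, inv_inv, fstL_apply] at h1
  refine h1.congr_fderiv ?_
  ext e
  simp
  field_simp

theorem eq_of_fderiv_eq_zero_on {B : Set V} (hB : IsOpen B) (hc : Convex ℝ B) {u : V → ℝ}
    (hu : ∀ y ∈ B, HasFDerivAt u (0 : V →L[ℝ] ℝ) y) {x y : V} (hx : x ∈ B) (hy : y ∈ B) :
    u x = u y :=
  hB.is_const_of_fderiv_eq_zero hc.isPreconnected
    (fun z hz => (hu z hz).differentiableAt.differentiableWithinAt)
    (fun z hz => (hu z hz).fderiv) hx hy

/-- Conservation of energy: as `|z| d|z| = w l`, the growth of `|z|^(2n-1)` is exactly offset by the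
minimal equation for `dα`. -/
theorem IsMinimalProfile.energy_eq {g : V → Space n} {B : Set V} {α w : V → ℝ} (hn : 1 ≤ n)
    (h : IsMinimalProfile g B α w) (hB : IsOpen B) (hc : Convex ℝ B)
    (hg : ∀ y ∈ B, DifferentiableAt ℝ g y) (h0 : ∀ y ∈ B, (g y).fst ≠ 0) {x y : V} (hx : x ∈ B)
    (hy : y ∈ B) :
    ‖(g x).fst‖ ^ (2 * n - 1) * α x = ‖(g y).fst‖ ^ (2 * n - 1) * α y := by
  refine eq_of_fderiv_eq_zero_on (u := fun y => ‖(g y).fst‖ ^ (2 * n - 1) * α y) hB hc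
    (fun y hy => ?_) hx hy
  have hr : ‖(g y).fst‖ ≠ 0 := norm_ne_zero_iff.2 (h0 y hy)
  have hα := ((h.contDiffOn_left.contDiffAt (hB.mem_nhds hy)).differentiableAt
    one_ne_zero).hasFDerivAt
  refine (((hasFDerivAt_norm_fst (hg y hy) (h0 y hy)).pow (2 * n - 1)).mul hα).congr_fderiv ?_
  ext e
  obtain ⟨k, hk⟩ : ∃ k, 2 * n - 1 = k + 1 := ⟨2 * n - 2, by omega⟩
  have hk' : (2 * n - 1 : ℝ) = k + 1 := by
    rw [← cast_two_mul_sub_one hn, hk]; push_cast; ring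
  simp [h.fderiv_left y hy, h.radial hy, hk, hk']
  field_simp
  ring

/-- The parameter `θ = arsinh (w / α)` has `cosh θ = 1 / α`, so constant energy fixes the radius.
The equations give `dθ = (2n - 1) |z|⁻² l`, hence `dt = |z|² / ((2n - 1) cosh θ) dθ`. Unlike `|z|`,
this parameter is regular at the neck. -/
theorem IsMinimalProfile.height_eq {g : V → Space n} {B : Set V} {α w : V → ℝ} (hn : 1 ≤ n)
    (h : IsMinimalProfile g B α w) (hB : IsOpen B) (hc : Convex ℝ B)
    (hg : ∀ y ∈ B, DifferentiableAt ℝ g y) (h0 : ∀ y ∈ B, (g y).fst ≠ 0) {E : ℝ} (hE : 0 < E)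
    (hα : ∀ y ∈ B, ‖(g y).fst‖ ^ (2 * n - 1) * α y = E) :
    (∀ y ∈ B, ‖(g y).fst‖ = profileRadius n E (Real.arsinh (w y / α y))) ∧
    ∀ x ∈ B, ∀ y ∈ B, (g x).snd - profileHeight n E (Real.arsinh (w x / α x))
      = (g y).snd - profileHeight n E (Real.arsinh (w y / α y)) := by
  have hr : ∀ y ∈ B, 0 < ‖(g y).fst‖ := fun y hy => norm_pos_iff.2 (h0 y hy)
  have hα0 : ∀ y ∈ B, 0 < α y := fun y hy =>
    pos_of_mul_pos_right ((hα y hy).symm ▸ hE) (pow_pos (hr y hy) _).le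
  have hsq : ∀ y ∈ B, Real.sqrt (1 + (w y / α y) ^ 2) = (α y)⁻¹ := fun y hy => by
    have := hα0 y hy
    rw [show 1 + (w y / α y) ^ 2 = ((α y)⁻¹) ^ 2 by
      field_simp; linarith [h.sq_add_sq y hy], Real.sqrt_sq (by positivity)]
  have hrad : ∀ y ∈ B, ‖(g y).fst‖ = profileRadius n E (Real.arsinh (w y / α y)) := by
    intro y hy
    refine eq_profileRadius hn hE (hr y hy).le ?_
    rw [Real.cosh_arsinh, hsq y hy, ← hα y hy, mul_assoc, mul_inv_cancel₀ (hα0 y hy).ne', mul_one]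
  refine ⟨hrad, fun x hx y hy => ?_⟩
  refine eq_of_fderiv_eq_zero_on
    (u := fun y => (g y).snd - profileHeight n E (Real.arsinh (w y / α y))) hB hc
    (fun y hy => ?_) hx hy
  have hDα := ((h.contDiffOn_left.contDiffAt (hB.mem_nhds hy)).differentiableAt
    one_ne_zero).hasFDerivAt
  have hDw := ((h.contDiffOn_right.contDiffAt (hB.mem_nhds hy)).differentiableAt
    one_ne_zero).hasFDerivAt
  have h1 := (hDw.mul ((hasDerivAt_inv (hα0 y hy).ne').comp_hasFDerivAt y hDα)).arsinh
  have h2 := (hasDerivAt_profileHeight hn hE (Real.arsinh (w y * (α y)⁻¹))).comp_hasFDerivAt y h1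
  refine (((sndL n).hasFDerivAt.comp y (hg y hy).hasFDerivAt).sub h2).congr_fderiv ?_
  ext e
  have hc := h.sq_add_sq y hy
  have hα' := (hα0 y hy).ne'
  have hr' := (hr y hy).ne'
  have hm := (two_mul_sub_one_pos hn).ne'
  have hs := hsq y hy
  simp [h.fderiv_left y hy, h.fderiv_right y hy, h.vertical hy, ← div_eq_mul_inv, ← hrad y hy,
    Real.cosh_arsinh, hs]
  field_simp
  linear_combination -(α y * profileForm g α w y e) * hc

end LocalProfile

/-! ### Charts, and tangency of a hypersurface of revolution to the orbits. -/

section Tangency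

open Filter Topology

variable {n : ℕ} {M : Type*} [TopologicalSpace M]
  [ChartedSpace (EuclideanSpace ℝ (Fin (2 * n))) M]

section Chart

variable [IsManifold (𝓡 (2 * n)) 2 M] {f : M → Space n}

theorem contDiffOn_chart (hf : ContMDiff (𝓡 (2 * n)) 𝓘(ℝ, Space n) 2 f) (p : M) :
    ContDiffOn ℝ 2 (f ∘ (extChartAt (𝓡 (2 * n)) p).symm) (extChartAt (𝓡 (2 * n)) p).target :=
  (hf.comp_contMDiffOn (contMDiffOn_extChartAt_symm p)).contDiffOn

theorem eventuallyEq_chart (f : M → Space n) {p q : M}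
    (hq : q ∈ (extChartAt (𝓡 (2 * n)) p).source) :
    f =ᶠ[𝓝 q] (f ∘ (extChartAt (𝓡 (2 * n)) p).symm) ∘ extChartAt (𝓡 (2 * n)) p := by
  filter_upwards [extChartAt_source_mem_nhds' (I := 𝓡 (2 * n)) hq] with x hx
  exact (congrArg f ((extChartAt (𝓡 (2 * n)) p).left_inv hx)).symm

theorem hasMFDerivAt_chart {p q : M} (hq : q ∈ (extChartAt (𝓡 (2 * n)) p).source) :
    HasMFDerivAt (𝓡 (2 * n)) 𝓘(ℝ, EuclideanSpace ℝ (Fin (2 * n))) (extChartAt (𝓡 (2 * n)) p) q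
      (mfderiv (𝓡 (2 * n)) 𝓘(ℝ, EuclideanSpace ℝ (Fin (2 * n))) (extChartAt (𝓡 (2 * n)) p) q) :=
  have : IsManifold (𝓡 (2 * n)) 1 M := IsManifold.of_le one_le_two
  (mdifferentiableAt_extChartAt (by simpa using hq)).hasMFDerivAt

theorem bijective_mfderiv_chart {p q : M} (hq : q ∈ (extChartAt (𝓡 (2 * n)) p).source) :
    Function.Bijective
      (mfderiv (𝓡 (2 * n)) 𝓘(ℝ, EuclideanSpace ℝ (Fin (2 * n))) (extChartAt (𝓡 (2 * n)) p) q) := by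
  have : IsManifold (𝓡 (2 * n)) 1 M := IsManifold.of_le one_le_two
  exact (isInvertible_mfderiv_extChartAt (I := 𝓡 (2 * n)) hq).bijective

theorem dirDeriv_chart (hf : ContMDiff (𝓡 (2 * n)) 𝓘(ℝ, Space n) 2 f) {p q : M}
    (hq : q ∈ (extChartAt (𝓡 (2 * n)) p).source) (e : TangentSpace (𝓡 (2 * n)) q) :
    dirDeriv f q e = fderiv ℝ (f ∘ (extChartAt (𝓡 (2 * n)) p).symm) (extChartAt (𝓡 (2 * n)) p q)
      (mfderiv (𝓡 (2 * n)) 𝓘(ℝ, EuclideanSpace ℝ (Fin (2 * n)))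
        (extChartAt (𝓡 (2 * n)) p) q e) := by
  have hy := (extChartAt (𝓡 (2 * n)) p).map_source hq
  refine dirDeriv_eq_comp (hasMFDerivAt_chart hq) ?_ (eventuallyEq_chart f hq) e
  exact (((contDiffOn_chart hf p).contDiffAt
    ((isOpen_extChartAt_target p).mem_nhds hy)).differentiableAt two_ne_zero).hasFDerivAt

theorem range_fderiv_chart (hf : ContMDiff (𝓡 (2 * n)) 𝓘(ℝ, Space n) 2 f) {p q : M}
    (hq : q ∈ (extChartAt (𝓡 (2 * n)) p).source) :
    Set.range (fderiv ℝ (f ∘ (extChartAt (𝓡 (2 * n)) p).symm) (extChartAt (𝓡 (2 * n)) p q))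
      = Set.range (dirDeriv f q) := by
  ext u
  constructor
  · rintro ⟨e, rfl⟩
    obtain ⟨e', rfl⟩ := (bijective_mfderiv_chart hq).2 e
    exact ⟨e', dirDeriv_chart hf hq e'⟩
  · rintro ⟨e, rfl⟩
    exact ⟨_, (dirDeriv_chart hf hq e).symm⟩

theorem injective_fderiv_chart (hf : ContMDiff (𝓡 (2 * n)) 𝓘(ℝ, Space n) 2 f) {p q : M}
    (hq : q ∈ (extChartAt (𝓡 (2 * n)) p).source)
    (himm : Function.Injective (mfderiv (𝓡 (2 * n)) 𝓘(ℝ, Space n) f q)) :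
    Function.Injective
      (fderiv ℝ (f ∘ (extChartAt (𝓡 (2 * n)) p).symm) (extChartAt (𝓡 (2 * n)) p q)) := by
  intro a b hab
  obtain ⟨a', rfl⟩ := (bijective_mfderiv_chart hq).2 a
  obtain ⟨b', rfl⟩ := (bijective_mfderiv_chart hq).2 b
  rw [← dirDeriv_chart hf hq, ← dirDeriv_chart hf hq] at hab
  rw [himm hab]

/-- A hypersurface has empty interior. -/
theorem dense_compl_range [SecondCountableTopology M]
    (hf : ContMDiff (𝓡 (2 * n)) 𝓘(ℝ, Space n) 2 f) : Dense (Set.range f)ᶜ := by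
  have hex : ∀ p : M, ∃ ε > 0, Metric.ball (extChartAt (𝓡 (2 * n)) p p) ε
      ⊆ (extChartAt (𝓡 (2 * n)) p).target := fun p =>
    Metric.isOpen_iff.1 (isOpen_extChartAt_target p) _ (mem_extChartAt_target p)
  choose ε hε hball using hex
  set U : M → Set M := fun p => (extChartAt (𝓡 (2 * n)) p).source ∩
    extChartAt (𝓡 (2 * n)) p ⁻¹' Metric.ball (extChartAt (𝓡 (2 * n)) p p) (ε p) with hU
  have hUn : ∀ p, U p ∈ 𝓝 p := fun p =>
    inter_mem (extChartAt_source_mem_nhds p)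
      ((continuousAt_extChartAt p).preimage_mem_nhds (Metric.ball_mem_nhds _ (hε p)))
  obtain ⟨s, hs, hcov⟩ := TopologicalSpace.countable_cover_nhds hUn
  have hsub : Set.range f ⊆ ⋃ p ∈ s, (f ∘ (extChartAt (𝓡 (2 * n)) p).symm) ''
      Metric.ball (extChartAt (𝓡 (2 * n)) p p) (ε p) := by
    rintro _ ⟨q, rfl⟩
    have hq : q ∈ ⋃ p ∈ s, U p := hcov ▸ Set.mem_univ q
    obtain ⟨p, hp, hqp⟩ := Set.mem_iUnion₂.1 hq
    refine Set.mem_iUnion₂.2 ⟨p, hp, extChartAt (𝓡 (2 * n)) p q, hqp.2, ?_⟩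
    exact congrArg f ((extChartAt (𝓡 (2 * n)) p).left_inv hqp.1)
  -- The image lies in a countable union of `C¹` images of balls in `ℝ^{2n}`, so its Hausdorff
  -- dimension is at most `2n`, below the ambient `2n + 1`.
  refine dense_compl_of_dimH_lt_finrank (lt_of_le_of_lt (b := ((2 * n : ℕ) : ENNReal)) ?_ ?_)
  · refine (dimH_mono hsub).trans ?_
    rw [dimH_bUnion hs]
    refine iSup₂_le fun p _ => ?_
    have h1 := ((contDiffOn_chart hf p).mono (hball p)).of_le one_le_two
    refine (h1.dimH_image_le (convex_ball _ _) subset_rfl).trans ?_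
    refine (dimH_mono (Set.subset_univ _)).trans ?_
    rw [Real.dimH_univ_eq_finrank, finrank_euclideanSpace, Fintype.card_fin]
  · rw [finrank_space]
    exact_mod_cast Nat.lt_succ_self _

end Chart

theorem rotation_mem_range {f : M → Space n} (hf : IsHypersurfaceOfRevolution f) {q : M}
    {z : EuclideanSpace ℂ (Fin n)} (hz : ‖z‖ = ‖(f q).fst‖) :
    WithLp.toLp 2 (z, (f q).snd) ∈ Set.range f := by
  obtain ⟨R, hR, hRz⟩ := exists_rotation hz.symm
  obtain ⟨ψ, hψ⟩ := hf.invariant R hR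
  exact ⟨ψ q, by rw [hψ, rotate, hRz]⟩

/-- The map `(s, y) ↦ (|z| (z + s v) / |z + s v|, t)` sweeping out the orbits through `g`. -/
theorem hasFDerivAt_sweep {V : Type*} [NormedAddCommGroup V] [NormedSpace ℝ V] {g : V → Space n}
    {y : V} (hg : ContDiffAt ℝ 1 g y) (h0 : (g y).fst ≠ 0) {v : EuclideanSpace ℂ (Fin n)}
    (hv : inner ℝ (g y).fst v = 0) :
    HasStrictFDerivAt (fun x : ℝ × V => (WithLp.toLp 2 ((‖(g x.2).fst‖ * ‖(g x.2).fst + x.1 • v‖⁻¹) •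
        ((g x.2).fst + x.1 • v), (g x.2).snd) : Space n))
      ((fderiv ℝ g y).comp (ContinuousLinearMap.snd ℝ ℝ V)
        + (ContinuousLinearMap.fst ℝ ℝ V).smulRight (WithLp.toLp 2 (v, 0))) (0, y) := by
  have hg2 : ContDiffAt ℝ 1 (fun x : ℝ × V => g x.2) ((0 : ℝ), y) :=
    hg.comp ((0 : ℝ), y) contDiffAt_snd
  have hz : ContDiffAt ℝ 1 (fun x : ℝ × V => (g x.2).fst) ((0 : ℝ), y) :=
    (fstL n).contDiff.contDiffAt.comp _ hg2
  have hu : ContDiffAt ℝ 1 (fun x : ℝ × V => (g x.2).fst + x.1 • v) ((0 : ℝ), y) :=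
    hz.add (contDiffAt_fst.smul contDiffAt_const)
  have hu0 : (g ((0 : ℝ), y).2).fst + ((0 : ℝ), y).1 • v ≠ 0 := by simpa using h0
  have hc : ContDiffAt ℝ 1 (fun x : ℝ × V => (WithLp.toLp 2 ((‖(g x.2).fst‖ *
      ‖(g x.2).fst + x.1 • v‖⁻¹) • ((g x.2).fst + x.1 • v), (g x.2).snd) : Space n))
      ((0 : ℝ), y) := by
    have h1 := (inlL n).contDiff.contDiffAt.comp _
      (((hz.norm ℝ h0).mul ((hu.norm ℝ hu0).inv (norm_ne_zero_iff.2 hu0))).smul hu)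
    have h2 := (inrL n).contDiff.contDiffAt.comp _ ((sndL n).contDiff.contDiffAt.comp _ hg2)
    refine (h1.add h2).congr_of_eventuallyEq (Eventually.of_forall fun x => ?_)
    refine Space.ext ?_ ?_ <;> simp
  refine hc.hasStrictFDerivAt' ?_ one_ne_zero
  have hgd := hg.differentiableAt one_ne_zero
  have e1 : HasFDerivAt (fun x : ℝ × V => (g x.2).fst)
      ((fstL n).comp ((fderiv ℝ g y).comp (ContinuousLinearMap.snd ℝ ℝ V))) ((0 : ℝ), y) :=
    (fstL n).hasFDerivAt.comp _ (hgd.hasFDerivAt.comp ((0 : ℝ), y) hasFDerivAt_snd)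
  have e2 : HasFDerivAt (fun x : ℝ × V => (g x.2).fst + x.1 • v)
      ((fstL n).comp ((fderiv ℝ g y).comp (ContinuousLinearMap.snd ℝ ℝ V))
        + (ContinuousLinearMap.fst ℝ ℝ V).smulRight v) ((0 : ℝ), y) :=
    e1.add (hasFDerivAt_fst.smul_const v)
  have e3 := (hasFDerivAt_norm_fst hgd h0).comp ((0 : ℝ), y) (hasFDerivAt_snd (𝕜 := ℝ))
  have e4 := hasFDerivAt_norm_inv e2 hu0
  have e5 := (inlL n).hasFDerivAt.comp _ ((e3.mul e4).smul e2)
  have e6 := (inrL n).hasFDerivAt.comp _ ((sndL n).hasFDerivAt.comp _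
    (hgd.hasFDerivAt.comp ((0 : ℝ), y) hasFDerivAt_snd))
  have hr : ‖(g y).fst‖ ≠ 0 := norm_ne_zero_iff.2 h0
  refine ((e5.add e6).congr_of_eventuallyEq (Eventually.of_forall fun x => ?_)).congr_fderiv ?_
  · refine Space.ext ?_ ?_ <;> simp
  · refine ContinuousLinearMap.ext fun ⟨s, e⟩ => ?_
    refine Space.ext ?_ ?_
    · simp [hv, hr]
      left
      field_simp
      ring
    · simp

/-- Off the axis, the tangent space of a hypersurface of revolution contains that of the orbit. -/
theorem exists_dirDeriv_eq [IsManifold (𝓡 (2 * n)) 2 M] [SecondCountableTopology M]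
    {f : M → Space n} (hf : IsHypersurfaceOfRevolution f) {q : M} (h0 : (f q).fst ≠ 0)
    {v : EuclideanSpace ℂ (Fin n)} (hv : inner ℝ (f q).fst v = 0) :
    ∃ e, dirDeriv f q e = WithLp.toLp 2 (v, 0) := by
  by_contra hne
  set φ := extChartAt (𝓡 (2 * n)) q with hφ
  set g := f ∘ φ.symm with hg
  have hq : q ∈ φ.source := mem_extChartAt_source q
  have hgq : g (φ q) = f q := congrArg f (φ.left_inv hq)
  have hgc : ContDiffAt ℝ 1 g (φ q) := ((contDiffOn_chart hf.contMDiff q).contDiffAt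
    ((isOpen_extChartAt_target q).mem_nhds (φ.map_source hq))).of_le one_le_two
  have hinj := injective_fderiv_chart hf.contMDiff hq (hf.immersion q)
  have hnr : WithLp.toLp 2 (v, 0) ∉ Set.range (fderiv ℝ g (φ q)) := by
    rw [range_fderiv_chart hf.contMDiff hq]
    exact hne
  have hs := hasFDerivAt_sweep hgc (hgq.symm ▸ h0) (hgq.symm ▸ hv)
  set S := (fderiv ℝ g (φ q)).comp (ContinuousLinearMap.snd ℝ ℝ (EuclideanSpace ℝ (Fin (2 * n))))
    + (ContinuousLinearMap.fst ℝ ℝ (EuclideanSpace ℝ (Fin (2 * n)))).smulRight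
      (WithLp.toLp 2 (v, 0)) with hS
  have hSi : Function.Injective (S : ℝ × EuclideanSpace ℝ (Fin (2 * n)) →ₗ[ℝ] Space n) := by
    rw [injective_iff_map_eq_zero]
    rintro ⟨s, e⟩ hse
    have h1 : fderiv ℝ g (φ q) e + s • WithLp.toLp 2 (v, 0) = 0 := hse
    by_cases hs0 : s = 0
    · rw [hs0, zero_smul, add_zero] at h1
      rw [hs0, hinj (h1.trans (map_zero _).symm)]
      rfl
    · refine absurd ⟨-s⁻¹ • e, ?_⟩ hnr
      rw [map_smul, eq_neg_of_add_eq_zero_left h1, smul_neg, neg_smul, neg_neg, smul_smul,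
        inv_mul_cancel₀ hs0, one_smul]
  have hSs : (S : ℝ × EuclideanSpace ℝ (Fin (2 * n)) →ₗ[ℝ] Space n).range = ⊤ := by
    refine LinearMap.range_eq_top.2 ((LinearMap.injective_iff_surjective_of_finrank_eq_finrank
      ?_).1 hSi)
    rw [finrank_space, Module.finrank_prod, Module.finrank_self, finrank_euclideanSpace,
      Fintype.card_fin, add_comm]
  have hmap := hs.map_nhds_eq_of_surj hSs
  -- The sweep has invertible differential, so it maps neighbourhoods onto neighbourhoods. Each of
  -- its values near the base point is a rotated image point of `f`, and so lies in the range. This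
  -- contradicts the density of the complement.
  have hmem : Set.range f ∈ 𝓝 (f q) := by
    have : (WithLp.toLp 2 ((‖(g (φ q)).fst‖ * ‖(g (φ q)).fst + (0 : ℝ) • v‖⁻¹) •
        ((g (φ q)).fst + (0 : ℝ) • v), (g (φ q)).snd) : Space n) = f q := by
      have hr : ‖(f q).fst‖ ≠ 0 := norm_ne_zero_iff.2 h0
      rw [hgq]
      refine Space.ext ?_ ?_
      · simp [hr]
      · simp
    rw [← this]
    refine hmap ▸ Filter.mem_map.2 ?_
    have hnz : ∀ᶠ x : ℝ × EuclideanSpace ℝ (Fin (2 * n)) in 𝓝 (0, φ q),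
        (g x.2).fst + x.1 • v ≠ 0 := by
      have hcont : ContinuousAt (fun x : ℝ × EuclideanSpace ℝ (Fin (2 * n)) =>
          (g x.2).fst + x.1 • v) (0, φ q) := by
        have : ContinuousAt (fun x : ℝ × EuclideanSpace ℝ (Fin (2 * n)) => g x.2) (0, φ q) :=
          ContinuousAt.comp (f := Prod.snd) (x := ((0 : ℝ), φ q)) hgc.continuousAt continuousAt_snd
        exact ((fstL n).continuous.continuousAt.comp this).add
          (continuousAt_fst.smul continuousAt_const)
      refine hcont.eventually_ne ?_
      simpa [hgq] using h0
    filter_upwards [hnz] with x hx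
    refine rotation_mem_range hf (q := φ.symm x.2) ?_
    rw [norm_smul, norm_mul, norm_norm, norm_inv, norm_norm, mul_assoc,
      inv_mul_cancel₀ (norm_ne_zero_iff.2 hx), mul_one]
    rfl
  obtain ⟨u, hu, hu'⟩ := (dense_compl_range hf.contMDiff).inter_nhds_nonempty hmem
  exact hu hu'

end Tangency

/-! ### The energy as a global invariant, and the classification up to completeness. -/

section Classification

open Filter Topology

variable {n : ℕ} {M : Type*} [TopologicalSpace M]
  [ChartedSpace (EuclideanSpace ℝ (Fin (2 * n))) M]

/-- The squared energy `K = r^{4n-2} b² / (a² + b²)` at a point, where `(a, b)` is the differential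
of `(r² / 2, t)` in any direction that is not tangent to the orbit. -/
def IsEnergyAt (f : M → Space n) (q : M) (K : ℝ) : Prop :=
  ∀ e : TangentSpace (𝓡 (2 * n)) q,
    K * (inner ℝ (f q).fst (dirDeriv f q e).fst ^ 2 + (dirDeriv f q e).snd ^ 2)
      = (dirDeriv f q e).snd ^ 2 * ‖(f q).fst‖ ^ (2 * (2 * n - 1))

/-- At `q` the immersion is tangent to the catenoid of energy `E` with neck at height `c`. -/
def IsCatenoidAt (f : M → Space n) (E c : ℝ) (q : M) : Prop :=
  ∃ θ, ‖(f q).fst‖ = profileRadius n E θ ∧ (f q).snd = c + profileHeight n E θ ∧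
    ∀ e : TangentSpace (𝓡 (2 * n)) q,
      inner ℝ (f q).fst (dirDeriv f q e).fst = Real.sinh θ * (dirDeriv f q e).snd

/-- The direction `(w, α)` is defined only up to sign; this change of orientation makes a nonzero
energy positive. -/
theorem IsMinimalProfile.neg {V : Type*} [NormedAddCommGroup V] [NormedSpace ℝ V]
    {g : V → Space n} {B : Set V} {α w : V → ℝ} (h : IsMinimalProfile g B α w) :
    IsMinimalProfile g B (fun y => -α y) (fun y => -w y) := by
  have hl : ∀ y e, profileForm g (fun y => -α y) (fun y => -w y) y e = -profileForm g α w y e :=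
    fun y e => by simp only [profileForm]; ring
  refine ⟨⟨h.contDiffOn_left.neg, h.contDiffOn_right.neg, fun y hy => ?_, fun y hy e => ?_,
    fun y hy => ?_⟩, fun y hy e => ?_, fun y hy e => ?_⟩
  · linear_combination h.sq_add_sq y hy
  · linear_combination -h.tangent y hy e
  · obtain ⟨e, he⟩ := h.nondegenerate y hy
    exact ⟨e, by rw [hl]; exact neg_ne_zero.2 he⟩
  · rw [fderiv_fun_neg, hl, neg_apply, h.fderiv_left y hy]; ring
  · rw [fderiv_fun_neg, hl, neg_apply, h.fderiv_right y hy]; ring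

variable [IsManifold (𝓡 (2 * n)) 2 M] {f : M → Space n}

theorem exists_dirDeriv_ne_zero (hf : IsHypersurfaceOfRevolution f) {q : M}
    (h0 : (f q).fst ≠ 0) :
    ∃ e, inner ℝ (f q).fst (dirDeriv f q e).fst ≠ 0 ∨ (dirDeriv f q e).snd ≠ 0 :=
  exists_nondegenerate (V := EuclideanSpace ℝ (Fin (2 * n)))
    (by rw [finrank_euclideanSpace, Fintype.card_fin])
    (G := mfderiv (𝓡 (2 * n)) 𝓘(ℝ, Space n) f q) (hf.immersion q) h0

theorem IsEnergyAt.unique (hf : IsHypersurfaceOfRevolution f) {q : M} (h0 : (f q).fst ≠ 0)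
    {K K' : ℝ} (h : IsEnergyAt f q K) (h' : IsEnergyAt f q K') : K = K' := by
  obtain ⟨e, he⟩ := exists_dirDeriv_ne_zero hf h0
  have h1 := (h e).trans (h' e).symm
  refine mul_right_cancel₀ ?_ h1
  rcases he with he | he <;> positivity

theorem IsEnergyAt.nonneg (hf : IsHypersurfaceOfRevolution f) {q : M} (h0 : (f q).fst ≠ 0)
    {K : ℝ} (h : IsEnergyAt f q K) : 0 ≤ K := by
  obtain ⟨e, he⟩ := exists_dirDeriv_ne_zero hf h0
  have hpos : 0 < inner ℝ (f q).fst (dirDeriv f q e).fst ^ 2 + (dirDeriv f q e).snd ^ 2 := by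
    rcases he with he | he <;> positivity
  refine nonneg_of_mul_nonneg_left ?_ hpos
  rw [h e]
  positivity

/-- This comes from `b² ≤ a² + b²`, and it forces the energy to tend to zero at the axis. -/
theorem IsEnergyAt.le (hf : IsHypersurfaceOfRevolution f) {q : M} (h0 : (f q).fst ≠ 0)
    {K : ℝ} (h : IsEnergyAt f q K) : K ≤ ‖(f q).fst‖ ^ (2 * (2 * n - 1)) := by
  obtain ⟨e, he⟩ := exists_dirDeriv_ne_zero hf h0
  have hpos : 0 < inner ℝ (f q).fst (dirDeriv f q e).fst ^ 2 + (dirDeriv f q e).snd ^ 2 := by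
    rcases he with he | he <;> positivity
  refine le_of_mul_le_mul_right ?_ hpos
  rw [h e, mul_comm]
  gcongr
  linarith [sq_nonneg (inner ℝ (f q).fst (dirDeriv f q e).fst)]

/-- The slope `⟪z, dz⟫ / dt = sinh θ` recovers the parameter from the tangent space, and the height
then recovers `c`. The radius alone would leave the sign of `θ` undetermined. -/
theorem IsCatenoidAt.unique (hf : IsHypersurfaceOfRevolution f) {q : M} (h0 : (f q).fst ≠ 0)
    {E c c' : ℝ} (h : IsCatenoidAt f E c q) (h' : IsCatenoidAt f E c' q) : c = c' := by
  obtain ⟨e, he⟩ := exists_dirDeriv_ne_zero hf h0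
  obtain ⟨θ, -, h2, h3⟩ := h
  obtain ⟨θ', -, h2', h3'⟩ := h'
  have hb : (dirDeriv f q e).snd ≠ 0 := by
    intro hb
    have := h3 e
    rw [hb, mul_zero] at this
    exact he.elim (fun h => h this) (fun h => h hb)
  have : θ = θ' := Real.sinh_injective (mul_right_cancel₀ hb ((h3 e).symm.trans (h3' e)))
  rw [this] at h2
  linarith

variable [SecondCountableTopology M]

/-- The tangent space at an off-axis point contains the orbit directions, which yields a profile.
Its curvature `μ` is the only unknown in the minimal surface equation and is solved for there. -/
theorem exists_isMinimalProfile (hn : 1 ≤ n) (hf : IsHypersurfaceOfRevolution f)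
    (hmin : IsMinimal f) {q : M} (h0 : (f q).fst ≠ 0) :
    ∃ B ⊆ (extChartAt (𝓡 (2 * n)) q).target, IsOpen B ∧ Convex ℝ B ∧
      extChartAt (𝓡 (2 * n)) q q ∈ B ∧
      (∀ y ∈ B, (f ((extChartAt (𝓡 (2 * n)) q).symm y)).fst ≠ 0) ∧
      ∃ α w, IsMinimalProfile (f ∘ (extChartAt (𝓡 (2 * n)) q).symm) B α w := by
  set φ := extChartAt (𝓡 (2 * n)) q with hφ
  set g := f ∘ φ.symm with hg
  have hgc : ContDiffOn ℝ 2 g φ.target := contDiffOn_chart hf.contMDiff q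
  have hopen : IsOpen φ.target := isOpen_extChartAt_target q
  have hs : ∀ y ∈ φ.target, φ.symm y ∈ φ.source := fun y hy => φ.map_target hy
  have hr : ∀ y ∈ φ.target, φ (φ.symm y) = y := fun y hy => φ.right_inv hy
  set B₀ := φ.target ∩ (fun y => (g y).fst) ⁻¹' {0}ᶜ with hB₀
  have hB₀o : IsOpen B₀ :=
    ((fstL n).continuous.comp_continuousOn hgc.continuousOn).isOpen_inter_preimage hopen
      isOpen_compl_singleton
  have hq₀ : φ q ∈ B₀ := ⟨mem_extChartAt_target q, by
    simpa [hg, hφ] using h0⟩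
  have hinj : ∀ y ∈ φ.target, Function.Injective (fderiv ℝ g y) := fun y hy => by
    have := injective_fderiv_chart hf.contMDiff (hs y hy) (hf.immersion (φ.symm y))
    rwa [hr y hy] at this
  obtain ⟨B, hBB₀, hBo, hBc, hqB, α, w, hprof⟩ := exists_isProfile
    (by rw [finrank_euclideanSpace, Fintype.card_fin]) hB₀o (hgc.mono Set.inter_subset_left) hq₀
    (fun y hy => hy.2)
    (fun y hy hsurj => by
      have := (fderiv ℝ g y).toLinearMap.finrank_le_finrank_of_injective (hinj y hy.1)
      have h2 := LinearMap.finrank_range_of_inj (f := (fderiv ℝ g y).toLinearMap) (hinj y hy.1)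
      rw [LinearMap.range_eq_top.2 hsurj, finrank_top, finrank_space, finrank_euclideanSpace,
        Fintype.card_fin] at h2
      omega)
    (fun y hy v hv => by
      obtain ⟨e, he⟩ := exists_dirDeriv_eq hf (q := φ.symm y) hy.2 hv
      have : (WithLp.toLp 2 (v, 0) : Space n) ∈ Set.range (dirDeriv f (φ.symm y)) := ⟨e, he⟩
      rw [← range_fderiv_chart hf.contMDiff (hs y hy.1), hr y hy.1] at this
      exact this)
    (hinj _ hq₀.1)
  have hBt : B ⊆ φ.target := fun y hy => (hBB₀ hy).1
  refine ⟨B, hBt, hBo, hBc, hqB, fun y hy => (hBB₀ hy).2, α, w, ?_⟩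
  have hcurv : ∀ y ∈ B, ∃ μ : ℝ, μ = (2 * n - 1) * α y * ‖(g y).fst‖⁻¹ ^ 2 ∧
      (∀ e, fderiv ℝ α y e = profileForm g α w y e * (-(w y * μ))) ∧
      ∀ e, fderiv ℝ w y e = profileForm g α w y e * (α y * μ) := by
    intro y hy
    obtain ⟨μ, h1, h2⟩ := hprof.exists_curvature hBo (hgc.mono hBt) hy
    refine ⟨μ, ?_, h1, h2⟩
    have hφy := hr y (hBt hy)
    have hW : IsOpen (φ.source ∩ φ ⁻¹' B) :=
      (continuousOn_extChartAt q).isOpen_inter_preimage (isOpen_extChartAt_source q) hBo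
    have hc : ContMDiffOn (𝓡 (2 * n)) 𝓘(ℝ, EuclideanSpace ℝ (Fin (2 * n))) 1 φ
        (φ.source ∩ φ ⁻¹' B) := by
      have : IsManifold (𝓡 (2 * n)) 1 M := IsManifold.of_le one_le_two
      refine (contMDiffOn_extChartAt (n := 1)).mono fun x hx => ?_
      have := hx.1
      rwa [hφ, extChartAt_source] at this
    -- With `α' = -w μ` and `w' = α μ`, the equation reduces to `μ = (2n - 1) α / |z|²`.
    have := hmin.radial_equation hn hW hc (g := g)
      (fun p hp => (congrArg f (φ.left_inv hp.1)).symm)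
      hBo (fun p hp => hp.2) ((hgc.mono hBt).of_le one_le_two) hprof.contDiffOn_left
      hprof.contDiffOn_right (fun y hy => (hBB₀ hy).2) hprof.sq_add_sq hprof.tangent
      (q := φ.symm y) ⟨hs y (hBt hy), by rwa [Set.mem_preimage, hφy]⟩ (hf.immersion _)
      (α' := -(w y * μ)) (w' := α y * μ) (by rw [hφy]; ring)
      (by rw [hφy]; exact h1) (by rw [hφy]; exact h2)
    rw [hφy] at this
    have hr0 : ‖(g y).fst‖ ≠ 0 := norm_ne_zero_iff.2 (hBB₀ hy).2
    have hsq := hprof.sq_add_sq y hy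
    field_simp at this ⊢
    linear_combination -this - μ * ‖(g y).fst‖ ^ 2 * hsq
  refine ⟨hprof, fun y hy e => ?_, fun y hy e => ?_⟩
  · obtain ⟨μ, hμ, h1, -⟩ := hcurv y hy
    rw [h1, hμ]; ring
  · obtain ⟨μ, hμ, -, h2⟩ := hcurv y hy
    rw [h2, hμ]; ring

/-- The local classification off the axis. -/
theorem exists_energy_nhds (hn : 1 ≤ n) (hf : IsHypersurfaceOfRevolution f)
    (hmin : IsMinimal f) {q : M} (h0 : (f q).fst ≠ 0) :
    ∃ W ∈ 𝓝 q, ∃ K : ℝ, (∀ p ∈ W, (f p).fst ≠ 0 ∧ IsEnergyAt f p K) ∧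
      ∀ E, 0 < E → K = E ^ 2 → ∃ c, ∀ p ∈ W, IsCatenoidAt f E c p := by
  obtain ⟨B, hBt, hBo, hBc, hqB, hB0, α, w, hprof⟩ := exists_isMinimalProfile hn hf hmin h0
  set φ := extChartAt (𝓡 (2 * n)) q with hφ
  set g := f ∘ φ.symm with hg
  have hgc : ContDiffOn ℝ 2 g φ.target := contDiffOn_chart hf.contMDiff q
  have hgd : ∀ y ∈ B, DifferentiableAt ℝ g y := fun y hy =>
    (hgc.contDiffAt ((isOpen_extChartAt_target q).mem_nhds (hBt hy))).differentiableAt two_ne_zero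
  have hfg : ∀ p ∈ φ.source, f p = g (φ p) := fun p hp => (congrArg f (φ.left_inv hp)).symm
  have hde : ∀ p ∈ φ.source, ∀ e, ∃ e', dirDeriv f p e = fderiv ℝ g (φ p) e' := fun p hp e =>
    ⟨_, dirDeriv_chart hf.contMDiff hp e⟩
  refine ⟨φ.source ∩ φ ⁻¹' B, inter_mem (extChartAt_source_mem_nhds q)
    ((continuousAt_extChartAt q).preimage_mem_nhds (hBo.mem_nhds hqB)),
    -- The square is used because it does not depend on the local choice of sign of the profile.
    (‖(g (φ q)).fst‖ ^ (2 * n - 1) * α (φ q)) ^ 2, fun p hp => ⟨?_, fun e => ?_⟩,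
    fun E hE hK => ?_⟩
  · rw [hfg p hp.1]; exact hB0 _ hp.2
  · obtain ⟨e', he'⟩ := hde p hp.1 e
    rw [he', hfg p hp.1, hprof.radial hp.2, hprof.vertical hp.2,
      hprof.energy_eq hn hBo hBc hgd hB0 hqB hp.2]
    have := hprof.sq_add_sq _ hp.2
    rw [mul_comm 2 (2 * n - 1), pow_mul]
    linear_combination (‖(g (φ p)).fst‖ ^ (2 * n - 1) * α (φ p) *
      profileForm g α w (φ p) e') ^ 2 * this
  · have main : ∀ α w, IsMinimalProfile g B α w →
        ‖(g (φ q)).fst‖ ^ (2 * n - 1) * α (φ q) = E →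
        ∃ c, ∀ p ∈ φ.source ∩ φ ⁻¹' B, IsCatenoidAt f E c p := by
      intro α w hprof hE'
      have hen : ∀ y ∈ B, ‖(g y).fst‖ ^ (2 * n - 1) * α y = E := fun y hy =>
        (hprof.energy_eq hn hBo hBc hgd hB0 hy hqB).trans hE'
      obtain ⟨h1, h2⟩ := hprof.height_eq hn hBo hBc hgd hB0 hE hen
      refine ⟨(g (φ q)).snd - profileHeight n E (Real.arsinh (w (φ q) / α (φ q))),
        fun p hp => ⟨Real.arsinh (w (φ p) / α (φ p)), ?_, ?_, fun e => ?_⟩⟩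
      · rw [hfg p hp.1]; exact h1 _ hp.2
      · rw [hfg p hp.1, h2 _ hqB _ hp.2]; ring
      · have hα : α (φ p) ≠ 0 := by
          intro hα
          have := hen _ hp.2
          rw [hα, mul_zero] at this
          exact hE.ne this
        obtain ⟨e', he'⟩ := hde p hp.1 e
        rw [he', hfg p hp.1, hprof.radial hp.2, hprof.vertical hp.2,
          Real.sinh_arsinh]
        field_simp
    rcases sq_eq_sq_iff_eq_or_eq_neg.1 hK with h | h
    · exact main α w hprof h
    · exact main _ _ hprof.neg (by rw [mul_neg, h, neg_neg])

/-- The axis may separate the regular part of `M`, so local constancy off it is not enough. The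
extension of the energy by zero is continuous, and a continuous function with countably many real
values on a connected space is constant. -/
theorem exists_forall_isEnergyAt [ConnectedSpace M] (hn : 1 ≤ n)
    (hf : IsHypersurfaceOfRevolution f) (hmin : IsMinimal f) :
    ∃ K : ℝ, 0 ≤ K ∧ ∀ q, ((f q).fst = 0 → K = 0) ∧ IsEnergyAt f q K := by
  have hex : ∀ q, ∃ K : ℝ, ((f q).fst = 0 → K = 0) ∧ IsEnergyAt f q K := by
    intro q
    by_cases h0 : (f q).fst = 0
    · refine ⟨0, fun _ => rfl, fun e => ?_⟩
      rw [h0, norm_zero, zero_pow (by omega)]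
      ring
    · obtain ⟨W, hW, K, hK, -⟩ := exists_energy_nhds hn hf hmin h0
      exact ⟨K, fun h => absurd h h0, (hK q (mem_of_mem_nhds hW)).2⟩
  choose K hK0 hK using hex
  have hloc : ∀ q, (f q).fst ≠ 0 → ∀ᶠ p in 𝓝 q, (f p).fst ≠ 0 ∧ K p = K q := by
    intro q h0
    obtain ⟨W, hW, K', hK', -⟩ := exists_energy_nhds hn hf hmin h0
    filter_upwards [hW] with p hp
    exact ⟨(hK' p hp).1, ((hK p).unique hf (hK' p hp).1 (hK' p hp).2).trans
      ((hK q).unique hf h0 (hK' q (mem_of_mem_nhds hW)).2).symm⟩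
  have hnn : ∀ q, 0 ≤ K q := fun q => by
    by_cases h0 : (f q).fst = 0
    · exact (hK0 q h0).ge
    · exact (hK q).nonneg hf h0
  have hle : ∀ q, K q ≤ ‖(f q).fst‖ ^ (2 * (2 * n - 1)) := fun q => by
    by_cases h0 : (f q).fst = 0
    · rw [hK0 q h0]; positivity
    · exact (hK q).le hf h0
  have hfc : Continuous f := hf.contMDiff.continuous
  have hcont : Continuous K := by
    rw [continuous_iff_continuousAt]
    intro q
    by_cases h0 : (f q).fst = 0
    · have hlim : Tendsto (fun p => ‖(f p).fst‖ ^ (2 * (2 * n - 1))) (𝓝 q) (𝓝 0) := by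
        have : ContinuousAt (fun p => ‖(f p).fst‖ ^ (2 * (2 * n - 1))) q :=
          (((fstL n).continuous.comp hfc).norm.pow _).continuousAt
        have h1 := this.tendsto
        simp only [h0, norm_zero] at h1
        rwa [zero_pow (by omega)] at h1
      rw [ContinuousAt, hK0 q h0]
      exact squeeze_zero hnn hle hlim
    · exact (continuousAt_const (y := K q)).congr
        ((hloc q h0).mono fun p hp => hp.2.symm)
  -- The off-axis level sets are disjoint, nonempty and open; second countability allows only
  -- countably many of them.
  have hcount : (Set.range K).Countable := by
    have h1 : (K '' {q | (f q).fst ≠ 0}).Countable := by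
      refine Set.PairwiseDisjoint.countable_of_isOpen
        (s := fun k => {q | (f q).fst ≠ 0 ∧ K q = k}) ?_ ?_ ?_
      · intro k _ k' _ hkk'
        exact Set.disjoint_left.2 fun q hq hq' => hkk' (hq.2.symm.trans hq'.2)
      · intro k _
        refine isOpen_iff_mem_nhds.2 fun q hq => ?_
        filter_upwards [hloc q hq.1] with p hp
        exact ⟨hp.1, hp.2.trans hq.2⟩
      · rintro _ ⟨q, hq, rfl⟩
        exact ⟨q, hq, rfl⟩
    refine (h1.union (Set.countable_singleton (0 : ℝ))).mono ?_
    rintro _ ⟨q, rfl⟩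
    by_cases h0 : (f q).fst = 0
    · exact Or.inr (hK0 q h0)
    · exact Or.inl ⟨q, h0, rfl⟩
  have hsub : (Set.range K).Subsingleton :=
    hcount.isTotallyDisconnected _ subset_rfl (isPreconnected_range hcont)
  obtain ⟨q₀⟩ : Nonempty M := ConnectedSpace.toNonempty
  have hc : ∀ q, K q = K q₀ := fun q => hsub ⟨q, rfl⟩ ⟨q₀, rfl⟩
  exact ⟨K q₀, hnn q₀, fun q => ⟨fun h => (hc q).symm.trans (hK0 q h), hc q ▸ hK q⟩⟩

/-- A hypersurface of revolution of zero energy is horizontal. -/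
theorem isLocallyConstant_snd (hn : 1 ≤ n) (hf : IsHypersurfaceOfRevolution f)
    (hK : ∀ q, IsEnergyAt f q 0) : IsLocallyConstant fun q => (f q).snd := by
  have hb : ∀ p, (f p).fst ≠ 0 → ∀ e, (dirDeriv f p e).snd = 0 := by
    intro p h0 e
    have h1 := hK p e
    rw [zero_mul, eq_comm, mul_eq_zero] at h1
    rcases h1 with h1 | h1
    · exact pow_eq_zero_iff two_ne_zero |>.1 h1
    · exact absurd (norm_eq_zero.1 (pow_eq_zero_iff (by omega) |>.1 h1)) h0
  refine (IsLocallyConstant.iff_eventually_eq _).2 fun q => ?_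
  set φ := extChartAt (𝓡 (2 * n)) q with hφ
  set g := f ∘ φ.symm with hg
  have hgc : ContDiffOn ℝ 2 g φ.target := contDiffOn_chart hf.contMDiff q
  have hopen : IsOpen φ.target := isOpen_extChartAt_target q
  have hgd : ∀ y ∈ φ.target, DifferentiableAt ℝ g y := fun y hy =>
    (hgc.contDiffAt (hopen.mem_nhds hy)).differentiableAt two_ne_zero
  have hfd : ContinuousOn (fderiv ℝ g) φ.target := hgc.continuousOn_fderiv_of_isOpen hopen (by norm_num)
  have hoff : ∀ y ∈ φ.target, (g y).fst ≠ 0 → (sndL n).comp (fderiv ℝ g y) = 0 := by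
    intro y hy h0
    ext e
    have : fderiv ℝ g y e ∈ Set.range (dirDeriv f (φ.symm y)) := by
      rw [← range_fderiv_chart hf.contMDiff (φ.map_target hy), ← hφ, φ.right_inv hy]
      exact ⟨e, rfl⟩
    obtain ⟨e', he'⟩ := this
    change (fderiv ℝ g y e).snd = 0
    rw [← he']
    exact hb _ h0 _
  have hall : ∀ y ∈ φ.target, (sndL n).comp (fderiv ℝ g y) = 0 := by
    intro y hy
    -- If `dt ≠ 0` at `y`, the same holds nearby, so a whole neighbourhood is mapped into the axis.
    -- There `dz = 0`, and `dt` alone would be injective on a space of dimension `2n > 1`.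
    by_contra hne
    have hcont : ContinuousAt (fun y => (sndL n).comp (fderiv ℝ g y)) y :=
      ((continuous_const.clm_comp continuous_id).continuousAt.comp
        (hfd.continuousAt (hopen.mem_nhds hy)))
    have hz : (fun x => fstL n (g x)) =ᶠ[𝓝 y] fun _ => 0 := by
      filter_upwards [hcont.eventually_ne hne, hopen.mem_nhds hy] with x hx hxt
      by_contra h0
      exact hx (hoff x hxt h0)
    have hz' : (fstL n).comp (fderiv ℝ g y) = 0 :=
      ((fstL n).hasFDerivAt.comp y (hgd y hy).hasFDerivAt).unique
        ((hasFDerivAt_const _ _).congr_of_eventuallyEq hz)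
    have hinj := injective_fderiv_chart hf.contMDiff (φ.map_target hy) (hf.immersion (φ.symm y))
    rw [← hφ, φ.right_inv hy] at hinj
    have hinj2 : Function.Injective ((sndL n).comp (fderiv ℝ g y)).toLinearMap := by
      intro a b hab
      refine hinj (Space.ext ?_ hab)
      exact (DFunLike.congr_fun hz' a).trans (DFunLike.congr_fun hz' b).symm
    have := LinearMap.finrank_le_finrank_of_injective hinj2
    rw [finrank_euclideanSpace, Fintype.card_fin, Module.finrank_self] at this
    omega
  obtain ⟨ε, hε, hball⟩ := Metric.isOpen_iff.1 hopen _ (mem_extChartAt_target q)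
  filter_upwards [extChartAt_source_mem_nhds (I := 𝓡 (2 * n)) q,
    (continuousAt_extChartAt (I := 𝓡 (2 * n)) q).preimage_mem_nhds
      (Metric.ball_mem_nhds _ hε)] with p hp hpb
  have := eq_of_fderiv_eq_zero_on (u := fun y => (g y).snd) Metric.isOpen_ball (convex_ball _ _)
    (fun y hy => by
      have := (sndL n).hasFDerivAt.comp y (hgd y (hball hy)).hasFDerivAt
      rwa [hall y (hball hy)] at this) hpb (Metric.mem_ball_self hε)
  have hp' : f p = g (φ p) := (congrArg f (φ.left_inv hp)).symm
  have hq' : f q = g (φ q) := (congrArg f (φ.left_inv (mem_extChartAt_source q))).symm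
  rw [hp', hq']
  exact this

/-- The classification of minimal hypersurfaces of revolution, up to completeness. -/
theorem range_classification [ConnectedSpace M] (hn : 1 ≤ n)
    (hf : IsHypersurfaceOfRevolution f) (hmin : IsMinimal f) :
    (∃ c, ∀ q, (f q).snd = c) ∨ ∃ E c, 0 < E ∧ ∀ q, ∃ θ,
      ‖(f q).fst‖ = profileRadius n E θ ∧ (f q).snd = c + profileHeight n E θ := by
  obtain ⟨K, hK0, hK⟩ := exists_forall_isEnergyAt hn hf hmin
  obtain ⟨q₀⟩ : Nonempty M := ConnectedSpace.toNonempty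
  rcases hK0.eq_or_lt with rfl | hpos
  · exact Or.inl ⟨(f q₀).snd, fun q =>
      (isLocallyConstant_snd hn hf fun q => (hK q).2).apply_eq_of_preconnectedSpace q q₀⟩
  · have hoff : ∀ q, (f q).fst ≠ 0 := fun q h => hpos.ne' ((hK q).1 h)
    have hE : 0 < Real.sqrt K := Real.sqrt_pos.2 hpos
    have hloc : ∀ q, ∃ c, ∀ᶠ p in 𝓝 q, IsCatenoidAt f (Real.sqrt K) c p := by
      intro q
      obtain ⟨W, hW, K', hK', hc⟩ := exists_energy_nhds hn hf hmin (hoff q)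
      have hKK : K' = K := ((hK' q (mem_of_mem_nhds hW)).2).unique hf (hoff q) (hK q).2
      obtain ⟨c, hc⟩ := hc (Real.sqrt K) hE (hKK.trans (Real.sq_sqrt hK0).symm)
      exact ⟨c, eventually_of_mem hW hc⟩
    choose c hc using hloc
    -- Neighbouring values of `c` describe the same tangent catenoid at a common point, where the
    -- height of the neck is unique.
    have hlc : IsLocallyConstant c := (IsLocallyConstant.iff_eventually_eq _).2 fun q => by
      filter_upwards [hc q] with p hp
      exact ((hc p).self_of_nhds).unique hf (hoff p) hp
    refine Or.inr ⟨Real.sqrt K, c q₀, hE, fun q => ?_⟩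
    obtain ⟨θ, h1, h2, -⟩ := (hc q).self_of_nhds
    exact ⟨θ, h1, by rw [h2, hlc.apply_eq_of_preconnectedSpace q q₀]⟩

end Classification

/-! ### Lifting paths along a local homeomorphism. -/

section Lifting

open Filter Topology Set

variable {M : Type*} [TopologicalSpace M] {X : Type*} [TopologicalSpace X]

/-- The path `γ` lifts along `h` over `[0, s]` to a path from `p₀` to `p`. -/
def IsPathLift (h : M → X) (γ : ℝ → X) (p₀ : M) (s : ℝ) (p : M) : Prop :=
  ∃ σ : ℝ → M, ContinuousOn σ (Icc 0 s) ∧ σ 0 = p₀ ∧ σ s = p ∧ ∀ x ∈ Icc 0 s, h (σ x) = γ x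

/-- `k q` is a local inverse of `h` at `q`, for all `q`. -/
structure IsLocalInverse (h : M → X) (k : M → X → M) : Prop where
  apply_image : ∀ q, k q (h q) = q
  continuousAt : ∀ q, ∀ᶠ u in 𝓝 (h q), ContinuousAt (k q) u
  right_inverse : ∀ q, ∀ᶠ u in 𝓝 (h q), h (k q u) = u
  left_inverse : ∀ q, ∀ᶠ p in 𝓝 q, k q (h p) = p

variable {h : M → X} {k : M → X → M} {γ : ℝ → X} {p₀ : M}

theorem IsLocalInverse.isLocallyInjective (hk : IsLocalInverse h k) : IsLocallyInjective h :=
  isLocallyInjective_iff_nhds.2 fun q => ⟨_, hk.left_inverse q, fun a ha b hb hab => by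
    have h1 : k q (h a) = a := ha
    have h2 : k q (h b) = b := hb
    rw [← h1, ← h2, hab]⟩

/-- Two lifts over a connected interval that agree at `0` agree throughout: the coincidence set is
closed as `M` is Hausdorff, and open by local injectivity. -/
theorem IsPathLift.unique [T2Space M] (hk : IsLocalInverse h k) {s : ℝ} (hs : 0 ≤ s) {p p' : M}
    (hp : IsPathLift h γ p₀ s p) (hp' : IsPathLift h γ p₀ s p') : p = p' := by
  obtain ⟨σ, h1, h2, rfl, h4⟩ := hp
  obtain ⟨σ', h1', h2', rfl, h4'⟩ := hp'
  exact (T2Space.isSeparatedMap h).eqOn_of_comp_eqOn hk.isLocallyInjective isPreconnected_Icc h1 h1'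
    (fun x hx => (h4 x hx).trans (h4' x hx).symm) (left_mem_Icc.2 hs) (h2.trans h2'.symm)
    (right_mem_Icc.2 hs)

theorem IsPathLift.trans {s s' : ℝ} (hs : 0 ≤ s) (hss' : s ≤ s') {p : M}
    (hp : IsPathLift h γ p₀ s p) {ρ : ℝ → M} (hρ : ContinuousOn ρ (Icc s s')) (hρs : ρ s = p)
    (hργ : ∀ x ∈ Icc s s', h (ρ x) = γ x) : IsPathLift h γ p₀ s' (ρ s') := by
  obtain ⟨σ, h1, h2, h3, h4⟩ := hp
  have e1 : ∀ x ∈ Icc 0 s, (if x ≤ s then σ x else ρ x) = σ x := fun x hx => if_pos hx.2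
  have e2 : ∀ x ∈ Icc s s', (if x ≤ s then σ x else ρ x) = ρ x := by
    intro x hx
    rcases hx.1.eq_or_lt with rfl | hlt
    · rw [if_pos le_rfl, h3, hρs]
    · exact if_neg (not_le.2 hlt)
  refine ⟨fun x => if x ≤ s then σ x else ρ x, ?_, ?_, ?_, fun x hx => ?_⟩
  · rw [← Icc_union_Icc_eq_Icc hs hss']
    exact (h1.congr e1).union_of_isClosed (hρ.congr e2) isClosed_Icc isClosed_Icc
  · exact (e1 0 (left_mem_Icc.2 hs)).trans h2
  · exact e2 s' (right_mem_Icc.2 hss')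
  · rcases le_total x s with hxs | hxs
    · change h (if x ≤ s then σ x else ρ x) = γ x
      rw [e1 x ⟨hx.1, hxs⟩]; exact h4 x ⟨hx.1, hxs⟩
    · change h (if x ≤ s then σ x else ρ x) = γ x
      rw [e2 x ⟨hxs, hx.2⟩]; exact hργ x ⟨hxs, hx.2⟩

/-- A path lifts along a local homeomorphism if the partial lifts converge. -/
theorem exists_isPathLift [T2Space M] (hk : IsLocalInverse h k) (hγ : Continuous γ)
    (hh : Continuous h) [T2Space X] (hp₀ : h p₀ = γ 0)
    (hlim : ∀ S, 0 < S → S ≤ 1 → ∀ τ : ℝ → M, (∀ x ∈ Ico 0 S, h (τ x) = γ x) →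
      (∀ x ∈ Ioo 0 S, ∀ᶠ y in 𝓝 x, τ y = k (τ x) (γ y)) →
      ∃ q, Tendsto τ (𝓝[<] S) (𝓝 q)) :
    ∃ p, h p = γ 1 := by
  classical
  -- Continuity method: the parameters over which a lift exists form an interval. Its supremum is
  -- attained by the limit hypothesis and passed by means of a local inverse, unless it is `1`.
  set A : Set ℝ := {s | s ∈ Icc (0 : ℝ) 1 ∧ ∃ p, IsPathLift h γ p₀ s p} with hA
  have hdown : ∀ s ∈ A, ∀ x ∈ Icc 0 s, x ∈ A := by
    rintro s ⟨hs, p, σ, h1, h2, h3, h4⟩ x hx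
    exact ⟨⟨hx.1, hx.2.trans hs.2⟩, σ x, σ, h1.mono (Icc_subset_Icc_right hx.2), h2, rfl,
      fun y hy => h4 y ⟨hy.1, hy.2.trans hx.2⟩⟩
  have h0A : (0 : ℝ) ∈ A := ⟨⟨le_rfl, zero_le_one⟩, p₀, fun _ => p₀, continuousOn_const, rfl, rfl,
    fun x hx => by rw [le_antisymm hx.2 hx.1]; exact hp₀⟩
  have hbdd : BddAbove A := ⟨1, fun s hs => hs.1.2⟩
  set S := sSup A with hS
  have hS0 : 0 ≤ S := le_csSup hbdd h0A
  have hS1 : S ≤ 1 := csSup_le ⟨0, h0A⟩ fun s hs => hs.1.2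
  have hlt : ∀ x ∈ Ico 0 S, x ∈ A := by
    intro x hx
    obtain ⟨s, hs, hxs⟩ := exists_lt_of_lt_csSup ⟨0, h0A⟩ hx.2
    exact hdown s hs x ⟨hx.1, hxs.le⟩
  -- a point over `γ S` at which the lifts arrive
  have hq : ∃ q, h q = γ S ∧ ∀ᶠ x in 𝓝[≤] S, 0 ≤ x → (x < S ∨ S = 0) →
      IsPathLift h γ p₀ x (k q (γ x)) := by
    rcases hS0.eq_or_lt with h0 | hpos
    · refine ⟨p₀, h0 ▸ hp₀, eventually_mem_nhdsWithin.mono fun x hx hx0 _ => ?_⟩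
      have : x = 0 := le_antisymm (hx.trans h0.symm.le) hx0
      subst this
      rw [← hp₀, hk.apply_image]
      exact ⟨fun _ => p₀, continuousOn_const, rfl, rfl,
        fun x hx => by rw [le_antisymm hx.2 hx.1]; exact hp₀⟩
    · have hex : ∀ x, ∃ p, x ∈ Ico 0 S → IsPathLift h γ p₀ x p := by
        intro x
        by_cases hx : x ∈ Ico 0 S
        · obtain ⟨p, hp⟩ := (hlt x hx).2
          exact ⟨p, fun _ => hp⟩
        · exact ⟨p₀, fun h => absurd h hx⟩
      choose τ hτ using hex
      have hτγ : ∀ x ∈ Ico 0 S, h (τ x) = γ x := by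
        intro x hx
        obtain ⟨σ, -, -, h3, h4⟩ := hτ x hx
        rw [← h3]; exact h4 x (right_mem_Icc.2 hx.1)
      -- The endpoints `τ x` come from unrelated choices of lifts, but uniqueness identifies them
      -- with the values of one continuous lift near `x`; hence they are locally `k (τ x) ∘ γ`.
      have hτl : ∀ x ∈ Ioo 0 S, ∀ᶠ y in 𝓝 x, τ y = k (τ x) (γ y) := by
        intro x hx
        obtain ⟨s, hxs, hsS⟩ := exists_between hx.2
        obtain ⟨σ, h1, h2, h3, h4⟩ := hτ s ⟨hx.1.le.trans hxs.le, hsS⟩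
        have hτσ : ∀ y ∈ Icc 0 s, τ y = σ y := fun y hy =>
          (hτ y ⟨hy.1, hy.2.trans_lt hsS⟩).unique hk hy.1
            ⟨σ, h1.mono (Icc_subset_Icc_right hy.2), h2, rfl,
              fun z hz => h4 z ⟨hz.1, hz.2.trans hy.2⟩⟩
        have hcx : ContinuousAt σ x := h1.continuousAt (Icc_mem_nhds hx.1 hxs)
        have hx' := hτσ x ⟨hx.1.le, hxs.le⟩
        filter_upwards [Icc_mem_nhds hx.1 hxs,
          hcx.eventually (hk.left_inverse (σ x))] with y hy hy'
        rw [hτσ y hy, hx', ← h4 y hy]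
        exact hy'.symm
      obtain ⟨q, hq⟩ := hlim S hpos hS1 τ hτγ hτl
      have hIco : Ico 0 S ∈ 𝓝[<] S := Ico_mem_nhdsLT hpos
      have hqS : h q = γ S := by
        have e1 : Tendsto (fun x => h (τ x)) (𝓝[<] S) (𝓝 (h q)) := (hh.tendsto q).comp hq
        have e2 : Tendsto (fun x => h (τ x)) (𝓝[<] S) (𝓝 (γ S)) :=
          ((hγ.tendsto S).mono_left nhdsWithin_le_nhds).congr'
            (eventually_of_mem hIco fun x hx => (hτγ x hx).symm)
        exact tendsto_nhds_unique e1 e2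
      refine ⟨q, hqS, ?_⟩
      have hev : ∀ᶠ x in 𝓝[<] S, IsPathLift h γ p₀ x (k q (γ x)) := by
        filter_upwards [hIco, hq.eventually (hk.left_inverse q)] with x hx hx'
        rw [← hτγ x hx, hx']
        exact hτ x hx
      rw [eventually_nhdsWithin_iff] at hev ⊢
      filter_upwards [hev] with x hx _ _ hxS
      exact hx (hxS.resolve_right hpos.ne')
  obtain ⟨q, hqS, hq⟩ := hq
  have hnice : ∀ᶠ x in 𝓝 S, ContinuousAt (fun y => k q (γ y)) x ∧ h (k q (γ x)) = γ x := by
    have h1 := (hγ.tendsto S).eventually (hqS ▸ hk.continuousAt q)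
    have h2 := (hγ.tendsto S).eventually (hqS ▸ hk.right_inverse q)
    filter_upwards [h1, h2] with x hx1 hx2
    exact ⟨ContinuousAt.comp (f := γ) hx1 hγ.continuousAt, hx2⟩
  rw [eventually_nhdsWithin_iff] at hq
  obtain ⟨δ, hδ, hball⟩ := Metric.eventually_nhds_iff.1 (hnice.and hq)
  -- A parameter just before `S` at which the lift already follows the local inverse at `q`; for `S
  -- = 0` there is nothing before it, and `x₁ = 0` with the constant lift is used.
  obtain ⟨x₁, hx₁0, hx₁S, hx₁δ, hx₁⟩ : ∃ x₁, 0 ≤ x₁ ∧ x₁ ≤ S ∧ S - δ < x₁ ∧ (x₁ < S ∨ S = 0) := by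
    rcases hS0.eq_or_lt with h0 | hpos
    · exact ⟨0, le_rfl, hS0, by linarith, Or.inr h0.symm⟩
    · exact ⟨max 0 (S - δ / 2), le_max_left _ _, max_le hS0 (by linarith),
        lt_max_of_lt_right (by linarith), Or.inl (max_lt hpos (by linarith))⟩
  have hd : ∀ x, x₁ ≤ x → x < S + δ → dist x S < δ := fun x h1 h2 => by
    rw [Real.dist_eq, abs_lt]; constructor <;> linarith
  have hlift := (hball (hd x₁ le_rfl (by linarith))).2 hx₁S hx₁0 hx₁
  have hext : ∀ s', S ≤ s' → s' < S + δ → IsPathLift h γ p₀ s' (k q (γ s')) := by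
    intro s' h1 h2
    refine hlift.trans hx₁0 (hx₁S.trans h1) (ρ := fun x => k q (γ x))
      (fun x hx => ?_) rfl fun x hx => ?_
    · exact (hball (hd x hx.1 (hx.2.trans_lt h2))).1.1.continuousWithinAt
    · exact (hball (hd x hx.1 (hx.2.trans_lt h2))).1.2
  rcases hS1.eq_or_lt with h1 | h1
  · exact ⟨q, h1 ▸ hqS⟩
  · exfalso
    have hmem : min 1 (S + δ / 2) ∈ A :=
      ⟨⟨le_min zero_le_one (by linarith), min_le_left _ _⟩, _,
        hext _ (le_min h1.le (by linarith)) (min_lt_of_right_lt (by linarith))⟩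
    have := le_csSup hbdd hmem
    rw [← hS] at this
    exact absurd this (not_le.2 (lt_min h1 (by linarith)))

end Lifting

/-! ### Complete immersions cover the whole model. -/

section Complete

open Filter Topology Set

variable {n : ℕ}

theorem continuousOn_frameCoord {Y : Type*} [TopologicalSpace Y] {s : Set Y} {p v : Y → Space n}
    (hp : ContinuousOn p s) (hv : ContinuousOn v s) :
    ContinuousOn (fun y => frameCoord (p y) (v y)) s := by
  have h1 := (fstL n).continuous.comp_continuousOn hv
  have h2 := (sndL n).continuous.comp_continuousOn hv
  have h3 := (mulIL n).continuous.comp_continuousOn ((fstL n).continuous.comp_continuousOn hp)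
  refine (((inlL n).continuous.comp_continuousOn h1).add
    ((inrL n).continuous.comp_continuousOn (h2.add (h3.inner h1)))).congr fun y _ => ?_
  refine Space.ext ?_ ?_
  · simp [frameCoord]
  · simp [frameCoord, symp_eq]

/-- `Ψ` parametrizes a hypersurface by the domain `U` of `ℂⁿ`, with `P` as left inverse. -/
structure IsParametrization (U : Set (EuclideanSpace ℂ (Fin n)))
    (Ψ : EuclideanSpace ℂ (Fin n) → Space n) (P : Space n → EuclideanSpace ℂ (Fin n)) : Prop where
  isOpen : IsOpen U
  isConnected : IsConnected U
  contDiffOn : ContDiffOn ℝ 2 Ψ U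
  contDiffAt : ∀ u ∈ U, ContDiffAt ℝ 2 P (Ψ u)
  left_inv : ∀ u ∈ U, P (Ψ u) = u

variable {M : Type*} [TopologicalSpace M] [ChartedSpace (EuclideanSpace ℝ (Fin (2 * n))) M]
  [IsManifold (𝓡 (2 * n)) 2 M] {f : M → Space n}
  {U : Set (EuclideanSpace ℂ (Fin n))} {Ψ : EuclideanSpace ℂ (Fin n) → Space n}
  {P : Space n → EuclideanSpace ℂ (Fin n)}

/-- From `f = Ψ ∘ (P ∘ f)` the differential of `P ∘ f` is injective, hence bijective since both
dimensions are `2n`. The inverse function theorem in a chart supplies `k`. -/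
theorem IsParametrization.exists_isLocalInverse (hΨ : IsParametrization U Ψ P)
    (hf : ContMDiff (𝓡 (2 * n)) 𝓘(ℝ, Space n) 2 f)
    (himm : ∀ p, Function.Injective (mfderiv (𝓡 (2 * n)) 𝓘(ℝ, Space n) f p))
    (hsub : ∀ q, P (f q) ∈ U ∧ Ψ (P (f q)) = f q) :
    ∃ k : M → EuclideanSpace ℂ (Fin n) → M, IsLocalInverse (P ∘ f) k ∧ ∀ q,
      ContMDiffAt 𝓘(ℝ, EuclideanSpace ℂ (Fin n)) (𝓡 (2 * n)) 1 (k q) (P (f q)) := by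
  have hex : ∀ q : M, ∃ k : EuclideanSpace ℂ (Fin n) → M, k (P (f q)) = q ∧
      (∀ᶠ u in 𝓝 (P (f q)), P (f (k u)) = u) ∧ (∀ᶠ p in 𝓝 q, k (P (f p)) = p) ∧
      ContMDiffAt 𝓘(ℝ, EuclideanSpace ℂ (Fin n)) (𝓡 (2 * n)) 1 k (P (f q)) := by
    intro q
    set φ := extChartAt (𝓡 (2 * n)) q with hφ
    have hq : q ∈ φ.source := mem_extChartAt_source q
    have hqt : φ.target ∈ 𝓝 (φ q) := (isOpen_extChartAt_target q).mem_nhds (φ.map_source hq)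
    set g := f ∘ φ.symm with hg
    have hgq : g (φ q) = f q := congrArg f (φ.left_inv hq)
    have hgc : ContDiffAt ℝ 2 g (φ q) := (contDiffOn_chart hf q).contDiffAt hqt
    have hH : ContDiffAt ℝ 2 (P ∘ g) (φ q) := by
      refine ContDiffAt.comp _ ?_ hgc
      rw [hgq, ← (hsub q).2]
      exact hΨ.contDiffAt _ (hsub q).1
    have hHd := (hH.differentiableAt two_ne_zero).hasFDerivAt
    set L := fderiv ℝ (P ∘ g) (φ q) with hL
    have hΨd : DifferentiableAt ℝ Ψ (P (g (φ q))) := by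
      rw [hgq]
      exact (hΨ.contDiffOn.contDiffAt (hΨ.isOpen.mem_nhds (hsub q).1)).differentiableAt two_ne_zero
    have hcomp : fderiv ℝ g (φ q) = (fderiv ℝ Ψ (P (g (φ q)))).comp L := by
      refine (hgc.differentiableAt two_ne_zero).hasFDerivAt.unique
        ((hΨd.hasFDerivAt.comp (φ q) hHd).congr_of_eventuallyEq (Eventually.of_forall fun y => ?_))
      exact (hsub (φ.symm y)).2.symm
    have hinj : Function.Injective L := by
      have h1 := injective_fderiv_chart hf hq (himm q)
      rw [← hφ, ← hg, hcomp] at h1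
      exact Function.Injective.of_comp (f := fderiv ℝ Ψ (P (g (φ q)))) h1
    have hdim : Module.finrank ℝ (EuclideanSpace ℝ (Fin (2 * n)))
        = Module.finrank ℝ (EuclideanSpace ℂ (Fin n)) := by
      rw [finrank_complex, finrank_euclideanSpace, Fintype.card_fin]
    set L' := (LinearEquiv.ofInjectiveOfFinrankEq L.toLinearMap hinj
      hdim).toContinuousLinearEquiv with hL'
    have hHd' : HasFDerivAt (P ∘ g)
        (L' : EuclideanSpace ℝ (Fin (2 * n)) →L[ℝ] EuclideanSpace ℂ (Fin n)) (φ q) := by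
      refine hHd.congr_fderiv ?_
      ext1 x
      rfl
    have hHs := hH.hasStrictFDerivAt' hHd' two_ne_zero
    have hinv := hH.to_localInverse hHd' two_ne_zero
    set K := hH.localInverse hHd' two_ne_zero with hK
    have hKq : K ((P ∘ g) (φ q)) = φ q := hH.localInverse_apply_image hHd' two_ne_zero
    have hgq' : (P ∘ g) (φ q) = P (f q) := congrArg P hgq
    rw [hgq'] at hKq hinv
    have hr : ∀ᶠ u in 𝓝 (P (f q)), (P ∘ g) (K u) = u := by
      have := hHs.eventually_right_inverse
      rwa [hgq'] at this
    have hl : ∀ᶠ y in 𝓝 (φ q), K ((P ∘ g) y) = y := hHs.eventually_left_inverse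
    refine ⟨fun u => φ.symm (K u), ?_, hr, ?_, ?_⟩
    · change φ.symm (K (P (f q))) = q
      rw [hKq, φ.left_inv hq]
    · filter_upwards [(continuousAt_extChartAt q).eventually hl,
        extChartAt_source_mem_nhds (I := 𝓡 (2 * n)) q] with p hp hps
      have e1 : g (φ p) = f p := congrArg f (φ.left_inv hps)
      have e2 : K (P (f p)) = φ p := by rw [← e1]; exact hp
      change φ.symm (K (P (f p))) = p
      rw [e2, φ.left_inv hps]
    · have h1 : ContMDiffAt 𝓘(ℝ, EuclideanSpace ℝ (Fin (2 * n))) (𝓡 (2 * n)) 2 φ.symm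
          (K (P (f q))) := by
        rw [hKq]
        exact (contMDiffOn_extChartAt_symm q).contMDiffAt hqt
      exact (h1.comp (P (f q)) hinv.contMDiffAt).of_le one_le_two
  choose k h1 h2 h3 h4 using hex
  have : IsManifold (𝓡 (2 * n)) 1 M := IsManifold.of_le one_le_two
  refine ⟨k, ⟨h1, fun q => ?_, h2, h3⟩, h4⟩
  have : ∀ᶠ u in 𝓝 (P (f q)),
      ContMDiffAt 𝓘(ℝ, EuclideanSpace ℂ (Fin n)) (𝓡 (2 * n)) 1 (k q) u :=
    contMDiffAt_iff_contMDiffAt_nhds (by simp) |>.1 (h4 q)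
  exact this.mono fun u hu => hu.continuousAt

/-- The image of `P ∘ f` is open in `U` because `P ∘ f` is a local homeomorphism, and closed in `U`
because segments in `U` starting in the image can be lifted to their ends. -/
theorem IsParametrization.image_subset_range [T2Space M] [Nonempty M]
    (hΨ : IsParametrization U Ψ P) (hf : ContMDiff (𝓡 (2 * n)) 𝓘(ℝ, Space n) 2 f)
    (himm : ∀ p, Function.Injective (mfderiv (𝓡 (2 * n)) 𝓘(ℝ, Space n) f p))
    (hsub : ∀ q, P (f q) ∈ U ∧ Ψ (P (f q)) = f q) (hc : IsCompleteImmersion f) :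
    Ψ '' U ⊆ range f := by
  obtain ⟨k, hk, hkc⟩ := hΨ.exists_isLocalInverse hf himm hsub
  have hh : Continuous (P ∘ f) := by
    refine continuous_iff_continuousAt.2 fun q => ContinuousAt.comp ?_ hf.continuous.continuousAt
    rw [← (hsub q).2]
    exact (hΨ.contDiffAt _ (hsub q).1).continuousAt
  -- segments in `U` lift
  have hseg : ∀ p₀ u, segment ℝ (P (f p₀)) u ⊆ U → ∃ p, P (f p) = u := by
    intro p₀ u hU
    set u₀ := P (f p₀) with hu₀
    set γ : ℝ → EuclideanSpace ℂ (Fin n) := fun x => u₀ + x • (u - u₀) with hγ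
    have hγc : ContDiff ℝ ∞ γ := contDiff_const.add (contDiff_id.smul contDiff_const)
    have hγU : ∀ x ∈ Icc (0 : ℝ) 1, γ x ∈ U := fun x hx => hU (by
      rw [segment_eq_image']; exact ⟨x, hx, rfl⟩)
    have hγ1 : γ 1 = u := by simp [hγ]
    rw [← hγ1]
    refine exists_isPathLift (p₀ := p₀) hk hγc.continuous hh (by simp [hγ, hu₀]) ?_
    intro S hS hS1 τ hτγ hτl
    have hSx : ∀ x ∈ Ioo (0 : ℝ) 1, S * x ∈ Ioo 0 S := fun x hx =>
      ⟨mul_pos hS hx.1, by nlinarith [hx.2]⟩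
    set F : ℝ → Space n := fun x => Ψ (γ (S * x)) with hF
    have hscale : ContDiff ℝ ∞ fun x : ℝ => γ (S * x) :=
      hγc.comp (contDiff_const.mul contDiff_id)
    -- Although the lift is known only on the open interval, its image `F` is `C¹` on a
    -- neighbourhood `V` of `[0, 1]`. Its speed is thus bounded there, the length is finite, and
    -- completeness gives the limit.
    set V : Set ℝ := (fun x => γ (S * x)) ⁻¹' U with hV
    have hVo : IsOpen V := hΨ.isOpen.preimage hscale.continuous
    have hVI : Icc (0 : ℝ) 1 ⊆ V := fun x hx =>
      hγU _ ⟨mul_nonneg hS.le hx.1, mul_le_one₀ hS1 hx.1 hx.2⟩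
    have hFc : ContDiffOn ℝ 2 F V :=
      hΨ.contDiffOn.comp (hscale.of_le (WithTop.coe_le_coe.2 le_top)).contDiffOn fun x hx => hx
    have hfF : ∀ x ∈ Ioo (0 : ℝ) 1, f (τ (S * x)) = F x := by
      intro x hx
      have := hSx x hx
      rw [hF, ← (hsub (τ (S * x))).2]
      exact congrArg Ψ (hτγ _ ⟨this.1.le, this.2⟩)
    have hτc : ContMDiffOn 𝓘(ℝ, ℝ) (𝓡 (2 * n)) 1 (fun x => τ (S * x)) (Ioo 0 1) := by
      intro x hx
      have hy := hSx x hx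
      have h1 : ContMDiffAt 𝓘(ℝ, EuclideanSpace ℂ (Fin n)) (𝓡 (2 * n)) 1 (k (τ (S * x)))
          (γ (S * x)) := by
        rw [← hτγ _ ⟨hy.1.le, hy.2⟩]; exact hkc _
      have h2 : ContMDiffAt 𝓘(ℝ, ℝ) 𝓘(ℝ, EuclideanSpace ℂ (Fin n)) 1
          (fun x : ℝ => γ (S * x)) x :=
        (hscale.of_le (WithTop.coe_le_coe.2 le_top)).contMDiff.contMDiffAt
      have h3 : ContMDiffAt 𝓘(ℝ, ℝ) (𝓡 (2 * n)) 1
          (fun y : ℝ => k (τ (S * x)) (γ (S * y))) x := ContMDiffAt.comp x h1 h2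
      refine (h3.congr_of_eventuallyEq ?_).contMDiffWithinAt
      have : ContinuousAt (fun y : ℝ => S * y) x := by fun_prop
      exact this.eventually (hτl _ hy)
    have hint : MeasureTheory.IntegrableOn (fun s => ‖frameCoord (f (τ (S * s)))
        (deriv (fun y => f (τ (S * y))) s)‖) (Ioo 0 1) := by
      have hcont : ContinuousOn (fun s => ‖frameCoord (F s) (deriv F s)‖) (Icc 0 1) :=
        (continuousOn_frameCoord (hFc.continuousOn.mono hVI)
          ((hFc.continuousOn_deriv_of_isOpen hVo one_le_two).mono hVI)).norm
      refine ((hcont.integrableOn_Icc).mono_set Ioo_subset_Icc_self).congr_fun (fun x hx => ?_)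
        measurableSet_Ioo
      have : (fun y => f (τ (S * y))) =ᶠ[𝓝 x] F :=
        eventually_of_mem (isOpen_Ioo.mem_nhds hx) hfF
      simp only [hfF x hx, this.deriv_eq]
    obtain ⟨q, hq⟩ := hc (fun x => τ (S * x)) hτc hint
    refine ⟨q, ?_⟩
    have hdiv : Tendsto (fun y : ℝ => y / S) (𝓝[<] S) (𝓝[<] 1) := by
      refine tendsto_nhdsWithin_iff.2 ⟨?_, ?_⟩
      · have : ContinuousAt (fun y : ℝ => y / S) S := by fun_prop
        have h1 := this.tendsto
        rw [div_self hS.ne'] at h1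
        exact h1.mono_left nhdsWithin_le_nhds
      · filter_upwards [self_mem_nhdsWithin] with y hy
        exact (div_lt_one hS).2 hy
    refine (hq.comp hdiv).congr fun y => ?_
    simp [mul_div_cancel₀ _ hS.ne']
  have hopen : ∀ q, ∀ᶠ u in 𝓝 (P (f q)), u ∈ range (P ∘ f) := fun q =>
    (hk.right_inverse q).mono fun u hu => ⟨_, hu⟩
  have hUsub : U ⊆ range (P ∘ f) := by
    refine hΨ.isConnected.isPreconnected.subset_of_closure_inter_subset
      (isOpen_iff_mem_nhds.2 ?_) ?_ ?_
    · rintro _ ⟨q, rfl⟩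
      exact hopen q
    · obtain ⟨q⟩ := ‹Nonempty M›
      exact ⟨P (f q), (hsub q).1, q, rfl⟩
    -- A limit point in `U` has an image point within a ball contained in `U`; the segment joining
    -- them stays in that ball and lifts.
    · rintro u ⟨hu, huU⟩
      obtain ⟨ε, hε, hball⟩ := Metric.isOpen_iff.1 hΨ.isOpen u huU
      obtain ⟨_, ⟨p₀, rfl⟩, hp₀⟩ := Metric.mem_closure_iff.1 hu ε hε
      obtain ⟨p, hp⟩ := hseg p₀ u (((convex_ball u ε).segment_subset
        (by rw [Metric.mem_ball, dist_comm]; exact hp₀) (Metric.mem_ball_self hε)).trans hball)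
      exact ⟨p, hp⟩
  rintro _ ⟨u, hu, rfl⟩
  obtain ⟨q, rfl⟩ := hUsub hu
  exact ⟨q, (hsub q).2.symm⟩

end Complete

section Models

open Filter Topology Set

variable {n : ℕ}

/-! ### The catenoid as a parametrized hypersurface -/

theorem profileRadius_zero (E : ℝ) : profileRadius n E 0 = E ^ (1 / (2 * (n : ℝ) - 1)) := by
  rw [profileRadius, Real.cosh_zero, mul_one]

theorem profileRadius_le (hn : 1 ≤ n) {E : ℝ} (hE : 0 < E) {θ θ' : ℝ} (h : |θ| ≤ |θ'|) :
    profileRadius n E θ ≤ profileRadius n E θ' :=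
  Real.rpow_le_rpow (mul_pos hE (Real.cosh_pos θ)).le
    (mul_le_mul_of_nonneg_left (Real.cosh_le_cosh.2 h) hE.le)
    (one_div_nonneg.2 (two_mul_sub_one_pos hn).le)

theorem profileRadius_lt (hn : 1 ≤ n) {E : ℝ} (hE : 0 < E) {θ θ' : ℝ} (h : |θ| < |θ'|) :
    profileRadius n E θ < profileRadius n E θ' :=
  Real.rpow_lt_rpow (mul_pos hE (Real.cosh_pos θ)).le
    (mul_lt_mul_of_pos_left (Real.cosh_lt_cosh.2 h) hE)
    (one_div_pos.2 (two_mul_sub_one_pos hn))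

theorem exists_profileRadius_eq (hn : 1 ≤ n) {E : ℝ} (hE : 0 < E) {r : ℝ}
    (hr : profileRadius n E 0 ≤ r) : ∃ θ, 0 ≤ θ ∧ r = profileRadius n E θ := by
  have hr0 : 0 ≤ r := (profileRadius_pos hE 0).le.trans hr
  have h1 : E ≤ r ^ (2 * n - 1) := by
    have := pow_le_pow_left₀ (profileRadius_pos hE 0).le hr (2 * n - 1)
    rwa [profileRadius_pow hn hE, Real.cosh_zero, mul_one] at this
  set x := r ^ (2 * n - 1) / E with hx
  have hx1 : 1 ≤ x := (one_le_div hE).2 h1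
  refine ⟨Real.arsinh (Real.sqrt (x ^ 2 - 1)), Real.arsinh_nonneg_iff.2 (Real.sqrt_nonneg _),
    eq_profileRadius hn hE hr0 ?_⟩
  rw [Real.cosh_arsinh, Real.sq_sqrt (by nlinarith), add_sub_cancel,
    Real.sqrt_sq (by linarith), hx, mul_div_cancel₀ _ hE.ne']

/-- Substituting `r = profileRadius n E θ` turns the square root into `E sinh θ`, and the factor
`sinh θ` in `dr` removes the singularity at the neck. The change of variables on a half-open
interval needs no separate integrability check. -/
theorem integral_eq_profileHeight (hn : 1 ≤ n) {E : ℝ} (hE : 0 < E) {θ : ℝ} (hθ : 0 ≤ θ) :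
    ∫ r in (profileRadius n E 0)..(profileRadius n E θ),
      E * r / Real.sqrt (r ^ (4 * n - 2) - E ^ 2) = profileHeight n E θ := by
  have hmono : StrictMonoOn (profileRadius n E) (Icc 0 θ) := fun a ha b hb hab =>
    profileRadius_lt hn hE (by rw [abs_of_nonneg ha.1, abs_of_nonneg hb.1]; exact hab)
  have himage : profileRadius n E '' Ioc 0 θ = Ioc (profileRadius n E 0) (profileRadius n E θ) := by
    refine Subset.antisymm ?_
      (intermediate_value_Ioc hθ (contDiff_profileRadius hE).continuous.continuousOn)
    rintro _ ⟨x, hx, rfl⟩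
    exact ⟨hmono (left_mem_Icc.2 hθ) (Ioc_subset_Icc_self hx) hx.1,
      hmono.monotoneOn (Ioc_subset_Icc_self hx) (right_mem_Icc.2 hθ) hx.2⟩
  rw [intervalIntegral.integral_of_le
    (profileRadius_le hn hE (by rw [abs_zero]; exact abs_nonneg θ)), ← himage,
    MeasureTheory.integral_image_eq_integral_abs_deriv_smul measurableSet_Ioc
      (fun x _ => (hasDerivAt_profileRadius hn hE x).hasDerivWithinAt)
      (hmono.injOn.mono Ioc_subset_Icc_self), profileHeight, intervalIntegral.integral_of_le hθ]
  refine MeasureTheory.setIntegral_congr_fun measurableSet_Ioc fun x hx => ?_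
  have hs : 0 < Real.sinh x := Real.sinh_pos_iff.2 hx.1
  have hc := Real.cosh_pos x
  have hr := profileRadius_pos (n := n) hE x
  have hm := two_mul_sub_one_pos hn
  have hsq : Real.sqrt (profileRadius n E x ^ (4 * n - 2) - E ^ 2) = E * Real.sinh x := by
    rw [show 4 * n - 2 = (2 * n - 1) * 2 by omega, pow_mul, profileRadius_pow hn hE,
      show (E * Real.cosh x) ^ 2 - E ^ 2 = (E * Real.sinh x) ^ 2 by
        rw [mul_pow, mul_pow, Real.cosh_sq]; ring, Real.sqrt_sq (by positivity)]
  simp only [smul_eq_mul]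
  rw [hsq, abs_of_pos (by positivity)]
  field_simp

/-- The radius is even and the height odd in `θ`, so the two halves `t ≥ c` and `t ≤ c` correspond
to the two signs of `θ`. -/
theorem mem_catenoid_iff (hn : 1 ≤ n) {E : ℝ} (hE : 0 < E) (c : ℝ) (p : Space n) :
    p ∈ catenoid n E c ↔
      ∃ θ, ‖p.fst‖ = profileRadius n E θ ∧ p.snd = c + profileHeight n E θ := by
  rw [catenoid, mem_ofPred_eq, ← profileRadius_zero]
  constructor
  · rintro ⟨h1, h2⟩
    obtain ⟨θ, hθ, h3⟩ := exists_profileRadius_eq hn hE h1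
    rw [h3, integral_eq_profileHeight hn hE hθ] at h2
    rcases abs_choice (p.snd - c) with h | h <;> rw [h] at h2
    · exact ⟨θ, h3, by linarith⟩
    · exact ⟨-θ, by rw [h3, profileRadius_neg], by rw [profileHeight_neg]; linarith⟩
  · rintro ⟨θ, h1, h2⟩
    have h3 : profileRadius n E θ = profileRadius n E |θ| := by
      rcases abs_choice θ with h | h <;> rw [h]
      rw [profileRadius_neg]
    have hmono := (strictMono_profileHeight hn hE).monotone
    refine ⟨h1 ▸ profileRadius_le hn hE (by rw [abs_zero]; exact abs_nonneg θ), ?_⟩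
    rw [h1, h3, integral_eq_profileHeight hn hE (abs_nonneg θ), h2, add_sub_cancel_left]
    rcases le_total 0 θ with h | h
    · rw [abs_of_nonneg h, abs_of_nonneg]
      rw [← profileHeight_zero (n := n) E]
      exact hmono h
    · rw [abs_of_nonpos h, profileHeight_neg, abs_of_nonpos]
      rw [← profileHeight_zero (n := n) E]
      exact hmono h

/-- The parametrization of the catenoid by `ℂⁿ ∖ {0}`. -/
def catenoidMap (n : ℕ) (E c : ℝ) (u : EuclideanSpace ℂ (Fin n)) : Space n :=
  WithLp.toLp 2 ((profileRadius n E (Real.log ‖u‖) * ‖u‖⁻¹) • u,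
    c + profileHeight n E (Real.log ‖u‖))

/-- The left inverse of `catenoidMap`. -/
def catenoidInv (n : ℕ) (E c : ℝ) (p : Space n) : EuclideanSpace ℂ (Fin n) :=
  (Real.exp (Function.invFun (profileHeight n E) (p.snd - c)) * ‖p.fst‖⁻¹) • p.fst

theorem norm_catenoidMap_fst {E : ℝ} (hE : 0 < E) (c : ℝ) {u : EuclideanSpace ℂ (Fin n)}
    (hu : u ≠ 0) : ‖(catenoidMap n E c u).fst‖ = profileRadius n E (Real.log ‖u‖) := by
  have : ‖u‖ ≠ 0 := norm_ne_zero_iff.2 hu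
  rw [catenoidMap, WithLp.toLp_fst, norm_smul, norm_mul, norm_inv, norm_norm,
    Real.norm_of_nonneg (profileRadius_pos hE _).le, mul_assoc, inv_mul_cancel₀ this, mul_one]

/-- The height need not be onto `ℝ`, so `Function.invFun` may take default values. Near a value of
the height it agrees with the local inverse, by injectivity. -/
theorem contDiffAt_invFun_profileHeight (hn : 1 ≤ n) {E : ℝ} (hE : 0 < E) (θ : ℝ) :
    ContDiffAt ℝ 2 (Function.invFun (profileHeight n E)) (profileHeight n E θ) := by
  have hc : ContDiffAt ℝ 2 (profileHeight n E) θ :=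
    ((contDiff_profileHeight hn hE).of_le (WithTop.coe_le_coe.2 le_top)).contDiffAt
  have hd := profileHeight_deriv_pos hn hE θ
  set d := profileRadius n E θ ^ 2 / ((2 * (n : ℝ) - 1) * Real.cosh θ)
  have hder : HasFDerivAt (profileHeight n E)
      ((ContinuousLinearEquiv.unitsEquivAut ℝ (Units.mk0 d hd.ne') : ℝ ≃L[ℝ] ℝ) : ℝ →L[ℝ] ℝ) θ := by
    refine (hasDerivAt_profileHeight hn hE θ).hasFDerivAt.congr_fderiv ?_
    ext
    simp
    rfl
  refine (hc.to_localInverse hder two_ne_zero).congr_of_eventuallyEq ?_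
  filter_upwards [(hc.hasStrictFDerivAt' hder two_ne_zero).eventually_right_inverse] with y hy
  have hy' : profileHeight n E (hc.localInverse hder two_ne_zero y) = y := hy
  conv_lhs => rw [← hy']
  exact Function.leftInverse_invFun (strictMono_profileHeight hn hE).injective _

theorem catenoidInv_eq (hn : 1 ≤ n) {E c : ℝ} (hE : 0 < E) {p : Space n} {θ : ℝ}
    (h : p.snd = c + profileHeight n E θ) :
    catenoidInv n E c p = (Real.exp θ * ‖p.fst‖⁻¹) • p.fst := by
  rw [catenoidInv, h, add_sub_cancel_left,
    Function.leftInverse_invFun (strictMono_profileHeight hn hE).injective]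

theorem catenoidMap_catenoidInv (hn : 1 ≤ n) {E c : ℝ} (hE : 0 < E) {p : Space n} {θ : ℝ}
    (h1 : ‖p.fst‖ = profileRadius n E θ) (h2 : p.snd = c + profileHeight n E θ) :
    catenoidInv n E c p ∈ ({0}ᶜ : Set (EuclideanSpace ℂ (Fin n))) ∧
      catenoidMap n E c (catenoidInv n E c p) = p := by
  have hr : ‖p.fst‖ ≠ 0 := h1 ▸ (profileRadius_pos hE θ).ne'
  have hnorm : ‖catenoidInv n E c p‖ = Real.exp θ := by
    rw [catenoidInv_eq hn hE h2, norm_smul, norm_mul, norm_inv, norm_norm,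
      Real.norm_of_nonneg (Real.exp_pos θ).le, mul_assoc, inv_mul_cancel₀ hr, mul_one]
  refine ⟨fun h => ?_, ?_⟩
  · rw [mem_singleton_iff.1 h, norm_zero] at hnorm
    exact (Real.exp_pos θ).ne hnorm
  · rw [catenoidMap, hnorm, Real.log_exp, ← h2, ← h1, catenoidInv_eq hn hE h2, smul_smul]
    refine Space.ext ?_ rfl
    have := (Real.exp_pos θ).ne'
    rw [WithLp.toLp_fst, show ‖p.fst‖ * (Real.exp θ)⁻¹ * (Real.exp θ * ‖p.fst‖⁻¹) = 1 by
      field_simp, one_smul]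

theorem isParametrization_catenoid (hn : 1 ≤ n) {E : ℝ} (hE : 0 < E) (c : ℝ) :
    IsParametrization ({0}ᶜ : Set (EuclideanSpace ℂ (Fin n))) (catenoidMap n E c)
      (catenoidInv n E c) := by
  refine ⟨isOpen_compl_singleton, ?_, fun u hu => ContDiffAt.contDiffWithinAt ?_,
    fun u hu => ?_, fun u hu => ?_⟩
  -- The punctured space is connected because its real dimension `2n` exceeds one.
  · refine isConnected_compl_singleton_of_one_lt_rank ?_ 0
    rw [← Module.finrank_eq_rank, finrank_complex]
    exact_mod_cast (by omega : 1 < 2 * n)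
  · have hr : ‖u‖ ≠ 0 := norm_ne_zero_iff.2 hu
    have hnorm : ContDiffAt ℝ 2 (fun u : EuclideanSpace ℂ (Fin n) => ‖u‖) u :=
      contDiffAt_norm ℝ hu
    have hlog : ContDiffAt ℝ 2 (fun u : EuclideanSpace ℂ (Fin n) => Real.log ‖u‖) u :=
      hnorm.log hr
    have h1 : ContDiffAt ℝ 2 (fun u : EuclideanSpace ℂ (Fin n) =>
        profileRadius n E (Real.log ‖u‖)) u :=
      ((contDiff_profileRadius hE).of_le (WithTop.coe_le_coe.2 le_top)).contDiffAt.comp u hlog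
    have h2 : ContDiffAt ℝ 2 (fun u : EuclideanSpace ℂ (Fin n) =>
        profileHeight n E (Real.log ‖u‖)) u :=
      ((contDiff_profileHeight hn hE).of_le (WithTop.coe_le_coe.2 le_top)).contDiffAt.comp u hlog
    have h3 := ((inlL n).contDiff.contDiffAt.comp u
      ((h1.mul (hnorm.inv hr)).smul contDiffAt_id)).add
      ((inrL n).contDiff.contDiffAt.comp u ((contDiffAt_const (c := c)).add h2))
    refine h3.congr_of_eventuallyEq (Eventually.of_forall fun u => ?_)
    refine Space.ext ?_ ?_ <;> simp [catenoidMap]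
  · set p := catenoidMap n E c u with hp
    have hp0 : p.fst ≠ 0 := by
      rw [← norm_ne_zero_iff, norm_catenoidMap_fst hE c hu]
      exact (profileRadius_pos hE _).ne'
    have h1 : ContDiffAt ℝ 2 (fun p : Space n => p.fst) p := (fstL n).contDiff.contDiffAt
    have h2 : ContDiffAt ℝ 2 (fun p : Space n => p.snd - c) p :=
      (sndL n).contDiff.contDiffAt.sub contDiffAt_const
    have h3 : ContDiffAt ℝ 2 (Function.invFun (profileHeight n E)) (p.snd - c) := by
      rw [hp, catenoidMap, WithLp.toLp_snd, add_sub_cancel_left]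
      exact contDiffAt_invFun_profileHeight hn hE _
    have h4 : ContDiffAt ℝ 2 (fun p : Space n =>
        Function.invFun (profileHeight n E) (p.snd - c)) p :=
      ContDiffAt.comp (f := fun p : Space n => p.snd - c)
        (g := Function.invFun (profileHeight n E)) p h3 h2
    exact (h4.exp.mul ((h1.norm ℝ hp0).inv (norm_ne_zero_iff.2 hp0))).smul h1
  · have hr : ‖u‖ ≠ 0 := norm_ne_zero_iff.2 hu
    have hR := (profileRadius_pos (n := n) hE (Real.log ‖u‖)).ne'
    rw [catenoidInv_eq hn hE (θ := Real.log ‖u‖) rfl, norm_catenoidMap_fst hE c hu,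
      Real.exp_log (norm_pos_iff.2 hu), catenoidMap, WithLp.toLp_fst, smul_smul,
      show ‖u‖ * (profileRadius n E (Real.log ‖u‖))⁻¹ *
        (profileRadius n E (Real.log ‖u‖) * ‖u‖⁻¹) = 1 by field_simp, one_smul]

theorem catenoidMap_image (hn : 1 ≤ n) {E : ℝ} (hE : 0 < E) (c : ℝ) :
    catenoidMap n E c '' {0}ᶜ = catenoid n E c := by
  ext p
  rw [mem_catenoid_iff hn hE]
  constructor
  · rintro ⟨u, hu, rfl⟩
    exact ⟨Real.log ‖u‖, norm_catenoidMap_fst hE c hu, rfl⟩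
  · rintro ⟨θ, h1, h2⟩
    obtain ⟨h3, h4⟩ := catenoidMap_catenoidInv hn hE h1 h2
    exact ⟨_, h3, h4⟩

/-- The catenoid is cut out by a closed inequality and an equation `|t - c| = g(|z|)`. Since
`Real.sqrt` vanishes on negative arguments, `g` is continuous on all of `ℝ`, including radii below
the neck. -/
theorem isClosed_catenoid (hn : 1 ≤ n) {E : ℝ} (hE : 0 < E) (c : ℝ) :
    IsClosed (catenoid n E c) := by
  set g : ℝ → ℝ := fun r =>
    profileHeight n E (Real.arsinh (Real.sqrt ((r ^ (2 * n - 1) / E) ^ 2 - 1))) with hg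
  have hgc : Continuous g := (contDiff_profileHeight hn hE).continuous.comp
    (Real.continuous_arsinh.comp (Real.continuous_sqrt.comp (by fun_prop)))
  have hfst : Continuous fun p : Space n => ‖p.fst‖ := (fstL n).continuous.norm
  have hsnd : Continuous fun p : Space n => |p.snd - c| :=
    ((sndL n).continuous.sub continuous_const).abs
  have hset : catenoid n E c
      = {p : Space n | E ≤ ‖p.fst‖ ^ (2 * n - 1)} ∩ {p | |p.snd - c| = g ‖p.fst‖} := by
    have hmono := strictMono_profileHeight hn hE
    ext p
    rw [mem_catenoid_iff hn hE]
    constructor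
    · rintro ⟨θ, h1, h2⟩
      have h3 : ‖p.fst‖ ^ (2 * n - 1) / E = Real.cosh θ := by
        rw [h1, profileRadius_pow hn hE, mul_div_cancel_left₀ _ hE.ne']
      refine ⟨?_, ?_⟩
      · change E ≤ ‖p.fst‖ ^ (2 * n - 1)
        rw [h1, profileRadius_pow hn hE]
        exact le_mul_of_one_le_right hE.le (Real.one_le_cosh θ)
      · change |p.snd - c| = profileHeight n E _
        rw [h3, Real.cosh_sq, add_sub_cancel_right, Real.sqrt_sq_eq_abs, Real.abs_sinh,
          Real.arsinh_sinh, h2, add_sub_cancel_left]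
        rcases le_total 0 θ with h | h
        · rw [abs_of_nonneg h, abs_of_nonneg]
          rw [← profileHeight_zero (n := n) E]
          exact hmono.monotone h
        · rw [abs_of_nonpos h, profileHeight_neg, abs_of_nonpos]
          rw [← profileHeight_zero (n := n) E]
          exact hmono.monotone h
    · rintro ⟨h1, h2⟩
      change E ≤ ‖p.fst‖ ^ (2 * n - 1) at h1
      change |p.snd - c| = profileHeight n E _ at h2
      set θ := Real.arsinh (Real.sqrt ((‖p.fst‖ ^ (2 * n - 1) / E) ^ 2 - 1)) with hθ
      have hx : 1 ≤ ‖p.fst‖ ^ (2 * n - 1) / E := (one_le_div hE).2 h1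
      have h3 : ‖p.fst‖ = profileRadius n E θ := by
        refine eq_profileRadius hn hE (norm_nonneg _) ?_
        rw [hθ, Real.cosh_arsinh, Real.sq_sqrt (by nlinarith), add_sub_cancel,
          Real.sqrt_sq (by linarith), mul_div_cancel₀ _ hE.ne']
      rcases abs_choice (p.snd - c) with h | h <;> rw [h] at h2
      · exact ⟨θ, h3, by linarith⟩
      · exact ⟨-θ, by rw [h3, profileRadius_neg], by rw [profileHeight_neg]; linarith⟩
  rw [hset]
  exact (isClosed_le continuous_const (hfst.pow _)).inter
    (isClosed_eq hsnd (hgc.comp hfst))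

/-! ### The plane as a parametrized hypersurface -/

/-- The parametrization of the plane by `ℂⁿ`. -/
def planeMap (n : ℕ) (c : ℝ) (u : EuclideanSpace ℂ (Fin n)) : Space n := WithLp.toLp 2 (u, c)

theorem isParametrization_plane (c : ℝ) :
    IsParametrization (univ : Set (EuclideanSpace ℂ (Fin n))) (planeMap n c) (fstL n) := by
  refine ⟨isOpen_univ, isConnected_univ, ?_, fun u _ => (fstL n).contDiff.contDiffAt,
    fun u _ => rfl⟩
  refine ((inlL n).contDiff.add (contDiff_const (c := inrL n c))).contDiffOn.congr fun u _ => ?_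
  refine Space.ext ?_ ?_ <;> simp [planeMap]

theorem planeMap_image (c : ℝ) :
    planeMap n c '' (univ : Set (EuclideanSpace ℂ (Fin n))) = hyperplane n c := by
  ext p
  constructor
  · rintro ⟨u, -, rfl⟩; rfl
  · intro h; exact ⟨p.fst, trivial, Space.ext rfl (Eq.symm h)⟩

/-- The classification of minimal hypersurfaces of revolution. -/
theorem classification (hn : 1 ≤ n) {M : Type*} [TopologicalSpace M]
    [ChartedSpace (EuclideanSpace ℝ (Fin (2 * n))) M] [IsManifold (𝓡 (2 * n)) 2 M] [T2Space M]
    [SecondCountableTopology M] [ConnectedSpace M] {f : M → Space n}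
    (hf : IsHypersurfaceOfRevolution f) (hmin : IsMinimal f) :
    (∃ c : ℝ, range f ⊆ hyperplane n c ∧
        (IsCompleteImmersion f → range f = hyperplane n c)) ∨
      (∃ E c : ℝ, 0 < E ∧ range f ⊆ catenoid n E c ∧
        (IsCompleteImmersion f → range f = catenoid n E c)) := by
  rcases range_classification hn hf hmin with ⟨c, hc⟩ | ⟨E, c, hE, hc⟩
  · have hsub : range f ⊆ hyperplane n c := by
      rintro _ ⟨q, rfl⟩; exact hc q
    refine Or.inl ⟨c, hsub, fun hcomp => hsub.antisymm ?_⟩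
    rw [← planeMap_image]
    exact (isParametrization_plane c).image_subset_range hf.contMDiff hf.immersion
      (fun q => ⟨trivial, Space.ext rfl (hc q).symm⟩) hcomp
  · have hsub : range f ⊆ catenoid n E c := by
      rintro _ ⟨q, rfl⟩; exact (mem_catenoid_iff hn hE c _).2 (hc q)
    refine Or.inr ⟨E, c, hE, hsub, fun hcomp => hsub.antisymm ?_⟩
    rw [← catenoidMap_image hn hE]
    refine (isParametrization_catenoid hn hE c).image_subset_range hf.contMDiff hf.immersion
      (fun q => ?_) hcomp
    obtain ⟨θ, h1, h2⟩ := hc q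
    exact catenoidMap_catenoidInv hn hE h1 h2

end Models

/-! ### Embedded minimal hypersurfaces with a global parametrization -/

section Converse

open Filter Topology Set

variable {n : ℕ}

/-- `φ` is a global coordinate on `M` with values in the domain `U` of `ℂⁿ`, with inverse `κ`. -/
structure IsGlobalCoordinate {M : Type*} [TopologicalSpace M]
    [ChartedSpace (EuclideanSpace ℝ (Fin (2 * n))) M] (U : Set (EuclideanSpace ℂ (Fin n)))
    (φ : M → EuclideanSpace ℂ (Fin n)) (κ : EuclideanSpace ℂ (Fin n) → M) : Prop where
  contMDiff : ContMDiff (𝓡 (2 * n)) 𝓘(ℝ, EuclideanSpace ℂ (Fin n)) 2 φ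
  contMDiffOn : ContMDiffOn 𝓘(ℝ, EuclideanSpace ℂ (Fin n)) (𝓡 (2 * n)) 2 κ U
  mem : ∀ q, φ q ∈ U
  left_inv : ∀ q, κ (φ q) = q
  right_inv : ∀ u ∈ U, φ (κ u) = u

/-- A real linear isomorphism of `ℂⁿ` with `ℝ^{2n}` restricts to an open embedding of `U`, taken as
its only chart. -/
theorem exists_isGlobalCoordinate {U : Set (EuclideanSpace ℂ (Fin n))} (hU : IsOpen U)
    [Nonempty U] : ∃ _ : ChartedSpace (EuclideanSpace ℝ (Fin (2 * n))) U,
      IsManifold (𝓡 (2 * n)) 2 U ∧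
        ∃ κ, IsGlobalCoordinate (M := U) U (fun q => (q : EuclideanSpace ℂ (Fin n))) κ := by
  have hdim : Module.finrank ℝ (EuclideanSpace ℂ (Fin n))
      = Module.finrank ℝ (EuclideanSpace ℝ (Fin (2 * n))) := by
    rw [finrank_complex, finrank_euclideanSpace, Fintype.card_fin]
  let L := ContinuousLinearEquiv.ofFinrankEq hdim
  have he : IsOpenEmbedding (fun q : U => L q) :=
    L.toHomeomorph.isOpenEmbedding.comp hU.isOpenEmbedding_subtypeVal
  letI := he.singletonChartedSpace
  refine ⟨he.singletonChartedSpace, he.isManifold_singleton,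
    fun u => (he.toOpenPartialHomeomorph _).symm (L u), ?_, ?_, fun q => q.2, fun q => ?_,
    fun u hu => ?_⟩
  · have h1 := L.symm.contDiff.contMDiff.comp (contMDiff_isOpenEmbedding (I := 𝓡 (2 * n)) (n := 2) he)
    refine h1.congr fun q => ?_
    simp
  · refine (contMDiffOn_isOpenEmbedding_symm (I := 𝓡 (2 * n)) (n := 2) he).comp
      L.contDiff.contMDiff.contMDiffOn fun u hu => ?_
    exact ⟨⟨u, hu⟩, rfl⟩
  · exact he.toOpenPartialHomeomorph_left_inv _
  · have := he.toOpenPartialHomeomorph_left_inv (x := (⟨u, hu⟩ : U))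
    exact congrArg Subtype.val this

variable {M : Type*} [TopologicalSpace M] [ChartedSpace (EuclideanSpace ℝ (Fin (2 * n))) M]
  {U : Set (EuclideanSpace ℂ (Fin n))} {Ψ : EuclideanSpace ℂ (Fin n) → Space n}
  {P : Space n → EuclideanSpace ℂ (Fin n)} {φ : M → EuclideanSpace ℂ (Fin n)}
  {κ : EuclideanSpace ℂ (Fin n) → M}

theorem IsGlobalCoordinate.contMDiff_comp (hφ : IsGlobalCoordinate U φ κ)
    (hΨ : IsParametrization U Ψ P) : ContMDiff (𝓡 (2 * n)) 𝓘(ℝ, Space n) 2 (Ψ ∘ φ) :=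
  fun q => ((hΨ.contDiffOn.contDiffAt (hΨ.isOpen.mem_nhds (hφ.mem q))).contMDiffAt).comp q
    hφ.contMDiff.contMDiffAt

theorem IsGlobalCoordinate.contMDiffAt_leftInverse (hφ : IsGlobalCoordinate U φ κ)
    (hΨ : IsParametrization U Ψ P) (q : M) :
    ContMDiffAt 𝓘(ℝ, Space n) (𝓡 (2 * n)) 2 (κ ∘ P) (Ψ (φ q)) := by
  refine ContMDiffAt.comp _ ?_ (hΨ.contDiffAt _ (hφ.mem q)).contMDiffAt
  rw [hΨ.left_inv _ (hφ.mem q)]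
  exact hφ.contMDiffOn.contMDiffAt (hΨ.isOpen.mem_nhds (hφ.mem q))

theorem IsGlobalCoordinate.leftInverse (hφ : IsGlobalCoordinate U φ κ)
    (hΨ : IsParametrization U Ψ P) (q : M) : (κ ∘ P) ((Ψ ∘ φ) q) = q := by
  simp only [Function.comp_apply]
  rw [hΨ.left_inv _ (hφ.mem q), hφ.left_inv]

/-- The left inverse `κ ∘ P` is differentiable at the image point, so the chain rule inverts the
differential on the left. -/
theorem IsGlobalCoordinate.injective_mfderiv (hφ : IsGlobalCoordinate U φ κ)
    (hΨ : IsParametrization U Ψ P) (q : M) :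
    Function.Injective (mfderiv (𝓡 (2 * n)) 𝓘(ℝ, Space n) (Ψ ∘ φ) q) := by
  have h1 := ((hφ.contMDiffAt_leftInverse hΨ q).mdifferentiableAt two_ne_zero).hasMFDerivAt
  have h2 := (((hφ.contMDiff_comp hΨ) q).mdifferentiableAt two_ne_zero).hasMFDerivAt
  have h3 := HasMFDerivAt.comp q h1 h2
  have h4 : HasMFDerivAt (𝓡 (2 * n)) (𝓡 (2 * n)) ((κ ∘ P) ∘ (Ψ ∘ φ)) q
      (ContinuousLinearMap.id ℝ (TangentSpace (𝓡 (2 * n)) q)) :=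
    (hasMFDerivAt_id q).congr_of_eventuallyEq (Eventually.of_forall (hφ.leftInverse hΨ))
  have h5 := hasMFDerivAt_unique h3 h4
  exact Function.LeftInverse.injective
    (g := mfderiv 𝓘(ℝ, Space n) (𝓡 (2 * n)) (κ ∘ P) (Ψ (φ q))) fun e => congrArg (· e) h5

theorem IsGlobalCoordinate.surjective_mfderiv (hφ : IsGlobalCoordinate U φ κ) (hU : IsOpen U)
    (q : M) : Function.Surjective
      (mfderiv (𝓡 (2 * n)) 𝓘(ℝ, EuclideanSpace ℂ (Fin n)) φ q) := by
  have h1 := (hφ.contMDiff.contMDiffAt (x := κ (φ q))).mdifferentiableAt two_ne_zero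
    |>.hasMFDerivAt
  have h2 := (hφ.contMDiffOn.contMDiffAt (hU.mem_nhds (hφ.mem q))).mdifferentiableAt two_ne_zero
    |>.hasMFDerivAt
  have h3 := HasMFDerivAt.comp (φ q) h1 h2
  have h4 : HasMFDerivAt 𝓘(ℝ, EuclideanSpace ℂ (Fin n)) 𝓘(ℝ, EuclideanSpace ℂ (Fin n)) (φ ∘ κ)
      (φ q) (ContinuousLinearMap.id ℝ (EuclideanSpace ℂ (Fin n))) :=
    (hasMFDerivAt_id (φ q)).congr_of_eventuallyEq
      (eventually_of_mem (hU.mem_nhds (hφ.mem q)) hφ.right_inv)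
  have h5 := hasMFDerivAt_unique h3 h4
  have h6 : Function.Surjective
      (mfderiv (𝓡 (2 * n)) 𝓘(ℝ, EuclideanSpace ℂ (Fin n)) φ (κ (φ q))) :=
    fun v => ⟨mfderiv 𝓘(ℝ, EuclideanSpace ℂ (Fin n)) (𝓡 (2 * n)) κ (φ q) v,
      congrArg (fun T : EuclideanSpace ℂ (Fin n) →L[ℝ] EuclideanSpace ℂ (Fin n) => T v) h5⟩
  rwa [hφ.left_inv] at h6

theorem IsGlobalCoordinate.isInducing (hφ : IsGlobalCoordinate U φ κ)
    (hΨ : IsParametrization U Ψ P) : IsInducing (Ψ ∘ φ) := by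
  refine isInducing_iff_nhds.2 fun q => le_antisymm
    ((hφ.contMDiff_comp hΨ).continuous.continuousAt.tendsto.le_comap) fun s hs => ?_
  have h1 := (hφ.contMDiffAt_leftInverse hΨ q).continuousAt
  have h2 : (κ ∘ P) (Ψ (φ q)) = q := hφ.leftInverse hΨ q
  refine ⟨(κ ∘ P) ⁻¹' s, h1 (by rwa [h2]), fun p hp => ?_⟩
  have h3 : (κ ∘ P) ((Ψ ∘ φ) p) ∈ s := hp
  rwa [hφ.leftInverse hΨ] at h3

theorem IsGlobalCoordinate.isEmbedding (hφ : IsGlobalCoordinate U φ κ)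
    (hΨ : IsParametrization U Ψ P) : IsEmbedding (Ψ ∘ φ) :=
  ⟨hφ.isInducing hΨ, Function.LeftInverse.injective (hφ.leftInverse hΨ)⟩

theorem IsGlobalCoordinate.range_comp (hφ : IsGlobalCoordinate U φ κ) :
    range (Ψ ∘ φ) = Ψ '' U := by
  ext p
  constructor
  · rintro ⟨q, rfl⟩; exact ⟨_, hφ.mem q, rfl⟩
  · rintro ⟨u, hu, rfl⟩; exact ⟨κ u, congrArg Ψ (hφ.right_inv u hu)⟩

theorem IsGlobalCoordinate.isHypersurfaceOfRevolution (hφ : IsGlobalCoordinate U φ κ)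
    (hΨ : IsParametrization U Ψ P)
    (hR : ∀ (R : EuclideanSpace ℂ (Fin n) ≃ₗᵢ[ℝ] EuclideanSpace ℂ (Fin n)), ∀ u ∈ U,
      R u ∈ U ∧ Ψ (R u) = rotate R (Ψ u)) : IsHypersurfaceOfRevolution (Ψ ∘ φ) := by
  have hsm : ∀ R : EuclideanSpace ℂ (Fin n) ≃ₗᵢ[ℝ] EuclideanSpace ℂ (Fin n),
      ContMDiff (𝓡 (2 * n)) (𝓡 (2 * n)) 2 fun q => κ (R (φ q)) := fun R q => by
    refine ContMDiffAt.comp q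
      (hφ.contMDiffOn.contMDiffAt (hΨ.isOpen.mem_nhds (hR R _ (hφ.mem q)).1)) ?_
    exact R.toContinuousLinearEquiv.contDiff.contMDiff.contMDiffAt.comp q hφ.contMDiff.contMDiffAt
  refine ⟨hφ.contMDiff_comp hΨ, hφ.injective_mfderiv hΨ, fun R _ =>
    ⟨⟨⟨fun q => κ (R (φ q)), fun q => κ (R.symm (φ q)), fun q => ?_, fun q => ?_⟩,
      hsm R, hsm R.symm⟩, fun q => ?_⟩⟩
  · simp only [hφ.right_inv _ (hR R _ (hφ.mem q)).1, R.symm_apply_apply, hφ.left_inv]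
  · simp only [hφ.right_inv _ (hR R.symm _ (hφ.mem q)).1, R.apply_symm_apply, hφ.left_inv]
  · have := hR R _ (hφ.mem q)
    change Ψ (φ (κ (R (φ q)))) = rotate R (Ψ (φ q))
    rw [hφ.right_inv _ this.1, this.2]

/-! ### Completeness -/

theorem exists_tendsto_of_integrable_deriv {F : Type*} [NormedAddCommGroup F] [NormedSpace ℝ F]
    [CompleteSpace F] {G : ℝ → F} {a b : ℝ} (hab : a < b) (hG : ContDiffOn ℝ 1 G (Ioo a b))
    (hint : MeasureTheory.IntegrableOn (deriv G) (Ioo a b)) : ∃ y, Tendsto G (𝓝[<] b) (𝓝 y) := by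
  set m := (a + b) / 2 with hm
  have ham : a < m := by rw [hm]; linarith
  have hmb : m < b := by rw [hm]; linarith
  have hint' : MeasureTheory.IntegrableOn (deriv G) (Icc m b) := by
    rw [integrableOn_Icc_iff_integrableOn_Ioo]
    exact hint.mono_set (Ioo_subset_Ioo_left ham.le)
  have hc : ContinuousOn (fun s => ∫ x in m..s, deriv G x) (Icc m b) := by
    have := intervalIntegral.continuousOn_primitive_interval (a := m) (b := b) (f := deriv G)
      (by rwa [uIcc_of_le hmb.le])
    rwa [uIcc_of_le hmb.le] at this
  have h1 : Tendsto (fun s => ∫ x in m..s, deriv G x) (𝓝[<] b)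
      (𝓝 (∫ x in m..b, deriv G x)) := by
    refine (hc b (right_mem_Icc.2 hmb.le)).tendsto.mono_left ?_
    rw [nhdsWithin_Icc_eq_nhdsLE hmb]
    exact nhdsWithin_mono _ Iio_subset_Iic_self
  refine ⟨G m + ∫ x in m..b, deriv G x, (h1.const_add (G m)).congr' ?_⟩
  filter_upwards [Ioo_mem_nhdsLT hmb] with s hs
  have hsub : uIcc m s ⊆ Ioo a b := by
    rw [uIcc_of_le hs.1.le]
    exact fun x hx => ⟨ham.trans_le hx.1, hx.2.trans_lt hs.2⟩
  rw [intervalIntegral.integral_deriv_eq_sub (fun x hx => (hG.differentiableOn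
    one_ne_zero).differentiableAt (isOpen_Ioo.mem_nhds (hsub hx)))]
  · abel
  · exact ((hG.continuousOn_deriv_of_isOpen isOpen_Ioo le_rfl).mono hsub).intervalIntegrable

theorem abs_symp_le (z v : EuclideanSpace ℂ (Fin n)) : |symp z v| ≤ ‖z‖ * ‖v‖ := by
  rw [symp_eq, abs_neg, ← norm_I_smul z]
  exact abs_real_inner_le_norm _ _

/-- A curve of finite length in the Heisenberg group converges. -/
theorem exists_tendsto_of_finite_length {F : ℝ → Space n} (hF : ContDiffOn ℝ 1 F (Ioo 0 1))
    (hint : MeasureTheory.IntegrableOn (fun s => ‖frameCoord (F s) (deriv F s)‖) (Ioo 0 1)) :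
    ∃ y, Tendsto F (𝓝[<] 1) (𝓝 y) := by
  have hd : ∀ s ∈ Ioo (0 : ℝ) 1, HasDerivAt F (deriv F s) s := fun s hs =>
    ((hF.differentiableOn one_ne_zero).differentiableAt (isOpen_Ioo.mem_nhds hs)).hasDerivAt
  have hdz : ∀ s ∈ Ioo (0 : ℝ) 1, deriv (fun s => (F s).fst) s = (deriv F s).fst := fun s hs =>
    ((fstL n).hasFDerivAt.comp_hasDerivAt s (hd s hs)).deriv
  have hdt : ∀ s ∈ Ioo (0 : ℝ) 1, deriv (fun s => (F s).snd) s = (deriv F s).snd := fun s hs =>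
    ((sndL n).hasFDerivAt.comp_hasDerivAt s (hd s hs)).deriv
  have hz : ContDiffOn ℝ 1 (fun s => (F s).fst) (Ioo 0 1) := (fstL n).contDiff.comp_contDiffOn hF
  have ht : ContDiffOn ℝ 1 (fun s => (F s).snd) (Ioo 0 1) := (sndL n).contDiff.comp_contDiffOn hF
  have hle : ∀ s, ‖(deriv F s).fst‖ ≤ ‖frameCoord (F s) (deriv F s)‖ := fun s =>
    WithLp.norm_fst_le _ (frameCoord (F s) (deriv F s))
  obtain ⟨y, hy⟩ := exists_tendsto_of_integrable_deriv zero_lt_one hz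
    (hint.mono' ((hz.continuousOn_deriv_of_isOpen isOpen_Ioo le_rfl).aestronglyMeasurable
      measurableSet_Ioo) ((MeasureTheory.ae_restrict_iff' measurableSet_Ioo).2
        (Eventually.of_forall fun s hs => by rw [hdz s hs]; exact hle s)))
  -- Since `|z'|` is at most the speed, `z` converges and is bounded near the end. Then `t' =
  -- (vertical frame coefficient) + symp z z'` is dominated by a constant times the speed, and `t`
  -- converges as well.
  have hbd : ∀ᶠ s in 𝓝[<] (1 : ℝ), ‖(F s).fst‖ < ‖y‖ + 1 :=
    hy.norm.eventually_lt_const (lt_add_one _)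
  obtain ⟨a, ha, hab⟩ := (mem_nhdsLT_iff_exists_Ioo_subset' zero_lt_one).1
    (inter_mem hbd (Ioo_mem_nhdsLT (zero_lt_one (α := ℝ))))
  have hsub : Ioo a 1 ⊆ Ioo 0 1 := fun s hs => (hab hs).2
  obtain ⟨x, hx⟩ := exists_tendsto_of_integrable_deriv (mem_Iio.1 ha) (ht.mono hsub)
    (((hint.mono_set hsub).const_mul (‖y‖ + 2)).mono'
      (((ht.mono hsub).continuousOn_deriv_of_isOpen isOpen_Ioo le_rfl).aestronglyMeasurable
      measurableSet_Ioo) ((MeasureTheory.ae_restrict_iff' measurableSet_Ioo).2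
        (Eventually.of_forall fun s hs => by
          rw [hdt s (hsub hs), Real.norm_eq_abs]
          have h1 : (deriv F s).snd = (frameCoord (F s) (deriv F s)).snd
              + symp (F s).fst (deriv F s).fst := by simp [frameCoord]
          have h2 : |(frameCoord (F s) (deriv F s)).snd| ≤ ‖frameCoord (F s) (deriv F s)‖ :=
            WithLp.norm_snd_le _ (frameCoord (F s) (deriv F s))
          have h3 := abs_symp_le (F s).fst (deriv F s).fst
          have h4 : ‖(F s).fst‖ * ‖(deriv F s).fst‖
              ≤ (‖y‖ + 1) * ‖frameCoord (F s) (deriv F s)‖ :=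
            mul_le_mul (le_of_lt (hab hs).1) (hle s) (norm_nonneg _) (by positivity)
          rw [h1]
          linarith [abs_add_le (frameCoord (F s) (deriv F s)).snd
            (symp (F s).fst (deriv F s).fst)])))
  refine ⟨WithLp.toLp 2 (y, x), ?_⟩
  have h1 := (((inlL n).continuous.tendsto y).comp hy).add (((inrL n).continuous.tendsto x).comp hx)
  have h2 : inlL n y + inrL n x = WithLp.toLp 2 (y, x) := by
    refine Space.ext ?_ ?_ <;> simp
  rw [h2] at h1
  refine h1.congr fun s => ?_
  refine Space.ext ?_ ?_ <;> simp

/-- A curve of finite length has an ambient limit, which lies in the closed image; the inducing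
property pulls the convergence back to `M`. -/
theorem isCompleteImmersion_of_isInducing {f : M → Space n}
    (hf : ContMDiff (𝓡 (2 * n)) 𝓘(ℝ, Space n) 2 f) (hi : IsInducing f)
    (hcl : IsClosed (range f)) : IsCompleteImmersion f := by
  intro σ hσ hint
  have hF : ContDiffOn ℝ 1 (fun s => f (σ s)) (Ioo 0 1) :=
    ((hf.of_le one_le_two).comp_contMDiffOn hσ).contDiffOn
  obtain ⟨y, hy⟩ := exists_tendsto_of_finite_length hF hint
  obtain ⟨q, rfl⟩ := hcl.mem_of_tendsto hy (Eventually.of_forall fun s => mem_range_self (σ s))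
  exact ⟨q, hi.tendsto_nhds_iff.2 hy⟩

end Converse

/-! ### Minimality of the planes and of the catenoids. -/

section Minimal

open Filter Topology Set

variable {n : ℕ}

/-- `α` and `w` are the radial and the rotational component of the horizontal normal of the
hypersurface parametrized by `Ψ`, and satisfy the minimal surface equation. -/
structure HasMinimalNormal (U : Set (EuclideanSpace ℂ (Fin n)))
    (Ψ : EuclideanSpace ℂ (Fin n) → Space n) (α w : EuclideanSpace ℂ (Fin n) → ℝ) : Prop where
  differentiableAt_fst : ∀ u ∈ U, DifferentiableAt ℝ α u
  differentiableAt_snd : ∀ u ∈ U, DifferentiableAt ℝ w u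
  sq_add_sq : ∀ u ∈ U, α u ^ 2 + w u ^ 2 = 1
  tangent : ∀ u ∈ U, ∀ e, α u * inner ℝ (Ψ u).fst (fderiv ℝ Ψ u e).fst
    = w u * (fderiv ℝ Ψ u e).snd
  equation : ∀ u ∈ U, (Ψ u).fst ≠ 0 → ∃ α' w' : ℝ, α u * α' + w u * w' = 0 ∧
    (∀ e, fderiv ℝ α u e = (w u * inner ℝ (Ψ u).fst (fderiv ℝ Ψ u e).fst
      + α u * (fderiv ℝ Ψ u e).snd) * α') ∧
    (∀ e, fderiv ℝ w u e = (w u * inner ℝ (Ψ u).fst (fderiv ℝ Ψ u e).fst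
      + α u * (fderiv ℝ Ψ u e).snd) * w') ∧
    ‖(Ψ u).fst‖ * (w u * α' - α u * w') + (2 * n - 1) * (α u * ‖(Ψ u).fst‖⁻¹) = 0
  vertical : ∀ u ∈ U, (Ψ u).fst = 0 → ∀ v, ∃ e, fderiv ℝ Ψ u e = WithLp.toLp 2 (v, 0)

theorem unitNormal_smul (ε α w : ℝ) (z : EuclideanSpace ℂ (Fin n)) (hε : ε ^ 2 = 1) :
    unitNormal (ε * α) (ε * w) z = ε • unitNormal α w z := by
  have : (ε * w * ‖z‖⁻¹) ^ 2 = (w * ‖z‖⁻¹) ^ 2 := by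
    rw [mul_assoc, mul_pow, hε, one_mul]
  rw [unitNormal, unitNormal, this, smul_comm ε]
  congr 1
  refine Space.ext ?_ ?_
  · simp only [WithLp.toLp_fst, WithLp.smul_fst]
    module
  · simp only [WithLp.toLp_snd, WithLp.smul_snd, smul_eq_mul]
    ring

/-- Two unit vectors orthogonal to an orthonormal family of corank one agree up to sign. -/
theorem sq_inner_eq_one_of_normal {u : Fin (2 * n) → Space n} (hu : Orthonormal ℝ u)
    {N V : Space n} (hN : ‖N‖ = 1) (hV : ‖V‖ = 1) (hNu : ∀ i, inner ℝ N (u i) = 0)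
    (hVu : ∀ i, inner ℝ V (u i) = 0) : inner ℝ V N ^ 2 = 1 := by
  have h := sum_inner_mul_inner_of_normal hu hN hNu V V
  simp only [hVu, mul_zero, Finset.sum_const_zero, real_inner_self_eq_norm_sq, hV] at h
  linarith

theorem eq_smul_of_inner_eq {N V : Space n} (hN : ‖N‖ = 1) (hV : ‖V‖ = 1) {ε : ℝ}
    (hε : ε ^ 2 = 1) (h : inner ℝ V N = ε) : N = ε • V := by
  rw [← sub_eq_zero, ← norm_eq_zero, ← sq_eq_zero_iff, norm_sub_sq_real, norm_smul,
    inner_smul_right, real_inner_comm, h, hN, hV, mul_one, Real.norm_eq_abs, sq_abs]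
  linarith

variable {M : Type*} [TopologicalSpace M] [ChartedSpace (EuclideanSpace ℝ (Fin (2 * n))) M]
  {U : Set (EuclideanSpace ℂ (Fin n))} {Ψ : EuclideanSpace ℂ (Fin n) → Space n}
  {P : Space n → EuclideanSpace ℂ (Fin n)} {φ : M → EuclideanSpace ℂ (Fin n)}
  {κ : EuclideanSpace ℂ (Fin n) → M} {α w : EuclideanSpace ℂ (Fin n) → ℝ}

/-- Minimality quantifies over all local unit normals. Corank one leaves only the explicit normal
and its opposite, and the mean curvature formula is homogeneous under this change of sign. -/
theorem HasMinimalNormal.isMinimal (hm : HasMinimalNormal U Ψ α w)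
    (hφ : IsGlobalCoordinate U φ κ) (hΨ : IsParametrization U Ψ P) :
    IsMinimal (Ψ ∘ φ) := by
  intro W N hW hN p hp hreg e he
  have hΨc : ∀ q, ContDiffAt ℝ 2 Ψ (φ q) := fun q =>
    hΨ.contDiffOn.contDiffAt (hΨ.isOpen.mem_nhds (hφ.mem q))
  have hdΨ : ∀ q, HasFDerivAt Ψ (fderiv ℝ Ψ (φ q)) (φ q) := fun q =>
    ((hΨc q).differentiableAt two_ne_zero).hasFDerivAt
  have hdφ : ∀ q, HasMFDerivAt (𝓡 (2 * n)) 𝓘(ℝ, EuclideanSpace ℂ (Fin n)) φ q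
      (mfderiv (𝓡 (2 * n)) 𝓘(ℝ, EuclideanSpace ℂ (Fin n)) φ q) := fun q =>
    (hφ.contMDiff.contMDiffAt.mdifferentiableAt two_ne_zero).hasMFDerivAt
  have hdf : ∀ q e, dirDeriv (Ψ ∘ φ) q e = fderiv ℝ Ψ (φ q)
      (mfderiv (𝓡 (2 * n)) 𝓘(ℝ, EuclideanSpace ℂ (Fin n)) φ q e) := fun q e =>
    dirDeriv_eq_comp (hdφ q) (hdΨ q) EventuallyEq.rfl e
  -- At a point on the axis the tangent space contains every horizontal vector, so the normal is
  -- vertical and the point is not regular.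
  have hz0 : (Ψ (φ p)).fst ≠ 0 := by
    intro h0
    refine hreg (Space.ext (?_ : (N p).fst = 0) rfl)
    obtain ⟨a, ha⟩ := hm.vertical _ (hφ.mem p) h0 (N p).fst
    obtain ⟨b, hb⟩ := hφ.surjective_mfderiv hΨ.isOpen p a
    have h1 := hN.normal p hp b
    rw [push, hdf, hb, ha, inner_eq] at h1
    simpa [frameCoord, symp_eq, h0] using h1
  set V : M → Space n := fun q => unitNormal (α (φ q)) (w (φ q)) (Ψ (φ q)).fst with hV
  have hφc := hφ.contMDiff.continuous
  have hzc : Continuous fun q => (Ψ (φ q)).fst :=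
    (fstL n).continuous.comp (hφ.contMDiff_comp hΨ).continuous
  have hz : ∀ᶠ q in 𝓝 p, (Ψ (φ q)).fst ≠ 0 := hzc.continuousAt.eventually_ne hz0
  have hV1 : ∀ q, (Ψ (φ q)).fst ≠ 0 → ‖V q‖ = 1 := fun q hq =>
    norm_unitNormal hq (hm.sq_add_sq _ (hφ.mem q))
  have hsq : ∀ q ∈ W, (Ψ (φ q)).fst ≠ 0 → inner ℝ (V q) (N q) ^ 2 = 1 := by
    intro q hq hzq
    obtain ⟨b, hb⟩ := exists_orthonormal_push (hφ.injective_mfderiv hΨ q)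
    refine sq_inner_eq_one_of_normal hb (hN.norm_eq_one q hq) (hV1 q hzq)
      (fun i => hN.normal q hq _) fun i => inner_unitNormal ?_
    rw [push, hdf]
    simpa [frameCoord] using hm.tangent _ (hφ.mem q) _
  have hVc : ContinuousAt V p := by
    have h1 : ContinuousAt (fun q => α (φ q)) p :=
      ContinuousAt.comp (hm.differentiableAt_fst _ (hφ.mem p)).continuousAt hφc.continuousAt
    have h2 : ContinuousAt (fun q => w (φ q)) p :=
      ContinuousAt.comp (hm.differentiableAt_snd _ (hφ.mem p)).continuousAt hφc.continuousAt
    have h3 : ContinuousAt (fun q => ‖(Ψ (φ q)).fst‖⁻¹) p :=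
      hzc.continuousAt.norm.inv₀ (norm_ne_zero_iff.2 hz0)
    have hs : Real.sqrt (1 + (w (φ p) * ‖(Ψ (φ p)).fst‖⁻¹) ^ 2) ≠ 0 :=
      (Real.sqrt_pos.2 (by positivity)).ne'
    have h4 : ContinuousAt (fun q => (Real.sqrt (1 + (w (φ q) * ‖(Ψ (φ q)).fst‖⁻¹) ^ 2))⁻¹) p :=
      ((continuousAt_const.add ((h2.mul h3).pow 2)).sqrt).inv₀ hs
    have h5 := h4.smul (((inlL n).continuous.continuousAt.comp (h3.smul
      ((h1.smul hzc.continuousAt).add (h2.smul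
        ((mulIL n).continuous.continuousAt.comp hzc.continuousAt))))).add
        ((inrL n).continuous.continuousAt.comp (h2.mul h3).neg))
    refine h5.congr (Eventually.of_forall fun q => ?_)
    simp only [hV, unitNormal]
    refine Space.ext ?_ ?_ <;> simp
  -- The sign relating the two normals. Their inner product is continuous with square one, so it
  -- equals `ε` wherever it stays within distance one of `ε`, as `-ε` is at distance two.
  set ε := inner ℝ (V p) (N p) with hε
  have hε1 : ε ^ 2 = 1 := hsq p hp hz0
  have hic : ContinuousAt (fun q => inner ℝ (V q) (N q)) p :=
    hVc.inner ((hN.contMDiffOn.continuousOn).continuousAt (hW.mem_nhds hp))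
  have hNV : ∀ᶠ q in 𝓝 p,
      N q = unitNormal (ε * α (φ q)) (ε * w (φ q)) (Ψ (φ q)).fst := by
    filter_upwards [hz, hW.mem_nhds hp, hic.eventually (Metric.ball_mem_nhds _ one_pos)]
      with q hq hqW hball
    rw [unitNormal_smul _ _ _ _ hε1]
    refine eq_smul_of_inner_eq (hN.norm_eq_one q hqW) (hV1 q hq) hε1 ?_
    have h1 := hsq q hqW hq
    rw [Real.dist_eq, ← hε] at hball
    have h2 := abs_lt.1 hball
    rcases sq_eq_sq_iff_eq_or_eq_neg.1 (h1.trans hε1.symm) with h | h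
    · exact h
    · nlinarith [h2.1, h2.2]
  have hhN : horizontalNormal N =ᶠ[𝓝 p]
      (fun y => radialNormal (ε * α y) (ε * w y) (Ψ y).fst) ∘ φ := by
    filter_upwards [hNV, hz] with q hq hzq
    have h1 : (ε * α (φ q)) ^ 2 + (ε * w (φ q)) ^ 2 = 1 := by
      rw [mul_pow, mul_pow, ← mul_add, hm.sq_add_sq _ (hφ.mem q), hε1, mul_one]
    rw [horizontalNormal, hq]
    exact horizontalNormal_unitNormal (z := fun q => (Ψ (φ q)).fst) (α := fun q => ε * α (φ q))
      (w := fun q => ε * w (φ q)) hzq h1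
  obtain ⟨α', w', h2, hα', hw', heq⟩ := hm.equation _ (hφ.mem p) hz0
  have hdα := (hm.differentiableAt_fst _ (hφ.mem p)).hasFDerivAt.const_mul ε
  have hdw := (hm.differentiableAt_snd _ (hφ.mem p)).hasFDerivAt.const_mul ε
  rw [meanCurvature_eq (hdφ p) (hdΨ p) EventuallyEq.rfl hdα hdw hhN hz0 (α' := α') (w' := w')
    ?_ ?_ ?_ ?_ ?_ he]
  · linear_combination -(1 / (2 * (n : ℝ))) * ε * heq
  · rw [mul_pow, mul_pow, ← mul_add, hm.sq_add_sq _ (hφ.mem p), hε1, mul_one]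
  · linear_combination ε * h2
  · intro a
    linear_combination ε * hm.tangent _ (hφ.mem p) a
  · intro a
    simp only [smul_apply, smul_eq_mul, hα' a]
    ring
  · intro a
    simp only [smul_apply, smul_eq_mul, hw' a]
    ring

theorem HasMinimalNormal.isEmbeddedCompleteMinimalOfRevolution
    (hm : HasMinimalNormal U Ψ α w) (hΨ : IsParametrization U Ψ P)
    (hR : ∀ (R : EuclideanSpace ℂ (Fin n) ≃ₗᵢ[ℝ] EuclideanSpace ℂ (Fin n)), ∀ u ∈ U,
      R u ∈ U ∧ Ψ (R u) = rotate R (Ψ u)) (hcl : IsClosed (Ψ '' U)) :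
    IsEmbeddedCompleteMinimalOfRevolution (Ψ '' U) := by
  have : Nonempty U := hΨ.isConnected.nonempty.to_subtype
  obtain ⟨_, hM, κ, hφ⟩ := exists_isGlobalCoordinate hΨ.isOpen
  have hrange := hφ.range_comp (Ψ := Ψ)
  exact ⟨U, inferInstance, _, Ψ ∘ Subtype.val, hM, inferInstance, inferInstance,
    isConnected_iff_connectedSpace.1 hΨ.isConnected, hφ.isHypersurfaceOfRevolution hΨ hR,
    hm.isMinimal hφ hΨ, isCompleteImmersion_of_isInducing (hφ.contMDiff_comp hΨ)
      (hφ.isInducing hΨ) (hrange ▸ hcl), hφ.isEmbedding hΨ, hrange⟩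

/-! ### The two families -/

theorem hasFDerivAt_planeMap (c : ℝ) (u : EuclideanSpace ℂ (Fin n)) :
    HasFDerivAt (planeMap n c) (inlL n) u := by
  refine ((inlL n).hasFDerivAt.add_const (inrL n c)).congr_of_eventuallyEq
    (Eventually.of_forall fun u => ?_)
  refine Space.ext ?_ ?_ <;> simp [planeMap]

theorem hasMinimalNormal_plane (c : ℝ) :
    HasMinimalNormal (univ : Set (EuclideanSpace ℂ (Fin n))) (planeMap n c)
      (fun _ => 0) (fun _ => 1) := by
  refine ⟨fun u _ => differentiableAt_const _, fun u _ => differentiableAt_const _,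
    fun u _ => by norm_num, fun u _ e => ?_, fun u _ _ => ⟨0, 0, by simp, by simp, by simp, by simp⟩,
    fun u _ _ v => ⟨v, ?_⟩⟩
  · rw [(hasFDerivAt_planeMap c u).fderiv]; simp
  · rw [(hasFDerivAt_planeMap c u).fderiv]; refine Space.ext ?_ ?_ <;> simp

theorem isEmbeddedCompleteMinimalOfRevolution_hyperplane (c : ℝ) :
    IsEmbeddedCompleteMinimalOfRevolution (hyperplane n c) := by
  rw [← planeMap_image]
  refine (hasMinimalNormal_plane c).isEmbeddedCompleteMinimalOfRevolution
    (isParametrization_plane c) (fun R u _ => ⟨trivial, rfl⟩) ?_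
  rw [planeMap_image]
  exact isClosed_eq (sndL n).continuous continuous_const

theorem hasFDerivAt_log_norm {u : EuclideanSpace ℂ (Fin n)} (hu : u ≠ 0) :
    HasFDerivAt (fun u : EuclideanSpace ℂ (Fin n) => Real.log ‖u‖)
      (fderiv ℝ (fun u : EuclideanSpace ℂ (Fin n) => Real.log ‖u‖) u) u :=
  (((contDiffAt_norm (n := 1) ℝ hu).differentiableAt one_ne_zero).log
    (norm_ne_zero_iff.2 hu)).hasFDerivAt

theorem fderiv_catenoidMap_snd (hn : 1 ≤ n) {E : ℝ} (hE : 0 < E) (c : ℝ)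
    {u : EuclideanSpace ℂ (Fin n)} (hu : u ≠ 0) (e : EuclideanSpace ℂ (Fin n)) :
    (fderiv ℝ (catenoidMap n E c) u e).snd
      = profileRadius n E (Real.log ‖u‖) ^ 2 / ((2 * (n : ℝ) - 1) * Real.cosh (Real.log ‖u‖))
        * fderiv ℝ (fun u : EuclideanSpace ℂ (Fin n) => Real.log ‖u‖) u e := by
  have hΨ := isParametrization_catenoid hn hE c
  have hd := ((hΨ.contDiffOn.contDiffAt (hΨ.isOpen.mem_nhds hu)).differentiableAt
    two_ne_zero).hasFDerivAt
  have h1 := (sndL n).hasFDerivAt.comp u hd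
  have h2 : HasFDerivAt (sndL n ∘ catenoidMap n E c) _ u :=
    ((hasDerivAt_profileHeight hn hE _).comp_hasFDerivAt u (hasFDerivAt_log_norm hu)).const_add c
  exact DFunLike.congr_fun (h1.unique h2) e

theorem inner_fderiv_catenoidMap_fst (hn : 1 ≤ n) {E : ℝ} (hE : 0 < E) (c : ℝ)
    {u : EuclideanSpace ℂ (Fin n)} (hu : u ≠ 0) (e : EuclideanSpace ℂ (Fin n)) :
    inner ℝ (catenoidMap n E c u).fst (fderiv ℝ (catenoidMap n E c) u e).fst
      = profileRadius n E (Real.log ‖u‖) ^ 2 * Real.sinh (Real.log ‖u‖)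
        / ((2 * (n : ℝ) - 1) * Real.cosh (Real.log ‖u‖))
        * fderiv ℝ (fun u : EuclideanSpace ℂ (Fin n) => Real.log ‖u‖) u e := by
  have hΨ := isParametrization_catenoid hn hE c
  have hd := ((hΨ.contDiffOn.contDiffAt (hΨ.isOpen.mem_nhds hu)).differentiableAt
    two_ne_zero).hasFDerivAt
  have h1 := ((fstL n).hasFDerivAt.comp u hd).norm_sq
  have h2 := ((hasDerivAt_profileRadius hn hE _).comp_hasFDerivAt u
    (hasFDerivAt_log_norm hu)).pow 2
  have h3 : (fun u => ‖(fstL n ∘ catenoidMap n E c) u‖ ^ 2) =ᶠ[𝓝 u]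
      fun u => (profileRadius n E ∘ fun u : EuclideanSpace ℂ (Fin n) => Real.log ‖u‖) u ^ 2 := by
    filter_upwards [isOpen_compl_singleton.mem_nhds hu] with v hv
    exact congrArg (· ^ 2) (norm_catenoidMap_fst hE c hv)
  have h4 := DFunLike.congr_fun (h1.unique (h2.congr_of_eventuallyEq h3)) e
  simp only [smul_apply, smul_eq_mul, Function.comp_apply, ContinuousLinearMap.comp_apply,
    fstL_apply, innerSL_apply_apply] at h4
  simp only [nsmul_eq_mul, Nat.cast_ofNat, Nat.add_one_sub_one, pow_one] at h4
  linear_combination h4 / 2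

/-- On the catenoid `w / α = sinh θ` with `θ = log ‖u‖`, so the unit direction is `α = 1 / cosh θ`,
`w = tanh θ`. -/
theorem hasMinimalNormal_catenoid (hn : 1 ≤ n) {E : ℝ} (hE : 0 < E) (c : ℝ) :
    HasMinimalNormal ({0}ᶜ : Set (EuclideanSpace ℂ (Fin n))) (catenoidMap n E c)
      (fun u => (Real.cosh (Real.log ‖u‖))⁻¹)
      (fun u => Real.sinh (Real.log ‖u‖) / Real.cosh (Real.log ‖u‖)) := by
  have hα : ∀ u ∈ ({0}ᶜ : Set (EuclideanSpace ℂ (Fin n))), HasFDerivAt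
      (fun u : EuclideanSpace ℂ (Fin n) => (Real.cosh (Real.log ‖u‖))⁻¹)
      ((-Real.sinh (Real.log ‖u‖) / Real.cosh (Real.log ‖u‖) ^ 2) •
        fderiv ℝ (fun u : EuclideanSpace ℂ (Fin n) => Real.log ‖u‖) u) u := fun u hu =>
    ((Real.hasDerivAt_cosh _).inv (Real.cosh_pos _).ne').comp_hasFDerivAt u
      (hasFDerivAt_log_norm hu)
  have hw : ∀ u ∈ ({0}ᶜ : Set (EuclideanSpace ℂ (Fin n))), HasFDerivAt
      (fun u : EuclideanSpace ℂ (Fin n) => Real.sinh (Real.log ‖u‖) / Real.cosh (Real.log ‖u‖))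
      (((Real.cosh (Real.log ‖u‖) * Real.cosh (Real.log ‖u‖)
        - Real.sinh (Real.log ‖u‖) * Real.sinh (Real.log ‖u‖)) / Real.cosh (Real.log ‖u‖) ^ 2) •
        fderiv ℝ (fun u : EuclideanSpace ℂ (Fin n) => Real.log ‖u‖) u) u := fun u hu =>
    ((Real.hasDerivAt_sinh _).div (Real.hasDerivAt_cosh _)
      (Real.cosh_pos _).ne').comp_hasFDerivAt u (hasFDerivAt_log_norm hu)
  have hm := two_mul_sub_one_pos hn
  refine ⟨fun u hu => (hα u hu).differentiableAt, fun u hu => (hw u hu).differentiableAt,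
    fun u hu => ?_, fun u hu e => ?_, fun u hu _ => ?_, fun u hu h0 => ?_⟩
  · have := Real.cosh_pos (Real.log ‖u‖)
    have h := Real.cosh_sq (Real.log ‖u‖)
    field_simp
    linarith
  · rw [fderiv_catenoidMap_snd hn hE c hu, inner_fderiv_catenoidMap_fst hn hE c hu]
    have := Real.cosh_pos (Real.log ‖u‖)
    field_simp
  · simp only [fderiv_catenoidMap_snd hn hE c hu, inner_fderiv_catenoidMap_fst hn hE c hu,
      (hα u hu).fderiv, (hw u hu).fderiv, norm_catenoidMap_fst hE c hu,
      smul_apply, smul_eq_mul]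
    set θ := Real.log ‖u‖
    have hc := Real.cosh_pos θ
    have hcs := Real.cosh_sq θ
    have hr := profileRadius_pos (n := n) hE θ
    set r := profileRadius n E θ
    -- These are `-w μ` and `α μ` for the curvature `μ = (2n - 1) α / r²` demanded by the minimal
    -- surface equation.
    refine ⟨-((2 * (n : ℝ) - 1) * (Real.sinh θ / Real.cosh θ ^ 2) / r ^ 2),
      (2 * (n : ℝ) - 1) / Real.cosh θ ^ 2 / r ^ 2, ?_, fun e => ?_, fun e => ?_, ?_⟩
    · field_simp
      ring
    · field_simp
      rw [hcs]
      ring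
    · field_simp
      rw [hcs]
      ring
    · field_simp
      rw [hcs]
      ring
  · have h := norm_catenoidMap_fst hE c hu
    rw [h0, norm_zero] at h
    exact absurd h (profileRadius_pos hE _).ne

theorem isEmbeddedCompleteMinimalOfRevolution_catenoid (hn : 1 ≤ n) {E : ℝ} (hE : 0 < E) (c : ℝ) :
    IsEmbeddedCompleteMinimalOfRevolution (catenoid n E c) := by
  rw [← catenoidMap_image hn hE]
  refine (hasMinimalNormal_catenoid hn hE c).isEmbeddedCompleteMinimalOfRevolution
    (isParametrization_catenoid hn hE c) (fun R u hu => ⟨?_, ?_⟩) ?_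
  · exact fun h => hu (by simpa using h)
  · refine Space.ext ?_ ?_
    · simp [catenoidMap, rotate]
    · simp [catenoidMap, rotate]
  · rw [catenoidMap_image hn hE]
    exact isClosed_catenoid hn hE c

end Minimal

end Heisenberg

end

theorem mainTheorem6 (n : ℕ) (hn : 1 ≤ n) :
    (∀ (M : Type*) [TopologicalSpace M] [ChartedSpace (EuclideanSpace ℝ (Fin (2 * n))) M]
        [IsManifold (𝓡 (2 * n)) 2 M] [T2Space M] [SecondCountableTopology M] [ConnectedSpace M]
        (f : M → Heisenberg.Space n),
        Heisenberg.IsHypersurfaceOfRevolution f → Heisenberg.IsMinimal f →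
        (∃ c : ℝ, Set.range f ⊆ Heisenberg.hyperplane n c ∧
            (Heisenberg.IsCompleteImmersion f → Set.range f = Heisenberg.hyperplane n c)) ∨
        (∃ E c : ℝ, 0 < E ∧ Set.range f ⊆ Heisenberg.catenoid n E c ∧
            (Heisenberg.IsCompleteImmersion f → Set.range f = Heisenberg.catenoid n E c))) ∧
    (∀ c : ℝ, Heisenberg.IsEmbeddedCompleteMinimalOfRevolution (Heisenberg.hyperplane n c)) ∧
    (∀ E c : ℝ, 0 < E →
      Heisenberg.IsEmbeddedCompleteMinimalOfRevolution (Heisenberg.catenoid n E c)) := ⟨fun M _ _ _ _ _ _ f hf hmin => Heisenberg.classification hn hf hmin,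
    fun c => Heisenberg.isEmbeddedCompleteMinimalOfRevolution_hyperplane c,
    fun E c hE => Heisenberg.isEmbeddedCompleteMinimalOfRevolution_catenoid hn hE c⟩
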